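/- Let $G$ be a finite, connected, simple, non-bipartite graph with vertex set $V$ and edge set $E$, let $\mathbb K$ be a field, and let $$I_G=\Big\langle \prod_{e\in E} e^{u_e}-\prod_{e\in E} e^{v_e}\ :\ u,v\in\mathbb N^E,\ \sum_{e\in E} u_e a_e=\sum_{e\in E} v_e a_e\Big\rangle\subseteq\mathbb K[e: e\in E]$$ be its toric ideal, where $a_e\in\mathbb N^V$ is the indicator vector of the two endpoints of $e$. Then the following are equivalent. 1. $I_G$ is generated by homogeneous polynomials of degree $2$ (the zero ideal is included), and $I_G$ is robust, that is, its universal Gröbner basis (the union of all its reduced Gröbner bases over all term orders, with $f$ and $-f$ regarded as the same element) is a minimal generating set of $I_G$. 2. Exactly one block $B$ of $G$ is non-bipartite; every other block is a cut edge or a $K_{2,\ell}$ with $\ell\ge 2$; and $B$ is a $K_{2,\ell}\cup\{e\}$, a double-$K_{2,(r,s)}$, or a necklace-$K_{2,\ell}$ graph. Here a block is a maximal connected subgraph without a cut vertex of its own, and graphs are taken up to isomorphism. * A $K_{2,\ell}\cup\{e\}$ is a complete bipartite graph $K_{2,\ell}$ ($\ell\ge2$) with one new edge $e$ joining two distinct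 non-adjacent vertices. * A double-$K_{2,(r,s)}$ ($r,s\ge2$) is obtained from the disjoint union of a $K_{2,r}\cup\{e\}$ and a $K_{2,s}$ by identifying $e$ with an edge of $K_{2,s}$ (the identified edge is kept). * A necklace-$K_{2,\ell}$ graph is obtained as follows. Let $R$ be a bipartite graph with $k\ge2$ blocks, each of which is a cut edge or a $K_{2,n}$ with $n\ge2$, whose block tree (the bipartite graph on the blocks and the cut vertices of $R$, a block being joined to the cut vertices it contains) is a path with end blocks $B_1$ and $B_k$. Let $x_1\in V(B_1)$ and $x_2\in V(B_k)$ be non-adjacent vertices at odd distance in $R$, neither of which is a cut vertex of $R$. Identify $x_1$ and $x_2$. In particular, $B$ is not a $K_4$. -/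

import Mathlib

/-! ### Toric ideals, universal Gröbner bases, robustness -/

namespace ToricGraph

section Algebra

variable {σ ι : Type*}

/-- The toric ideal `I_A ⊆ K[x_i | i ∈ σ]` of a family `A` of vectors of natural numbers: it is
generated by all binomials `x^u - x^v` whose two terms have the same `A`-degree. -/
noncomputable def toricIdeal (K : Type*) [Field K] (A : σ → ι → ℕ) :
    Ideal (MvPolynomial σ K) :=
  Ideal.span {f | ∃ u v : σ →₀ ℕ,
    Finsupp.linearCombination ℕ A u = Finsupp.linearCombination ℕ A v ∧
    f = MvPolynomial.monomial u 1 - MvPolynomial.monomial v 1}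

/-- `B` is a reduced Gröbner basis of `I` with respect to the term order `m`. For exponent vectors,
`≤` is the componentwise order, that is, divisibility of monomials. -/
structure IsReducedGroebnerBasis {K : Type*} [Field K] (m : MonomialOrder σ)
    (I : Ideal (MvPolynomial σ K)) (B : Set (MvPolynomial σ K)) : Prop where
  subset : ∀ g ∈ B, g ∈ I
  monic : ∀ g ∈ B, m.Monic g
  initial : ∀ f ∈ I, f ≠ 0 → ∃ g ∈ B, m.degree g ≤ m.degree f
  reduced : ∀ g ∈ B, ∀ g' ∈ B, g' ≠ g → ∀ u ∈ g.support, ¬ m.degree g' ≤ u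

end Algebra

universe u w

/-- The union of all reduced Gröbner bases of `I`, over all term orders. -/
def universalGroebnerBasis {σ : Type u} {K : Type w} [Field K]
    (I : Ideal (MvPolynomial σ K)) : Set (MvPolynomial σ K) :=
  {f | ∃ (m : MonomialOrder.{u, u} σ) (B : Set (MvPolynomial σ K)),
    IsReducedGroebnerBasis m I B ∧ f ∈ B}

/-- `I` is robust: its universal Gröbner basis is a minimal set of generators of `I`.
As usual, elements of the universal Gröbner basis are taken up to a nonzero scalar (for a toric
ideal, `f` and `-f` are the same element): `S` picks one element of each class. -/
def IsRobust {σ : Type u} {K : Type w} [Field K] (I : Ideal (MvPolynomial σ K)) : Prop :=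
  ∃ S ⊆ universalGroebnerBasis I,
    (∀ f ∈ universalGroebnerBasis I, ∃! g, g ∈ S ∧ Associated g f) ∧
    Minimal (fun T : Set (MvPolynomial σ K) => Ideal.span T = I) S

/-- `I` is generated by quadrics (the zero ideal is, by the empty set). -/
def IsGeneratedByQuadrics {σ : Type u} {K : Type w} [Field K]
    (I : Ideal (MvPolynomial σ K)) : Prop :=
  ∃ S : Set (MvPolynomial σ K), (∀ f ∈ S, f.IsHomogeneous 2) ∧ Ideal.span S = I

open Classical in
/-- The vector `a_e = v_i + v_j` of an edge `e = {v_i, v_j}`. -/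
noncomputable def edgeVector {V : Type u} (G : SimpleGraph V) (e : G.edgeSet) : V → ℕ :=
  fun v => if v ∈ (e : Sym2 V) then 1 else 0

/-- The toric ideal `I_G` of a graph, in the polynomial ring whose variables are the edges. -/
noncomputable def graphIdeal {V : Type u} (K : Type w) [Field K] (G : SimpleGraph V) :
    Ideal (MvPolynomial G.edgeSet K) :=
  toricIdeal K (edgeVector G)

/-! ### Blocks -/

section Graphs

variable {V W V₁ V₂ : Type*}

/-- A cut vertex: its removal disconnects two vertices that were connected. -/
def IsCutVertex (G : SimpleGraph V) (v : V) : Prop :=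
  ∃ (a b : V) (ha : a ≠ v) (hb : b ≠ v), G.Reachable a b ∧
    ¬ (G.induce {v}ᶜ).Reachable ⟨a, ha⟩ ⟨b, hb⟩

/-- Connected and without cut vertices. -/
def IsBiconnected (G : SimpleGraph V) : Prop :=
  G.Connected ∧ ∀ v, ¬ IsCutVertex G v

/-- A block: a maximal biconnected subgraph. -/
def IsBlock (G : SimpleGraph V) (B : G.Subgraph) : Prop :=
  Maximal (fun H : G.Subgraph => IsBiconnected H.coe) B

/-- The subgraph `B` consists of a single cut edge of `G` with its two endpoints. -/
def IsCutEdge (G : SimpleGraph V) (B : G.Subgraph) : Prop :=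
  ∃ (a b : V) (h : G.Adj a b), G.IsBridge s(a, b) ∧ B = G.subgraphOfAdj h

/-- The complete bipartite graph `K_{2,ℓ}`. -/
abbrev K2 (l : ℕ) : SimpleGraph (Fin 2 ⊕ Fin l) :=
  completeBipartiteGraph (Fin 2) (Fin l)

/-- `G` is a `K_{2,ℓ}` for some `ℓ ≥ 2`. -/
def IsK2 (G : SimpleGraph V) : Prop :=
  ∃ l, 2 ≤ l ∧ Nonempty (G ≃g K2 l)

/-- `G` is a `K_{2,ℓ} ∪ {e}` for some `ℓ ≥ 2`: one new edge `e = {a, b}` between two (distinct,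
non-adjacent, hence on the same side) vertices of `K_{2,ℓ}`. -/
def IsK2PlusEdge (G : SimpleGraph V) : Prop :=
  ∃ l, 2 ≤ l ∧ ∃ a b : Fin 2 ⊕ Fin l, a ≠ b ∧ ¬ (K2 l).Adj a b ∧
    Nonempty (G ≃g K2 l ⊔ SimpleGraph.edge a b)

/-- `G` is a 2-clique sum of `G₁` and `G₂`, obtained by identifying the edge `{a, b}` of `G₁` with
the edge `{c, d}` of `G₂` (`a` with `c` and `b` with `d`): it is the union of a copy of `G₁` and a
copy of `G₂` that have exactly the two vertices of that edge in common. -/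
def IsEdgeSum (G₁ : SimpleGraph V₁) (a b : V₁) (G₂ : SimpleGraph V₂) (c d : V₂)
    (G : SimpleGraph W) : Prop :=
  G₁.Adj a b ∧ G₂.Adj c d ∧
  ∃ (f₁ : V₁ ↪ W) (f₂ : V₂ ↪ W), f₁ a = f₂ c ∧ f₁ b = f₂ d ∧
    Set.range f₁ ∪ Set.range f₂ = Set.univ ∧
    Set.range f₁ ∩ Set.range f₂ = {f₁ a, f₁ b} ∧
    G = G₁.map f₁ ⊔ G₂.map f₂

/-- `G` is a double-`K_{2,(r,s)}` for some `r, s ≥ 2`: a 2-clique sum of `K_{2,r} ∪ {e}` and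
`K_{2,s}`, obtained by identifying `e` with an edge of `K_{2,s}`. -/
def IsDoubleK2 (G : SimpleGraph W) : Prop :=
  ∃ r s, 2 ≤ r ∧ 2 ≤ s ∧
    ∃ (a b : Fin 2 ⊕ Fin r) (c d : Fin 2 ⊕ Fin s), a ≠ b ∧ ¬ (K2 r).Adj a b ∧
      IsEdgeSum (K2 r ⊔ SimpleGraph.edge a b) a b (K2 s) c d G

/-- The block tree of `G`: its vertices are the blocks and the cut vertices of `G`, and a block is
joined to the cut vertices that it contains. -/
def blockTree (G : SimpleGraph V) :
    SimpleGraph ({B : G.Subgraph // IsBlock G B} ⊕ {v : V // IsCutVertex G v}) :=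
  SimpleGraph.fromRel fun x y =>
    match x, y with
    | .inl B, .inr v => v.1 ∈ B.1.verts
    | _, _ => False

/-- `R` is a chain of `k + 1` blocks with first block `B` and last block `B'`: the block tree of `R`
is a path with endpoints `B` and `B'` (it then has `k + 1` blocks and `k` cut vertices). -/
def IsBlockChain (R : SimpleGraph V) (k : ℕ) (B B' : {B : R.Subgraph // IsBlock R B}) : Prop :=
  ∃ φ : SimpleGraph.pathGraph (2 * k + 1) ≃g blockTree R,
    φ 0 = Sum.inl B ∧ φ (Fin.last (2 * k)) = Sum.inl B'

/-- `G` is a necklace-`K_{2,ℓ}`: it arises from a bipartite chain `R` of at least two blocks, each a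
`K_{2,n}` with `n ≥ 2` or a cut edge, by identifying (through `π`) two non-adjacent vertices
`x₁, x₂` at odd distance, in the first and in the last block, that are not cut vertices of `R`. -/
def IsNecklaceK2 (G : SimpleGraph W) : Prop :=
  ∃ (n : ℕ) (R : SimpleGraph (Fin n)) (k : ℕ) (B B' : {B : R.Subgraph // IsBlock R B})
    (x₁ x₂ : Fin n) (π : Fin n → W),
    R.IsBipartite ∧ 1 ≤ k ∧ IsBlockChain R k B B' ∧
    (∀ C : R.Subgraph, IsBlock R C → IsK2 C.coe ∨ IsCutEdge R C) ∧
    x₁ ∈ B.1.verts ∧ x₂ ∈ B'.1.verts ∧ ¬ IsCutVertex R x₁ ∧ ¬ IsCutVertex R x₂ ∧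
    ¬ R.Adj x₁ x₂ ∧ Odd (R.dist x₁ x₂) ∧
    Function.Surjective π ∧
    (∀ a b, π a = π b ↔ a = b ∨ (a = x₁ ∧ b = x₂) ∨ (a = x₂ ∧ b = x₁)) ∧
    G = R.map π

end Graphs

end ToricGraph

/-! Everything passes through `HasSquareCircuits`: every even cycle has length 4, any two odd cycles
share two vertices, and there is no K_4. For a connected graph this follows from robustness together
with quadratic generation. Conversely it implies both, and for non-bipartite connected graphs it is
matched with the description by blocks.

From algebra to cycles. If quadrics generate the ideal, then the quadratic members of a generating
set taken from the universal Gröbner basis already generate. Minimality therefore makes the whole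
universal Gröbner basis quadratic (`degree_eq_two_of_robust`). A nonzero integral edge weighting
with zero vertex sums gives a binomial on its support. An elimination order for this support yields
an element of the universal Gröbner basis there, and a quadratic one is a 4-cycle
(`exists_square_of_vertexSum_eq_zero`). Alternating signs on an even cycle, or on two odd cycles
joined by a doubled path, give the first two conditions. A K_4 has three perfect matchings of the
same multidegree. All three differences lie in the universal Gröbner basis, and one of them is
redundant (`not_robust_of_triangle`).

From cycles to algebra. If two monomials have the same multidegree, the edges where one exceeds the
other and those where it falls short cover the same vertices. A shortest closed walk alternating
between the two sets is a 4-cycle, since otherwise two odd cycles would meet in at most one vertex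
(`exists_alternating_square`). Hence for every term order the minimal non-normal monomials are
quadratic. Without a K_4 a quadratic fiber has at most two monomials, so the quadratic binomials
form the universal Gröbner basis up to sign and none can be omitted (`HasQuadraticFibers.isRobust`).

From blocks to cycles. Each of the three families consists of two bipartite graphs with 4-cycles
only, glued along two vertices whose relative color differs in the two parts. A cycle stays in one
part and has length 4, or uses both, and then is odd and contains both gluing vertices
(`hasPoles_of_glue`).

From cycles to blocks. Odd cycles share two vertices, so they all lie in one block. The other blocks
have only 4-cycles, which makes them a `K_{2,ℓ}` or an edge (`isK2_of_cycles`). In the non-bipartite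
block take a longest odd cycle. Vertices off the cycle duplicate a vertex of the cycle, chords cut
off a 4-cycle, and these modifications exclude each other so strongly that two vertices `v`, `w` of
the cycle are untouched (`IsLongestOdd.exists_two_fixed`). The position along the cycle then gives a
coloring away from `v` and a division into two sides (`HasSquareCircuits.exists_split`). Splitting
`v` in two produces a bipartite graph in which `w` separates the two copies, and every cut vertex
lies between them. Its blocks therefore form a chain (`exists_isBlockChain`), and the block is a
necklace. This direction never needs the other two families. -/

namespace ToricGraph

/-! ### Cycles as periodic sequences, odd closed walks, ears. -/

section Cycles

variable {V W : Type*} {G : SimpleGraph V}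

/-- A cycle of length `n`, as a periodic sequence of vertices. -/
structure IsCyc (G : SimpleGraph V) (n : ℕ) (c : ℤ → V) : Prop where
  three_le : 3 ≤ n
  adj : ∀ i, G.Adj (c i) (c (i + 1))
  eq_iff : ∀ i j, c i = c j ↔ (n : ℤ) ∣ i - j

namespace IsCyc

variable {n : ℕ} {c : ℤ → V}

/-- With integer indices, rotating and reflecting a cycle are substitutions in the index. This
allows any vertex and any direction to be chosen as the start. -/
theorem shift (h : IsCyc G n c) (k : ℤ) : IsCyc G n (fun i => c (k + i)) where
  three_le := h.three_le
  adj i := by simpa [add_assoc] using h.adj (k + i)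
  eq_iff i j := by rw [h.eq_iff]; ring_nf

theorem reflect (h : IsCyc G n c) (k : ℤ) : IsCyc G n (fun i => c (k - i)) where
  three_le := h.three_le
  adj i := by
    have := (h.adj (k - (i + 1))).symm
    rwa [show k - (i + 1) + 1 = k - i by ring] at this
  eq_iff i j := by
    rw [h.eq_iff, ← dvd_neg]; ring_nf

theorem map {G' : SimpleGraph W} (h : IsCyc G n c) {f : V → W}
    (hf : ∀ i, G'.Adj (f (c i)) (f (c (i + 1)))) (hinj : ∀ i j, f (c i) = f (c j) → c i = c j) :
    IsCyc G' n (fun i => f (c i)) where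
  three_le := h.three_le
  adj := hf
  eq_iff i j := by rw [← h.eq_iff]; exact ⟨hinj i j, fun e => by rw [e]⟩

theorem mono {G' : SimpleGraph V} (h : IsCyc G n c) (hf : ∀ i, G'.Adj (c i) (c (i + 1))) :
    IsCyc G' n c := ⟨h.three_le, hf, h.eq_iff⟩

theorem adj_of_eq (h : IsCyc G n c) {i j : ℤ} (e : j = i + 1) : G.Adj (c i) (c j) := e ▸ h.adj i

theorem add_period (h : IsCyc G n c) (i : ℤ) : c (i + n) = c i :=
  (h.eq_iff _ _).2 (by simp)

theorem ne (h : IsCyc G n c) {i j : ℤ} (h1 : i < j) (h2 : j - i < n) : c i ≠ c j := by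
  rw [Ne, eq_comm, h.eq_iff]
  intro hd
  have := Int.le_of_dvd (by omega) hd
  omega

/-- Measures the arc from `c k` to `c i` as a natural number below `n`, so that arc lengths can be
compared by arithmetic. -/
theorem exists_index (h : IsCyc G n c) (k i : ℤ) : ∃ j : ℕ, j < n ∧ c i = c (k + j) := by
  have h3 := h.three_le
  refine ⟨((i - k) % n).toNat, ?_, ?_⟩
  · have := Int.emod_lt_of_pos (i - k) (show (0 : ℤ) < n by omega)
    omega
  · rw [h.eq_iff, Int.toNat_of_nonneg (Int.emod_nonneg _ (by omega))]
    have := Int.dvd_self_sub_emod (x := i - k) (m := n)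
    convert this using 1
    ring

/-- A cycle from a path together with an edge that joins its ends. -/
theorem of_path {n : ℕ} (hn : 3 ≤ n) {p : ℕ → V} (hinj : ∀ i j, i < n → j < n → p i = p j → i = j)
    (hadj : ∀ i, i + 1 < n → G.Adj (p i) (p (i + 1))) (hlast : G.Adj (p (n - 1)) (p 0)) :
    IsCyc G n (fun i => p (i % n).toNat) := by
  have hpos : (0 : ℤ) < n := by omega
  have hlt : ∀ i : ℤ, (i % n).toNat < n := fun i => by
    have := Int.emod_lt_of_pos i hpos
    have := Int.emod_nonneg i hpos.ne'
    omega
  refine ⟨hn, fun i => ?_, fun i j => ⟨fun h => ?_, fun h => ?_⟩⟩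
  · have h1 := Int.emod_lt_of_pos i hpos
    have h0 := Int.emod_nonneg i hpos.ne'
    by_cases hi : i % n + 1 = n
    · have : (i + 1) % n = 0 := by
        rw [Int.add_emod, Int.emod_eq_of_lt (a := 1) (by omega) (by omega), hi, Int.emod_self]
      simp only [this]
      have : (i % n).toNat = n - 1 := by omega
      rw [this]; exact hlast
    · have : (i + 1) % n = i % n + 1 := by
        rw [Int.add_emod, Int.emod_eq_of_lt (a := 1) (by omega) (by omega),
          Int.emod_eq_of_lt (by omega) (by omega)]
      simp only [this]
      have : (i % n + 1).toNat = (i % n).toNat + 1 := by omega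
      rw [this]; exact hadj _ (by omega)
  · have := hinj _ _ (hlt i) (hlt j) h
    have h0 := Int.emod_nonneg i hpos.ne'
    have h1 := Int.emod_nonneg j hpos.ne'
    exact Int.ModEq.dvd (show j % n = i % n by omega)
  · have : j % n = i % n := (Int.modEq_iff_dvd (n := (n : ℤ))).2 h
    simp only [this]

end IsCyc

/-- A cycle from an explicit list of vertices. -/
theorem exists_isCyc_of_list {a : V} {l : List V} (hl : 2 ≤ l.length) (hn : (a :: l).Nodup)
    (hadj : (a :: l).IsChain G.Adj) (hlast : G.Adj ((a :: l).getLast (by simp)) a) :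
    ∃ c, IsCyc G (l.length + 1) c ∧ ∀ i, c i ∈ a :: l := by
  have hlt : ∀ i, i < l.length + 1 → i < (a :: l).length := fun i hi => by simpa using hi
  refine ⟨_, IsCyc.of_path (p := fun i => (a :: l).getD i a) (by omega) ?_ ?_ ?_, ?_⟩
  · intro i j hi hj h
    simp only [List.getD_eq_getElem _ _ (hlt _ hi), List.getD_eq_getElem _ _ (hlt _ hj)] at h
    exact (hn.getElem_inj_iff).1 h
  · intro i hi
    simp only [List.getD_eq_getElem _ _ (hlt _ hi),
      List.getD_eq_getElem _ _ (hlt _ (Nat.lt_of_succ_lt hi))]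
    exact (List.isChain_iff_getElem.1 hadj) i (hlt _ hi)
  · simp only [List.getD_eq_getElem _ _ (hlt (l.length + 1 - 1) (by omega))]
    simpa [List.getLast_eq_getElem] using hlast
  · intro i
    rw [List.getD_eq_getElem?_getD]
    -- The default value `a` is itself in the list, so an index out of range does no harm.
    cases h : (a :: l)[(i % ((l.length + 1 : ℕ) : ℤ)).toNat]? with
    | none => simp
    | some x => simpa using List.mem_of_getElem? h

/-- An odd closed walk of minimal length is a cycle. -/
theorem exists_odd_isCyc (h : ¬ G.IsBipartite) : ∃ n c, IsCyc G n c ∧ Odd n := by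
  classical
  have hex : ∃ n, Odd n ∧ ∃ x : ℕ → V, x 0 = x n ∧ ∀ i < n, G.Adj (x i) (x (i + 1)) := by
    by_contra hcon
    refine h (SimpleGraph.two_colorable_iff_forall_loop_even.2 fun u w => ?_)
    by_contra hodd
    refine hcon ⟨w.length, Nat.not_even_iff_odd.1 hodd, w.getVert, by simp, fun i hi =>
      w.adj_getVert_succ hi⟩
  obtain ⟨hodd, x, h0, hadj⟩ := Nat.find_spec hex
  have hmin := fun m hm => Nat.find_min (H := hex) (m := m) hm
  generalize Nat.find hex = n at hodd h0 hadj hmin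
  have hinj : ∀ i j, i < j → j < n → x i ≠ x j := by
    intro i j hij hj he
    -- A repetition at even distance can be cut out, and one at odd distance is itself a closed walk
    -- of odd length. Either way a shorter odd closed walk results.
    rcases Nat.even_or_odd (j - i) with hev | hod
    · refine hmin (n - (j - i)) (by omega) ⟨?_, fun k => if k ≤ i then x k else x (k + (j - i)),
        ?_, ?_⟩
      · rw [Nat.odd_sub (by omega)]; simp [hodd, hev]
      · have : ¬ n - (j - i) ≤ i := by omega
        simp only [this, if_false]
        rw [show n - (j - i) + (j - i) = n by omega]; simpa using h0
      · intro k hk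
        rcases lt_trichotomy k i with hki | rfl | hki
        · simp only [show k ≤ i by omega, show k + 1 ≤ i by omega, if_true]
          exact hadj k (by omega)
        · simp only [le_refl, if_true, show ¬ k + 1 ≤ k by omega, if_false, he]
          rw [show k + 1 + (j - k) = j + 1 by omega]
          exact hadj j hj
        · simp only [show ¬ k ≤ i by omega, show ¬ k + 1 ≤ i by omega, if_false]
          rw [show k + 1 + (j - i) = k + (j - i) + 1 by omega]
          exact hadj _ (by omega)
    · refine hmin (j - i) (by omega) ⟨hod, fun k => x (i + k), ?_, fun k hk => ?_⟩
      · simp only [add_zero]; rw [he]; congr 1; omega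
      · exact hadj (i + k) (by omega)
  have h3 : 3 ≤ n := by
    by_contra hlt
    obtain ⟨k, hk⟩ := hodd
    have : n = 1 := by omega
    subst this
    exact (hadj 0 (by omega)).ne h0
  refine ⟨n, _, IsCyc.of_path (p := x) h3 ?_ (fun i hi => hadj i (by omega)) ?_, hodd⟩
  · intro i j hi hj he
    rcases lt_trichotomy i j with hij | hij | hij
    · exact absurd he (hinj i j hij hj)
    · exact hij
    · exact absurd he.symm (hinj j i hij hi)
  · have := hadj (n - 1) (by omega)
    rwa [show n - 1 + 1 = n by omega, ← h0] at this

/-- A proper 2-colouring alternates along a cycle. -/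
theorem IsCyc.color_eq_iff {n : ℕ} {c : ℤ → V} (h : IsCyc G n c) {f : V → Bool}
    (hf : ∀ x y, G.Adj x y → f x ≠ f y) (i : ℤ) (k : ℕ) : f (c (i + k)) = f (c i) ↔ Even k := by
  induction k with
  | zero => simp
  | succ k ih =>
    have := hf _ _ (h.adj (i + k))
    rw [Nat.even_add_one, ← ih]
    push_cast
    rw [← add_assoc]
    revert this
    cases f (c (i + k)) <;> cases f (c (i + k + 1)) <;> cases f (c i) <;> simp

theorem IsCyc.even_of_coloring {n : ℕ} {c : ℤ → V} (h : IsCyc G n c) {f : V → Bool}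
    (hf : ∀ x y, G.Adj x y → f x ≠ f y) : Even n := by
  rw [← h.color_eq_iff hf 0 n, h.add_period]

theorem isBipartite_iff_bool : G.IsBipartite ↔ ∃ f : V → Bool, ∀ x y, G.Adj x y → f x ≠ f y := by
  constructor
  · rintro ⟨C⟩
    refine ⟨fun x => decide (C x = 0), fun x y hxy => ?_⟩
    have := C.valid hxy
    intro he
    simp only [decide_eq_decide] at he
    apply this
    generalize C x = a at *
    generalize C y = b at *
    revert a b; decide
  · rintro ⟨f, hf⟩
    exact (SimpleGraph.Coloring.mk f (fun {x y} hxy => hf x y hxy)).colorable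

/-- A cycle closed up by an arc of a cycle and a path that meets the cycle only in its ends. -/
theorem IsCyc.exists_of_ear {n : ℕ} {c : ℤ → V} (h : IsCyc G n c) {i : ℤ} {d L : ℕ} (hd : 0 < d)
    (hdn : d < n) (hL : 0 < L) (h3 : 3 ≤ L + d) {q : ℕ → V} (h0 : q 0 = c i)
    (hq : q L = c (i + d)) (hinj : ∀ k l, k ≤ L → l ≤ L → q k = q l → k = l)
    (hout : ∀ k, 0 < k → k < L → ∀ j, q k ≠ c j) (hadj : ∀ k < L, G.Adj (q k) (q (k + 1))) :
    ∃ c', IsCyc G (L + d) c' := by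
  -- The arc from `c i` up to the vertex before `c (i + d)`, followed by the ear run backwards from
  -- `q L` to `q 1`.
  refine ⟨_, IsCyc.of_path (p := fun k => if k < d then c (i + k) else q (L + d - k)) h3 ?_ ?_ ?_⟩
  · have hlow : ∀ a b, a < d → b < d → c (i + a) = c (i + b) → a = b := by
      intro a b ha hb he
      rcases lt_trichotomy a b with hab | hab | hab
      · exact absurd he (h.ne (by omega) (by omega))
      · exact hab
      · exact absurd he.symm (h.ne (by omega) (by omega))
    have hcross : ∀ a b, a < d → ¬ b < d → b < L + d → c (i + a) ≠ q (L + d - b) := by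
      intro a b ha hb hb' he
      rcases eq_or_ne b d with rfl | hbd
      · rw [show L + b - b = L by omega, hq] at he
        exact h.ne (by omega) (by omega) he
      · exact hout (L + d - b) (by omega) (by omega) _ he.symm
    intro a b ha hb he
    split_ifs at he with h1 h2 h2
    · exact hlow a b h1 h2 he
    · exact absurd he (hcross a b h1 h2 hb)
    · exact absurd he.symm (hcross b a h2 h1 ha)
    · have := hinj _ _ (by omega) (by omega) he
      omega
  · intro k hk
    by_cases h1 : k + 1 < d
    · simp only [h1, show k < d by omega, if_true]
      push_cast
      rw [← add_assoc]
      exact h.adj _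
    · simp only [h1, if_false]
      by_cases h2 : k < d
      · have : k + 1 = d := by omega
        simp only [h2, if_true, show L + d - (k + 1) = L by omega, hq]
        exact h.adj_of_eq (by omega)
      · simp only [h2, if_false]
        have := (hadj (L + d - (k + 1)) (by omega)).symm
        rwa [show L + d - (k + 1) + 1 = L + d - k by omega] at this
  · simp only [hd, if_true]
    by_cases h1 : L + d - 1 < d
    · have hL1 : L = 1 := by omega
      subst hL1
      simp only [h1, if_true, Nat.cast_zero, add_zero]
      omega
    · simp only [h1, if_false, Nat.cast_zero, add_zero, ← h0]
      rw [show L + d - (L + d - 1) = 1 by omega]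
      exact (hadj 0 hL).symm

end Cycles

end ToricGraph

namespace ToricGraph

/-! ### Walks avoiding a set of vertices, inseparable subgraphs and blocks. -/

section Linked

variable {V W : Type*} {G : SimpleGraph V} {r : V → V → Prop} {A : Set V} {a b x y z : V}

/-- `a` and `b` are joined by a walk along `r` that avoids `A`. -/
def Linked (r : V → V → Prop) (A : Set V) : V → V → Prop :=
  Relation.ReflTransGen fun x y => r x y ∧ x ∉ A ∧ y ∉ A

theorem Linked.refl : Linked r A a a := Relation.ReflTransGen.refl

theorem Linked.trans (h : Linked r A a b) (h' : Linked r A b x) : Linked r A a x :=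
  Relation.ReflTransGen.trans h h'

theorem Linked.symm (hr : ∀ x y, r x y → r y x) (h : Linked r A a b) : Linked r A b a := by
  induction h with
  | refl => exact .refl
  | tail _ h ih => exact Relation.ReflTransGen.head ⟨hr _ _ h.1, h.2.2, h.2.1⟩ ih

theorem Linked.adj_symm (h : Linked G.Adj A a b) : Linked G.Adj A b a :=
  h.symm fun _ _ h => h.symm

theorem Linked.single (h : r a b) (ha : a ∉ A) (hb : b ∉ A) : Linked r A a b :=
  Relation.ReflTransGen.single ⟨h, ha, hb⟩

theorem Linked.image {r' : W → W → Prop} {A' : Set W} (h : Linked r A a b) (f : V → W)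
    (hf : ∀ x y, r x y → x ∉ A → y ∉ A → r' (f x) (f y) ∧ f x ∉ A' ∧ f y ∉ A') :
    Linked r' A' (f a) (f b) := by
  induction h with
  | refl => exact .refl
  | tail _ h ih => exact Relation.ReflTransGen.tail ih (hf _ _ h.1 h.2.1 h.2.2)

theorem Linked.mono {r' : V → V → Prop} {A' : Set V} (h : Linked r A a b)
    (hr : ∀ x y, r x y → r' x y) (hA : A' ⊆ A) : Linked r' A' a b :=
  h.image id fun _ _ h hx hy => ⟨hr _ _ h, fun h' => hx (hA h'), fun h' => hy (hA h')⟩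

theorem Linked.notMem (h : Linked r A a b) (ha : a ∉ A) : b ∉ A := by
  induction h with
  | refl => exact ha
  | tail _ h _ => exact h.2.2

/-- A set that is closed under steps is closed under walks. -/
theorem Linked.mem_of_closed (h : Linked r A a b) {S : Set V} (ha : a ∈ S)
    (hS : ∀ x y, r x y → x ∉ A → y ∉ A → x ∈ S → y ∈ S) : b ∈ S := by
  induction h with
  | refl => exact ha
  | tail _ h ih => exact hS _ _ h.1 h.2.1 h.2.2 ih

theorem linked_of_seq {q : ℕ → V} {k l : ℕ} (hkl : k ≤ l)
    (h : ∀ i, k ≤ i → i < l → r (q i) (q (i + 1))) (hA : ∀ i, k ≤ i → i ≤ l → q i ∉ A) :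
    Linked r A (q k) (q l) := by
  induction l, hkl using Nat.le_induction with
  | base => exact .refl
  | succ l hkl ih =>
    exact (ih (fun i h1 h2 => h i h1 (by omega)) (fun i h1 h2 => hA i h1 (by omega))).trans
      (.single (h l hkl (by omega)) (hA l hkl (by omega)) (hA _ (by omega) le_rfl))

/-- A walk contains a path to the first vertex of a given set. -/
theorem Linked.exists_path (h : Linked r A a b) (ha : a ∉ A) {S : Set V} (hb : b ∈ S) :
    ∃ (L : ℕ) (q : ℕ → V), q 0 = a ∧ q L ∈ S ∧ (∀ i < L, q i ∉ S) ∧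
      (∀ i j, i ≤ L → j ≤ L → q i = q j → i = j) ∧ (∀ i < L, r (q i) (q (i + 1))) ∧
      ∀ i ≤ L, q i ∉ A := by
  classical
  induction h using Relation.ReflTransGen.head_induction_on with
  | refl => exact ⟨0, fun _ => b, rfl, hb, by simp, by simp, by simp, by simpa⟩
  | @head a a' h _ ih =>
    obtain ⟨L, q, h0, hL, hS, hinj, hr, hA⟩ := ih h.2.2
    by_cases haS : a ∈ S
    · exact ⟨0, fun _ => a, rfl, haS, by simp, by simp, by simp, by simpa⟩
    -- If the path already found passes through `a`, it is restarted there. Otherwise `a` is put in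
    -- front.
    by_cases hex : ∃ m ≤ L, q m = a
    · obtain ⟨m, hm, rfl⟩ := hex
      refine ⟨L - m, fun i => q (m + i), rfl, by simpa [Nat.add_sub_cancel' hm] using hL,
        fun i hi => hS _ (by omega), fun i j hi hj he => ?_, fun i hi => hr (m + i) (by omega),
        fun i hi => hA _ (by omega)⟩
      have := hinj _ _ (by omega) (by omega) he
      omega
    · push Not at hex
      refine ⟨L + 1, fun i => if i = 0 then a else q (i - 1), rfl, by simpa, ?_, ?_, ?_, ?_⟩
      · intro i hi
        rcases i with - | i
        · simpa
        · simpa using hS i (by omega)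
      · intro i j hi hj he
        rcases i with - | i <;> rcases j with - | j
        · rfl
        · simp at he; exact absurd he.symm (hex j (by omega))
        · simp at he; exact absurd he (hex i (by omega))
        · simp at he; rw [hinj i j (by omega) (by omega) he]
      · intro i hi
        rcases i with - | i
        · simpa [h0] using h.1
        · simpa using hr i (by omega)
      · intro i hi
        rcases i with - | i
        · simpa
        · simpa using hA i (by omega)

theorem reachable_iff_linked : G.Reachable a b ↔ Linked G.Adj ∅ a b := by
  rw [SimpleGraph.reachable_iff_reflTransGen]
  unfold Linked
  simp

/-- Replaces reachability after deletion of a vertex by walks in the original vertex type, so that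
no subtypes are needed afterwards. -/
theorem reachable_induce_iff_linked {v : V} (ha : a ≠ v) (hb : b ≠ v) :
    (G.induce {v}ᶜ).Reachable ⟨a, ha⟩ ⟨b, hb⟩ ↔ Linked G.Adj {v} a b := by
  rw [reachable_iff_linked]
  constructor
  · intro h
    exact h.image (fun x : ({v}ᶜ : Set V) => x.1) fun x y hxy _ _ => ⟨hxy, x.2, y.2⟩
  · intro h
    unfold Linked at h
    revert ha
    induction h using Relation.ReflTransGen.head_induction_on with
    | refl => intro _; exact .refl
    | @head x y h _ ih =>
      intro ha
      refine Linked.trans (b := (⟨y, h.2.2⟩ : ({v}ᶜ : Set V))) (.single ?_ ?_ ?_) (ih h.2.2)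
      · exact h.1
      · simp
      · simp

theorem isCutVertex_iff {v : V} : IsCutVertex G v ↔ ∃ a b, a ≠ v ∧ b ≠ v ∧
    Linked G.Adj ∅ a b ∧ ¬ Linked G.Adj {v} a b := by
  unfold IsCutVertex
  constructor
  · rintro ⟨a, b, ha, hb, h1, h2⟩
    exact ⟨a, b, ha, hb, reachable_iff_linked.1 h1, by rwa [← reachable_induce_iff_linked ha hb]⟩
  · rintro ⟨a, b, ha, hb, h1, h2⟩
    exact ⟨a, b, ha, hb, reachable_iff_linked.2 h1, by rwa [reachable_induce_iff_linked ha hb]⟩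

/-- No two vertices outside `A` are separated by `A`, for sets `A` of at most one vertex. -/
theorem isBiconnected_iff : IsBiconnected G ↔ Nonempty V ∧
    ∀ A : Set V, A.Subsingleton → ∀ a b, a ∉ A → b ∉ A → Linked G.Adj A a b := by
  constructor
  · rintro ⟨hc, hcut⟩
    refine ⟨hc.nonempty, fun A hA a b ha hb => ?_⟩
    have h0 := reachable_iff_linked.1 (hc.preconnected a b)
    rcases hA.eq_empty_or_singleton with rfl | ⟨v, rfl⟩
    · exact h0
    · by_contra hcon
      exact hcut v (isCutVertex_iff.2 ⟨a, b, ha, hb, h0, hcon⟩)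
  · rintro ⟨hne, h⟩
    refine ⟨⟨fun a b => reachable_iff_linked.2 (h ∅ (by simp) a b (by simp) (by simp))⟩,
      fun v hv => ?_⟩
    obtain ⟨a, b, ha, hb, -, hn⟩ := isCutVertex_iff.1 hv
    exact hn (h {v} (by simp) a b ha hb)

theorem linked_coe_iff {H : G.Subgraph} {A : Set V} (ha : a ∈ H.verts) (hb : b ∈ H.verts) :
    Linked H.coe.Adj (Subtype.val ⁻¹' A) ⟨a, ha⟩ ⟨b, hb⟩ ↔ Linked H.Adj A a b := by
  constructor
  · intro h
    exact h.image (fun x : H.verts => x.1) fun x y hxy hx hy => ⟨hxy, hx, hy⟩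
  · intro h
    unfold Linked at h
    revert ha
    induction h using Relation.ReflTransGen.head_induction_on with
    | refl => intro _; exact .refl
    | @head x y h _ ih =>
      intro ha
      exact Linked.trans (b := (⟨y, h.1.snd_mem⟩ : H.verts)) (.single h.1 h.2.1 h.2.2)
        (ih h.1.snd_mem)

/-- A subgraph that is nonempty and that no vertex separates. -/
def Inseparable (H : G.Subgraph) : Prop :=
  H.verts.Nonempty ∧ ∀ A : Set V, A.Subsingleton → ∀ a ∈ H.verts, ∀ b ∈ H.verts,
    a ∉ A → b ∉ A → Linked H.Adj A a b

theorem isBiconnected_coe_iff {H : G.Subgraph} : IsBiconnected H.coe ↔ Inseparable H := by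
  rw [isBiconnected_iff]
  constructor
  · rintro ⟨⟨x⟩, h⟩
    refine ⟨⟨x, x.2⟩, fun A hA a ha b hb haA hbA => ?_⟩
    rw [← linked_coe_iff ha hb]
    exact h _ (hA.preimage Subtype.val_injective) _ _ haA hbA
  · rintro ⟨⟨x, hx⟩, h⟩
    refine ⟨⟨⟨x, hx⟩⟩, fun A hA a b ha hb => ?_⟩
    have := (linked_coe_iff (A := Subtype.val '' A) a.2 b.2).2
      (h _ (hA.image _) a a.2 b b.2 (by simpa) (by simpa))
    rwa [Set.preimage_image_eq _ Subtype.val_injective] at this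

theorem isBlock_iff {B : G.Subgraph} : IsBlock G B ↔ Maximal Inseparable B := by
  unfold IsBlock
  simp only [isBiconnected_coe_iff]

/-- A set of at most one vertex misses one of the two common vertices, and every remaining vertex of
either subgraph can be linked to that one. -/
theorem Inseparable.sup {H H' : G.Subgraph} (h : Inseparable H) (h' : Inseparable H')
    (hxy : x ≠ y) (hx : x ∈ H.verts) (hx' : x ∈ H'.verts) (hy : y ∈ H.verts)
    (hy' : y ∈ H'.verts) : Inseparable (H ⊔ H') := by
  refine ⟨h.1.mono (by simp), fun A hA => ?_⟩
  obtain ⟨s, hs, hs', hsA⟩ : ∃ s, s ∈ H.verts ∧ s ∈ H'.verts ∧ s ∉ A := by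
    by_cases hxA : x ∈ A
    · exact ⟨y, hy, hy', fun hyA => hxy (hA hxA hyA)⟩
    · exact ⟨x, hx, hx', hxA⟩
  have key : ∀ a ∈ (H ⊔ H').verts, a ∉ A → Linked (H ⊔ H').Adj A a s := by
    rintro a (ha | ha) haA
    · exact (h.2 A hA a ha s hs haA hsA).mono (fun _ _ h => Or.inl h) subset_rfl
    · exact (h'.2 A hA a ha s hs' haA hsA).mono (fun _ _ h => Or.inr h) subset_rfl
  intro a ha b hb haA hbA
  exact (key a ha haA).trans ((key b hb hbA).symm fun _ _ h => h.symm)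

/-- The union of the two blocks is inseparable, so by maximality it equals both of them. -/
theorem IsBlock.eq_of_two {B B' : G.Subgraph} (h : IsBlock G B) (h' : IsBlock G B')
    (hxy : x ≠ y) (hx : x ∈ B.verts) (hx' : x ∈ B'.verts) (hy : y ∈ B.verts)
    (hy' : y ∈ B'.verts) : B = B' := by
  rw [isBlock_iff] at h h'
  have hs := h.1.sup h'.1 hxy hx hx' hy hy'
  exact (h.eq_of_ge hs le_sup_left).symm.trans (h'.eq_of_ge hs le_sup_right)

theorem exists_isBlock_ge [Finite V] {H : G.Subgraph} (h : Inseparable H) :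
    ∃ B, H ≤ B ∧ IsBlock G B := by
  obtain ⟨B, h1, h2⟩ := (Set.toFinite {H : G.Subgraph | Inseparable H}).exists_le_maximal h
  exact ⟨B, h1, isBlock_iff.2 h2⟩

/-- The subgraph formed by a cycle. -/
def IsCyc.subgraph {n : ℕ} {c : ℤ → V} (h : IsCyc G n c) : G.Subgraph where
  verts := Set.range c
  Adj x y := ∃ i, (x = c i ∧ y = c (i + 1)) ∨ (y = c i ∧ x = c (i + 1))
  adj_sub := by
    rintro x y ⟨i, ⟨rfl, rfl⟩ | ⟨rfl, rfl⟩⟩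
    · exact h.adj i
    · exact (h.adj i).symm
  edge_vert := by
    rintro x y ⟨i, ⟨rfl, rfl⟩ | ⟨rfl, rfl⟩⟩ <;> exact ⟨_, rfl⟩
  symm := ⟨by
    rintro x y ⟨i, h⟩
    exact ⟨i, h.symm⟩⟩

/-- A cycle minus one vertex is a path. The index `k` marks the deleted vertex and is arbitrary if
none is deleted; every remaining vertex is reached from `c (k + 1)`. -/
theorem IsCyc.inseparable {n : ℕ} {c : ℤ → V} (h : IsCyc G n c) : Inseparable h.subgraph := by
  refine ⟨⟨c 0, 0, rfl⟩, fun A hA => ?_⟩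
  obtain ⟨k, hk⟩ : ∃ k, ∀ j, c j ∈ A → c j = c k := by
    by_cases hex : ∃ k, c k ∈ A
    · obtain ⟨k, hk⟩ := hex
      exact ⟨k, fun j hj => hA hj hk⟩
    · exact ⟨0, fun j hj => absurd ⟨j, hj⟩ hex⟩
  have h3 := h.three_le
  have hnot : ∀ j : ℕ, 1 ≤ j → j ≤ n - 1 → c (k + j) ∉ A := fun j h1 h2 hj =>
    (h.ne (by omega) (by omega) : c k ≠ c (k + j)) (hk _ hj).symm
  have hstep : ∀ i, h.subgraph.Adj (c i) (c (i + 1)) := fun i => ⟨i, Or.inl ⟨rfl, rfl⟩⟩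
  have key : ∀ a ∈ h.subgraph.verts, a ∉ A → Linked h.subgraph.Adj A (c (k + (1 : ℕ))) a := by
    rintro _ ⟨i, rfl⟩ hiA
    obtain ⟨j, hj, hij⟩ := h.exists_index k i
    rw [hij] at hiA ⊢
    rcases Nat.eq_zero_or_pos j with rfl | hpos
    -- Here the target is `c k` itself, so nothing on the cycle is deleted: walk around to `c (k + n
    -- - 1)` and take the closing edge.
    · have h1 : Linked h.subgraph.Adj A (c (k + (1 : ℕ))) (c (k + (n - 1 : ℕ))) :=
        linked_of_seq (q := fun j : ℕ => c (k + j)) (by omega)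
          (fun i _ _ => by
            have := hstep (k + i)
            push_cast
            rwa [← add_assoc]) hnot
      refine h1.trans (.single ?_ (hnot _ (by omega) le_rfl) hiA)
      have := hstep (k + (n - 1 : ℕ))
      rw [show k + ((n - 1 : ℕ) : ℤ) + 1 = k + n by omega, h.add_period] at this
      simpa using this
    · exact linked_of_seq (q := fun j : ℕ => c (k + j)) hpos (fun i _ _ => by
            have := hstep (k + i)
            push_cast
            rwa [← add_assoc]) (fun i h1 h2 => hnot i h1 (by omega))
  intro a ha b hb haA hbA
  exact ((key a ha haA).symm fun _ _ h => h.symm).trans (key b hb hbA)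

theorem IsCyc.exists_isBlock [Finite V] {n : ℕ} {c : ℤ → V} (h : IsCyc G n c) :
    ∃ B, IsBlock G B ∧ ∀ i, B.Adj (c i) (c (i + 1)) := by
  obtain ⟨B, h1, h2⟩ := exists_isBlock_ge h.inseparable
  exact ⟨B, h2, fun i => h1.2 ⟨i, Or.inl ⟨rfl, rfl⟩⟩⟩

/-- A cycle all of whose edges lie in a subgraph, as a cycle of that subgraph. -/
theorem IsCyc.coe {n : ℕ} {c : ℤ → V} (h : IsCyc G n c) {B : G.Subgraph}
    (hB : ∀ i, B.Adj (c i) (c (i + 1))) :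
    IsCyc B.coe n (fun i => ⟨c i, (hB i).fst_mem⟩) where
  three_le := h.three_le
  adj := hB
  eq_iff i j := by rw [Subtype.mk.injEq]; exact h.eq_iff i j

theorem IsCyc.of_coe {B : G.Subgraph} {n : ℕ} {c : ℤ → B.verts} (h : IsCyc B.coe n c) :
    IsCyc G n (fun i => (c i : V)) :=
  h.map (fun i => B.adj_sub (h.adj i)) fun _ _ => Subtype.ext

theorem inseparable_subgraphOfAdj (h : G.Adj a b) : Inseparable (G.subgraphOfAdj h) := by
  refine ⟨⟨a, by simp⟩, fun A hA x hx y hy hxA hyA => ?_⟩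
  simp only [SimpleGraph.subgraphOfAdj_verts, Set.mem_insert_iff, Set.mem_singleton_iff] at hx hy
  rcases hx with rfl | rfl <;> rcases hy with rfl | rfl
  · exact .refl
  · exact .single (by simp) hxA hyA
  · exact .single (by simp [Sym2.eq_swap]) hxA hyA
  · exact .refl

theorem exists_isBlock_adj [Finite V] (h : G.Adj a b) : ∃ B, IsBlock G B ∧ B.Adj a b := by
  obtain ⟨B, h1, h2⟩ := exists_isBlock_ge (inseparable_subgraphOfAdj h)
  exact ⟨B, h2, h1.2 (by simp)⟩

/-- The subgraph formed by a path `q 0, …, q L`. -/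
def pathSubgraph (G : SimpleGraph V) (q : ℕ → V) (L : ℕ)
    (h : ∀ i < L, G.Adj (q i) (q (i + 1))) : G.Subgraph where
  verts := {x | ∃ i ≤ L, x = q i}
  Adj x y := ∃ i < L, (x = q i ∧ y = q (i + 1)) ∨ (y = q i ∧ x = q (i + 1))
  adj_sub := by
    rintro x y ⟨i, hi, ⟨rfl, rfl⟩ | ⟨rfl, rfl⟩⟩
    · exact h i hi
    · exact (h i hi).symm
  edge_vert := by
    rintro x y ⟨i, hi, ⟨rfl, rfl⟩ | ⟨rfl, rfl⟩⟩
    · exact ⟨i, hi.le, rfl⟩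
    · exact ⟨i + 1, hi, rfl⟩
  symm := ⟨by
    rintro x y ⟨i, hi, h⟩
    exact ⟨i, hi, h.symm⟩⟩

/-- Adding an ear keeps a subgraph inseparable. -/
theorem Inseparable.sup_path {H : G.Subgraph} (hH : Inseparable H) {q : ℕ → V} {L : ℕ}
    (hadj : ∀ i < L, G.Adj (q i) (q (i + 1))) (hinj : ∀ i j, i ≤ L → j ≤ L → q i = q j → i = j)
    (h0 : q 0 ∈ H.verts) (hL : q L ∈ H.verts) :
    Inseparable (H ⊔ pathSubgraph G q L hadj) := by
  refine ⟨hH.1.mono (by simp), fun A hA => ?_⟩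
  set H' := H ⊔ pathSubgraph G q L hadj with hH'
  have hsym : ∀ x y, H'.Adj x y → H'.Adj y x := fun _ _ h => h.symm
  have hstep : ∀ i < L, H'.Adj (q i) (q (i + 1)) := fun i hi => Or.inr ⟨i, hi, Or.inl ⟨rfl, rfl⟩⟩
  have key : ∀ a ∈ H'.verts, a ∉ A → ∃ s ∈ H.verts, s ∉ A ∧ Linked H'.Adj A a s := by
    rintro a (ha | ⟨i, hi, rfl⟩) haA
    · exact ⟨a, ha, haA, .refl⟩
    -- At most one vertex of the path is deleted, so from `q i` one of the two directions leads to
    -- an end of the path, hence into `H`.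
    · by_cases hex : ∃ m < i, q m ∈ A
      · obtain ⟨m, hm, hmA⟩ := hex
        have hout : ∀ j, i ≤ j → j ≤ L → q j ∉ A := fun j h1 h2 hj => by
          have := hinj m j (by omega) h2 (hA hmA hj)
          omega
        exact ⟨q L, hL, hout L hi le_rfl, linked_of_seq hi (fun j _ hj => hstep j hj) hout⟩
      · push Not at hex
        have hout : ∀ j, 0 ≤ j → j ≤ i → q j ∉ A := fun j _ h2 => by
          rcases h2.lt_or_eq with h | rfl
          · exact hex j h
          · exact haA
        exact ⟨q 0, h0, hout 0 le_rfl (by omega), (linked_of_seq (Nat.zero_le i)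
          (fun j _ hj => hstep j (by omega)) hout).symm hsym⟩
  intro a ha b hb haA hbA
  obtain ⟨s, hs, hsA, has⟩ := key a ha haA
  obtain ⟨t, ht, htA, hbt⟩ := key b hb hbA
  exact has.trans (((hH.2 A hA s hs t ht hsA htA).mono (fun _ _ h => Or.inl h) subset_rfl).trans
    (hbt.symm hsym))

/-- A vertex of a block separates the block from its neighbours outside the block. -/
theorem IsBlock.not_linked {B : G.Subgraph} (hB : IsBlock G B) (hy : y ∈ B.verts)
    (hz : z ∉ B.verts) (hyz : G.Adj y z) {d : V} (hd : d ∈ B.verts) :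
    ¬ Linked G.Adj {y} z d := by
  intro hl
  obtain ⟨L, q, h0, hL, hS, hinj, hr, hA⟩ := hl.exists_path (S := B.verts)
    (by simpa using hyz.ne') hd
  -- A path from `z` back to the block, with `y` put in front, is an ear of `B`. Adding it would
  -- enlarge a maximal inseparable subgraph.
  have hadj : ∀ i < L + 1, G.Adj ((fun i => if i = 0 then y else q (i - 1)) i)
      ((fun i => if i = 0 then y else q (i - 1)) (i + 1)) := by
    intro i hi
    rcases i with - | i
    · simpa [h0] using hyz
    · simpa using hr i (by omega)
  have hins := (isBlock_iff.1 hB).1.sup_path hadj (by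
      intro i j hi hj he
      rcases i with - | i <;> rcases j with - | j
      · rfl
      · simp at he; exact absurd he.symm (hA j (by omega))
      · simp at he; exact absurd he (hA i (by omega))
      · simp at he; rw [hinj i j (by omega) (by omega) he]) (by simpa) (by simpa)
  have := (isBlock_iff.1 hB).2 hins le_sup_left
  exact hz (this.1 (Or.inr ⟨1, by omega, by simp [h0]⟩))

/-- Two vertices that no third vertex separates lie in a common block. -/
theorem exists_isBlock_of_inseparable [Finite V] (hab : a ≠ b)
    (h : ∀ A : Set V, A.Subsingleton → a ∉ A → b ∉ A → Linked G.Adj A a b) :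
    ∃ B, IsBlock G B ∧ a ∈ B.verts ∧ b ∈ B.verts := by
  classical
  obtain ⟨L, q, h0, hL, hS, hinj, hr, -⟩ :=
    (h ∅ (by simp) (by simp) (by simp)).exists_path (S := {b}) (by simp) rfl
  have hL0 : 0 < L := by
    rcases Nat.eq_zero_or_pos L with rfl | hpos
    · exact absurd (h0.symm.trans hL) hab
    · exact hpos
  obtain ⟨B, hB, hadj⟩ := exists_isBlock_adj (hr 0 hL0)
  have haB : a ∈ B.verts := h0 ▸ hadj.fst_mem
  refine ⟨B, hB, haB, ?_⟩
  by_contra hbB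
  -- `B` is the block of the first edge of the path. At the last index where the path is in `B`, the
  -- vertex `q i` does not separate `a` from `b`; hence `q (i + 1)` is linked to `a` without `q i`,
  -- against `IsBlock.not_linked`.
  let P : ℕ → Prop := fun i => 1 ≤ i ∧ q i ∈ B.verts
  have hP : P (Nat.findGreatest P L) :=
    Nat.findGreatest_spec (P := P) (m := 1) hL0 ⟨le_rfl, by simpa using hadj.snd_mem⟩
  have hmax : ∀ j, Nat.findGreatest P L < j → j ≤ L → ¬ P j := fun j h1 h2 =>
    Nat.findGreatest_is_greatest h1 h2
  have hle := Nat.findGreatest_le (P := P) L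
  generalize Nat.findGreatest P L = i at hP hmax hle
  have hiL : i ≠ L := by
    rintro rfl
    have hL' : q i = b := hL
    exact hbB (hL' ▸ hP.2)
  have hz : q (i + 1) ∉ B.verts := fun hz => hmax (i + 1) (by omega) (by omega) ⟨by omega, hz⟩
  refine hB.not_linked hP.2 hz (hr i (by omega)) haB ?_
  have h1 : Linked G.Adj {q i} (q (i + 1)) (q L) :=
    linked_of_seq (by omega) (fun j _ hj => hr j hj) fun j h1 h2 hj => by
      have := hinj j i h2 (by omega) hj
      omega
  have hL' : q L = b := hL
  rw [hL'] at h1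
  refine h1.trans (h {q i} (by simp) ?_ ?_).adj_symm
  · intro he
    have := hinj 0 i (by omega) (by omega) (h0.trans he)
    have := hP.1
    omega
  · intro he
    exact hiL (hinj i L (by omega) le_rfl (hL'.trans he).symm)

end Linked

end ToricGraph

namespace ToricGraph

/-! ### Reduced Gröbner bases of toric ideals. -/

section Toric

open MvPolynomial
open scoped MonomialOrder

variable {σ ι K : Type*} [Field K] {A : σ → ι → ℕ} {m : MonomialOrder σ}

/-- The multidegree of a monomial with respect to `A`. -/
noncomputable abbrev wt (A : σ → ι → ℕ) (u : σ →₀ ℕ) : ι → ℕ := Finsupp.linearCombination ℕ A u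

theorem binomial_mem {u v : σ →₀ ℕ} (h : wt A u = wt A v) :
    monomial u 1 - monomial v 1 ∈ toricIdeal K A :=
  Ideal.subset_span ⟨u, v, h, rfl⟩

/-- The monomial map whose kernel contains the toric ideal. -/
noncomputable def toricHom (K : Type*) [Field K] (A : σ → ι → ℕ) :
    MvPolynomial σ K →+* AddMonoidAlgebra K (ι → ℕ) :=
  AddMonoidAlgebra.mapDomainRingHom K (Finsupp.linearCombination ℕ A).toAddMonoidHom

theorem toricHom_monomial (u : σ →₀ ℕ) (a : K) :
    toricHom K A (monomial u a) = AddMonoidAlgebra.single (wt A u) a :=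
  AddMonoidAlgebra.mapDomain_single

theorem toricHom_eq_zero {f : MvPolynomial σ K} (hf : f ∈ toricIdeal K A) :
    toricHom K A f = 0 := by
  have : toricIdeal K A ≤ RingHom.ker (toricHom K A) := by
    refine Ideal.span_le.2 ?_
    rintro _ ⟨u, v, h, rfl⟩
    simp [toricHom_monomial, RingHom.mem_ker, h]
  exact this hf

/-- No monomial of an element of a toric ideal is alone in its multidegree. -/
theorem exists_other_of_mem {f : MvPolynomial σ K} (hf : f ∈ toricIdeal K A) {u : σ →₀ ℕ}
    (hu : u ∈ f.support) : ∃ v ∈ f.support, v ≠ u ∧ wt A v = wt A u := by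
  classical
  by_contra! hcon
  have h0 := toricHom_eq_zero hf
  rw [f.as_sum, map_sum] at h0
  simp only [toricHom_monomial] at h0
  have h1 := congrArg (fun x : AddMonoidAlgebra K (ι → ℕ) => x.coeff (wt A u)) h0
  simp only [AddMonoidAlgebra.coeff_sum, Finsupp.finsetSum_apply, AddMonoidAlgebra.coeff_single,
    AddMonoidAlgebra.coeff_zero, Finsupp.zero_apply] at h1
  rw [Finset.sum_eq_single u] at h1
  · simp at h1
    exact (mem_support_iff.1 hu) h1
  · intro v hv hvu
    rw [Finsupp.single_apply, if_neg (hcon v hv hvu)]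
  · intro h; exact absurd hu h

/-- The binomial `x^u - x^v`. -/
noncomputable abbrev binom (K : Type*) [Field K] (u v : σ →₀ ℕ) : MvPolynomial σ K :=
  monomial u 1 - monomial v 1

theorem coeff_binom_left {u v : σ →₀ ℕ} (h : u ≠ v) : coeff u (binom K u v) = 1 := by
  classical
  simp [coeff_monomial, h.symm]

theorem coeff_binom_right {u v : σ →₀ ℕ} (h : u ≠ v) : coeff v (binom K u v) = -1 := by
  classical
  simp [coeff_monomial, h]

theorem coeff_binom_of_ne {u v w : σ →₀ ℕ} (h : w ≠ u) (h' : w ≠ v) :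
    coeff w (binom K u v) = 0 := by
  classical
  simp [coeff_monomial, h.symm, h'.symm]

theorem mem_support_binom {u v w : σ →₀ ℕ} (h : u ≠ v) :
    w ∈ (binom K u v).support ↔ w = u ∨ w = v := by
  rw [mem_support_iff]
  constructor
  · intro hw
    by_contra! hcon
    exact hw (coeff_binom_of_ne hcon.1 hcon.2)
  · rintro (rfl | rfl)
    · simp [coeff_binom_left h]
    · simp [coeff_binom_right h]

theorem binom_ne_zero {u v : σ →₀ ℕ} (h : u ≠ v) : binom K u v ≠ 0 := fun h0 => by
  have := coeff_binom_left (K := K) h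
  simp [h0] at this

theorem degree_binom {u v : σ →₀ ℕ} (h : v ≺[m] u) : m.degree (binom K u v) = u := by
  have hne : u ≠ v := by rintro rfl; exact lt_irrefl _ h
  have h1 := m.degree_mem_support (binom_ne_zero (K := K) hne)
  have h2 := m.le_degree ((mem_support_binom (K := K) hne).2 (Or.inl rfl))
  rcases (mem_support_binom hne).1 h1 with h3 | h3
  · exact h3
  · rw [h3] at h2
    exact absurd h (not_lt.2 h2)

theorem monic_binom {u v : σ →₀ ℕ} (h : v ≺[m] u) : m.Monic (binom K u v) := by
  have hne : u ≠ v := by rintro rfl; exact lt_irrefl _ h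
  unfold MonomialOrder.Monic MonomialOrder.leadingCoeff
  rw [degree_binom h, coeff_binom_left hne]

/-- `u` is the least monomial of its multidegree. -/
def IsNormal (m : MonomialOrder σ) (A : σ → ι → ℕ) (u : σ →₀ ℕ) : Prop :=
  ∀ v, wt A v = wt A u → u ≼[m] v

theorem exists_isNormal (m : MonomialOrder σ) (A : σ → ι → ℕ) (u : σ →₀ ℕ) :
    ∃ v, wt A u = wt A v ∧ IsNormal m A v := by
  have hwf : WellFounded fun a b : σ →₀ ℕ => a ≺[m] b :=
    InvImage.wf m.toSyn wellFounded_lt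
  obtain ⟨v, hv, hmin⟩ := hwf.has_min {v | wt A v = wt A u} ⟨u, rfl⟩
  exact ⟨v, hv.symm, fun w hw => not_lt.1 (hmin w (hw.trans hv))⟩

theorem IsNormal.eq {u v : σ →₀ ℕ} (h : IsNormal m A u) (h' : IsNormal m A v)
    (huv : wt A u = wt A v) : u = v :=
  m.toSyn.injective (le_antisymm (h v huv.symm) (h' u huv))

/-- A smaller monomial of the multidegree of `u`, multiplied by the cofactor `v - u`, would be a
smaller monomial of the multidegree of `v`. -/
theorem IsNormal.of_le {u v : σ →₀ ℕ} (h : IsNormal m A v) (huv : u ≤ v) : IsNormal m A u := by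
  intro w hw
  have h1 : wt A (w + (v - u)) = wt A v := by
    rw [wt, map_add, show Finsupp.linearCombination ℕ A w = _ from hw, ← map_add,
      add_tsub_cancel_of_le huv]
  have h2 := h _ h1
  rw [← add_tsub_cancel_of_le huv, add_tsub_cancel_left, map_add, map_add] at h2
  exact le_of_add_le_add_right h2

theorem IsNormal.lt {u v : σ →₀ ℕ} (h : IsNormal m A v) (huv : wt A u = wt A v)
    (hu : ¬ IsNormal m A u) : v ≺[m] u :=
  lt_of_le_of_ne (h u huv) fun he => hu (m.toSyn.injective he ▸ h)

/-- The leading monomial has a companion of the same multidegree in the support, and that companion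
is smaller. So leading monomials are never normal, and conversely a non-normal monomial leads the
binomial with its normal form. -/
theorem not_isNormal_degree {f : MvPolynomial σ K} (hf : f ∈ toricIdeal K A) (h0 : f ≠ 0) :
    ¬ IsNormal m A (m.degree f) := by
  intro hn
  obtain ⟨v, hv, hne, hw⟩ := exists_other_of_mem hf (m.degree_mem_support h0)
  exact hne (m.toSyn.injective (le_antisymm (m.le_degree hv) (hn v hw)))

/-- The elements of a reduced Gröbner basis of a toric ideal are binomials. -/
theorem IsReducedGroebnerBasis.exists_binom {B : Set (MvPolynomial σ K)}
    (hB : IsReducedGroebnerBasis m (toricIdeal K A) B) {g : MvPolynomial σ K} (hg : g ∈ B) :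
    ∃ u v, wt A u = wt A v ∧ v ≺[m] u ∧ g = binom K u v := by
  have hg0 : g ≠ 0 := by
    rintro rfl
    have := hB.monic 0 hg
    simp [MonomialOrder.Monic] at this
  obtain ⟨v, huv, hv⟩ := exists_isNormal m A (m.degree g)
  have hlt := hv.lt huv (not_isNormal_degree (hB.subset g hg) hg0)
  refine ⟨m.degree g, v, huv, hlt, ?_⟩
  have hne : m.degree g ≠ v := by intro h; rw [← h] at hlt; exact lt_irrefl _ hlt
  -- Otherwise the difference of `g` and the binomial has a non-normal leading monomial `w`. It
  -- differs from `v`, which is normal, and from the leading monomial of `g`, which has cancelled,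
  -- so it is a monomial of `g`. Some leading monomial of `B` divides `w`, and reducedness excludes
  -- this.
  by_contra hcon
  have hmem : g - binom K (m.degree g) v ∈ toricIdeal K A :=
    sub_mem (hB.subset g hg) (binomial_mem huv)
  have hsub := sub_ne_zero.2 hcon
  have hw := m.degree_mem_support hsub
  have hnn := not_isNormal_degree (m := m) hmem hsub
  generalize m.degree (g - binom K (m.degree g) v) = w at hw hnn
  have hwv : w ≠ v := fun h => hnn (h ▸ hv)
  rw [mem_support_iff, coeff_sub] at hw
  have hwu : w ≠ m.degree g := by
    rintro rfl
    rw [coeff_binom_left hne, MonomialOrder.Monic.coeff_degree (hB.monic g hg), sub_self] at hw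
    exact hw rfl
  rw [coeff_binom_of_ne hwu hwv, sub_zero] at hw
  have hws : w ∈ g.support := mem_support_iff.2 hw
  obtain ⟨w', hw', hw'n⟩ := exists_isNormal m A w
  have hlt' := hw'n.lt hw' hnn
  obtain ⟨g', hg', hle⟩ := hB.initial _ (binomial_mem (K := K) hw') (binom_ne_zero (by
    rintro rfl; exact lt_irrefl _ hlt'))
  rw [degree_binom hlt'] at hle
  refine hB.reduced g hg g' hg' ?_ w hws hle
  rintro rfl
  exact hwu (m.toSyn.injective (le_antisymm (m.le_degree hws) (m.toSyn_monotone hle)))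

/-- The reduced Gröbner basis of a toric ideal. -/
theorem isReducedGroebnerBasis_toric (m : MonomialOrder σ) (A : σ → ι → ℕ) :
    IsReducedGroebnerBasis m (toricIdeal K A) {g | ∃ u v, wt A u = wt A v ∧ IsNormal m A v ∧
      ¬ IsNormal m A u ∧ (∀ c ≤ u, c ≠ u → IsNormal m A c) ∧ g = binom K u v} where
  subset := by
    rintro _ ⟨u, v, h, -, -, -, rfl⟩
    exact binomial_mem h
  monic := by
    rintro _ ⟨u, v, h, hv, hu, -, rfl⟩
    exact monic_binom (hv.lt h hu)
  initial := by
    intro f hf h0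
    have hn := not_isNormal_degree (m := m) hf h0
    have hwf : WellFounded fun a b : σ →₀ ℕ => a ≺[m] b :=
      InvImage.wf m.toSyn wellFounded_lt
    -- The term order refines divisibility, so the least non-normal divisor in the term order is
    -- also minimal for divisibility.
    obtain ⟨u, ⟨hu1, hu2⟩, hmin⟩ := hwf.has_min {u | u ≤ m.degree f ∧ ¬ IsNormal m A u}
      ⟨_, le_rfl, hn⟩
    obtain ⟨v, huv, hv⟩ := exists_isNormal m A u
    refine ⟨_, ⟨u, v, huv, hv, hu2, fun c hc hcu => ?_, rfl⟩, ?_⟩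
    · by_contra hcn
      exact hmin c ⟨hc.trans hu1, hcn⟩ (m.toSyn_strictMono (lt_of_le_of_ne hc hcu))
    · rwa [degree_binom (hv.lt huv hu2)]
  reduced := by
    rintro _ ⟨u, v, h, hv, hu, hmin, rfl⟩ _ ⟨u', v', h', hv', hu', hmin', rfl⟩ hne w hw hle
    rw [degree_binom (hv'.lt h' hu')] at hle
    have huv : u ≠ v := fun e => hu (e ▸ hv)
    rcases (mem_support_binom huv).1 hw with rfl | rfl
    · by_cases e : u' = w
      · subst e
        exact hne (by rw [hv.eq hv' (h.symm.trans h')])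
      · exact hu' (hmin u' hle e)
    · exact hu' (hv.of_le hle)

end Toric

end ToricGraph

namespace ToricGraph

/-! ### Consequences of robustness and quadratic generation; elimination orders. -/

section Quadrics

open MvPolynomial
open scoped MonomialOrder

universe u w

variable {σ : Type u} {ι : Type*} {K : Type w} [Field K] {A : σ → ι → ℕ}

theorem universalGroebnerBasis_exists_binom {f : MvPolynomial σ K}
    (hf : f ∈ universalGroebnerBasis (toricIdeal K A)) :
    ∃ u v, wt A u = wt A v ∧ u ≠ v ∧ f = binom K u v := by
  obtain ⟨m, B, hB, hfB⟩ := hf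
  obtain ⟨u, v, h1, h2, h3⟩ := hB.exists_binom hfB
  exact ⟨u, v, h1, by rintro rfl; exact lt_irrefl _ h2, h3⟩

theorem isHomogeneous_binom {a b : σ →₀ ℕ} {d : ℕ} (ha : a.degree = d) (hb : b.degree = d) :
    (binom K a b).IsHomogeneous d :=
  (isHomogeneous_monomial _ ha).sub (isHomogeneous_monomial _ hb)

/-- No generator has degree below 2, so the degree 2 part of a combination comes only from constant
multiples of the quadratic generators. -/
theorem homogeneousComponent_two_mem {S : Set (MvPolynomial σ K)}
    (hS : ∀ s ∈ S, ∃ d, 2 ≤ d ∧ s.IsHomogeneous d) {f : MvPolynomial σ K}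
    (hf : f ∈ Ideal.span S) :
    homogeneousComponent 2 f ∈ Ideal.span {s ∈ S | s.IsHomogeneous 2} := by
  obtain ⟨k, a, s, rfl⟩ := Submodule.mem_span_set'.1 hf
  rw [map_sum]
  refine Ideal.sum_mem _ fun i _ => ?_
  obtain ⟨d, hd, hs⟩ := hS _ (s i).2
  rw [smul_eq_mul]
  nth_rewrite 1 [← sum_homogeneousComponent (a i)]
  rw [Finset.sum_mul, map_sum]
  refine Ideal.sum_mem _ fun j _ => ?_
  have hj : (homogeneousComponent j (a i) * (s i : MvPolynomial σ K)).IsHomogeneous (j + d) :=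
    (homogeneousComponent_isHomogeneous j (a i)).mul hs
  rw [homogeneousComponent_of_mem hj]
  split_ifs with h
  · have : d = 2 := by omega
    subst this
    exact Ideal.mul_mem_left _ _ (Ideal.subset_span ⟨(s i).2, hs⟩)
  · exact zero_mem _

/-- In a robust toric ideal that is generated by quadrics, the universal Gröbner basis consists of
quadrics. -/
theorem degree_eq_two_of_robust (hdeg : ∀ u v, wt A u = wt A v → u.degree = v.degree)
    (h2 : ∀ u v, wt A u = wt A v → u ≠ v → 2 ≤ u.degree) (hr : IsRobust (toricIdeal K A))
    (hq : IsGeneratedByQuadrics (toricIdeal K A)) {a b : σ →₀ ℕ} (hab : a ≠ b)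
    (hf : binom K a b ∈ universalGroebnerBasis (toricIdeal K A)) (hw : wt A a = wt A b) :
    a.degree = 2 := by
  obtain ⟨S, hSU, huniq, hmin⟩ := hr
  obtain ⟨T, hT, hTI⟩ := hq
  have hS : ∀ s ∈ S, ∃ d, 2 ≤ d ∧ s.IsHomogeneous d := by
    intro s hs
    obtain ⟨u, v, h, hne, rfl⟩ := universalGroebnerBasis_exists_binom (hSU hs)
    exact ⟨u.degree, h2 u v h hne, isHomogeneous_binom rfl (hdeg u v h).symm⟩
  -- Quadrics generate the ideal, and each of them lies in the span of the quadratic members of `S`.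
  -- Minimality of `S` then leaves no other members.
  have hspan : Ideal.span {s ∈ S | s.IsHomogeneous 2} = toricIdeal K A := by
    refine le_antisymm ((Ideal.span_mono fun s hs => hs.1).trans_eq hmin.1) ?_
    rw [← hTI]
    refine Ideal.span_le.2 fun t ht => ?_
    have htS : t ∈ Ideal.span S := by
      rw [hmin.1, ← hTI]; exact Ideal.subset_span ht
    have := homogeneousComponent_two_mem hS htS
    rwa [homogeneousComponent_of_mem (hT t ht), if_pos rfl] at this
  have hS2 : ∀ s ∈ S, s.IsHomogeneous 2 := fun s hs => (hmin.2 hspan (fun s hs => hs.1) hs).2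
  obtain ⟨g, ⟨hgS, w, hgw⟩, -⟩ := huniq _ hf
  have hf0 := binom_ne_zero (K := K) hab
  have hg0 : g ≠ 0 := by rintro rfl; rw [zero_mul] at hgw; exact hf0 hgw.symm
  have h1 : (binom K a b).totalDegree = a.degree :=
    (isHomogeneous_binom rfl (hdeg a b hw).symm).totalDegree hf0
  rw [← hgw, totalDegree_mul_of_isDomain hg0 w.ne_zero, (hS2 g hgS).totalDegree hg0] at h1
  have := (MvPolynomial.isUnit_iff_totalDegree_of_isReduced.1 w.isUnit).2
  omega

/-- A term order for which the monomials in the variables of `F` are the smallest. -/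
theorem exists_elimination_order [Finite σ] (F : Set σ) : ∃ m : MonomialOrder.{u, u} σ,
    ∀ a b : σ →₀ ℕ, (∀ e, a e ≠ 0 → e ∈ F) → b ≼[m] a → ∀ e, b e ≠ 0 → e ∈ F := by
  classical
  obtain ⟨n, ⟨eq⟩⟩ := Finite.exists_equiv_fin σ
  -- In the lexicographic order the smaller variable decides first. Since `false < true`, the
  -- variables outside `F` come first, and any monomial containing one of them exceeds all monomials
  -- in `F`.
  let f : σ → Bool ×ₗ Fin n := fun x => toLex (decide (x ∈ F), eq x)
  have hf : Function.Injective f := fun x y h => by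
    have := congrArg (fun z => (ofLex z).2) h
    exact eq.injective this
  let : LinearOrder σ := LinearOrder.lift' f hf
  have hlt : ∀ x y, x ∉ F → y ∈ F → x < y := by
    intro x y hx hy
    change f x < f y
    rw [Prod.Lex.lt_iff]
    left
    simp [f, hx, hy]
  refine ⟨MonomialOrder.lex, fun a b ha hba e he => ?_⟩
  by_contra heF
  have hae : a e = 0 := by
    by_contra h; exact heF (ha e h)
  rcases hba.lt_or_eq with h | h
  · rw [MonomialOrder.lex_lt_iff, Finsupp.Lex.lt_iff] at h
    obtain ⟨i, h1, h2⟩ := h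
    have hi : i ∈ F := ha i (by simp at h2; omega)
    have := h1 e (hlt e i heF hi)
    simp at this
    omega
  · have := MonomialOrder.lex.toSyn.injective h
    rw [this] at he
    exact he hae

/-- If two different monomials in the variables of `F` have the same multidegree, then some element
of the universal Gröbner basis involves only these variables. -/
theorem exists_mem_universalGroebnerBasis [Finite σ] {F : Set σ} {a b : σ →₀ ℕ} (hab : a ≠ b)
    (hw : wt A a = wt A b) (ha : ∀ e, a e ≠ 0 → e ∈ F) (hb : ∀ e, b e ≠ 0 → e ∈ F) :
    ∃ u v, wt A u = wt A v ∧ u ≠ v ∧ (∀ e, u e ≠ 0 → e ∈ F) ∧ (∀ e, v e ≠ 0 → e ∈ F) ∧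
      binom K u v ∈ universalGroebnerBasis (toricIdeal K A) := by
  obtain ⟨m, hm⟩ := exists_elimination_order F
  wlog hlt : b ≺[m] a generalizing a b
  · exact this hab.symm hw.symm hb ha
      (lt_of_le_of_ne (not_lt.1 hlt) fun h => hab (m.toSyn.injective h))
  have hB := isReducedGroebnerBasis_toric (K := K) m A
  -- The leading monomial of `g` divides `a` and so involves only `F`. The other monomial of `g` is
  -- smaller, and the elimination order keeps it in `F` as well.
  obtain ⟨g, hg, hle⟩ := hB.initial _ (binomial_mem hw) (binom_ne_zero hab)
  have hg' := hg
  obtain ⟨u, v, huv, hv, hu, -, rfl⟩ := hg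
  have hlt' := hv.lt huv hu
  rw [degree_binom hlt, degree_binom hlt'] at hle
  have huF : ∀ e, u e ≠ 0 → e ∈ F := fun e he => ha e (by have := hle e; omega)
  exact ⟨u, v, huv, fun h => hu (h ▸ hv), huF, hm u v huF hlt'.le, m, _, hB, hg'⟩

/-- A quadratic binomial that is unique in the variables it involves belongs to the universal
Gröbner basis, up to sign. -/
theorem binom_mem_universalGroebnerBasis [Finite σ] {a b : σ →₀ ℕ} (hab : a ≠ b)
    (hw : wt A a = wt A b)
    (huniq : ∀ u v, wt A u = wt A v → u ≠ v → (∀ e, u e ≠ 0 → a e ≠ 0 ∨ b e ≠ 0) →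
      (∀ e, v e ≠ 0 → a e ≠ 0 ∨ b e ≠ 0) → u.degree = 2 → (u = a ∧ v = b) ∨ (u = b ∧ v = a))
    (hdeg : ∀ u v, binom K u v ∈ universalGroebnerBasis (toricIdeal K A) → u ≠ v →
      wt A u = wt A v → u.degree = 2) :
    binom K a b ∈ universalGroebnerBasis (toricIdeal K A) ∨
      binom K b a ∈ universalGroebnerBasis (toricIdeal K A) := by
  obtain ⟨u, v, h1, h2, h3, h4, h5⟩ := exists_mem_universalGroebnerBasis (K := K)
    (F := {e | a e ≠ 0 ∨ b e ≠ 0}) hab hw (fun e he => Or.inl he) (fun e he => Or.inr he)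
  rcases huniq u v h1 h2 h3 h4 (hdeg u v h5 h2 h1) with ⟨rfl, rfl⟩ | ⟨rfl, rfl⟩
  · exact Or.inl h5
  · exact Or.inr h5

/-- In a robust toric ideal, three monomials of the same multidegree cannot all be connected by
elements of the universal Gröbner basis. -/
theorem not_associated_binom {x y z t : σ →₀ ℕ} (hxy : x ≠ y)
    (h : ∃ s, s ≠ z ∧ s ≠ t ∧ (s = x ∨ s = y)) :
    ¬ Associated (binom K x y) (binom K z t) := by
  obtain ⟨s, hsz, hst, hs⟩ := h
  rintro ⟨w, hw⟩
  obtain ⟨-, hw0⟩ := MvPolynomial.isUnit_iff_totalDegree_of_isReduced.1 w.isUnit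
  rw [totalDegree_eq_zero_iff_eq_C] at hw0
  have hc := congrArg (coeff s) hw
  rw [coeff_binom_of_ne hsz hst, hw0, mul_comm, coeff_C_mul] at hc
  rcases mul_eq_zero.1 hc with h | h
  · rw [h, C_0] at hw0
    exact w.ne_zero hw0
  · rcases hs with rfl | rfl
    · rw [coeff_binom_left hxy] at h; exact one_ne_zero h
    · rw [coeff_binom_right hxy] at h; exact one_ne_zero (neg_eq_zero.1 h)

/-- The binomial of `b` and `c` is the difference of the other two. Its representative in the
generating set can be dropped, against minimality. -/
theorem not_robust_of_triangle {a b c : σ →₀ ℕ} (hab : a ≠ b) (hac : a ≠ c)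
    (h1 : binom K a b ∈ universalGroebnerBasis (toricIdeal K A) ∨
      binom K b a ∈ universalGroebnerBasis (toricIdeal K A))
    (h2 : binom K a c ∈ universalGroebnerBasis (toricIdeal K A) ∨
      binom K c a ∈ universalGroebnerBasis (toricIdeal K A))
    (h3 : binom K b c ∈ universalGroebnerBasis (toricIdeal K A) ∨
      binom K c b ∈ universalGroebnerBasis (toricIdeal K A)) :
    ¬ IsRobust (toricIdeal K A) := by
  rintro ⟨S, hSU, huniq, hmin⟩
  have get : ∀ u v, (binom K u v ∈ universalGroebnerBasis (toricIdeal K A) ∨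
      binom K v u ∈ universalGroebnerBasis (toricIdeal K A)) →
      ∃ g ∈ S, Associated g (binom K u v) := by
    rintro u v (h | h)
    · obtain ⟨g, ⟨hg, hg'⟩, -⟩ := huniq _ h
      exact ⟨g, hg, hg'⟩
    · obtain ⟨g, ⟨hg, hg'⟩, -⟩ := huniq _ h
      refine ⟨g, hg, ?_⟩
      rw [show binom K u v = - binom K v u by simp [binom]]
      exact hg'.neg_right
  obtain ⟨g1, hg1, ha1⟩ := get a b h1
  obtain ⟨g2, hg2, ha2⟩ := get a c h2
  obtain ⟨g3, hg3, ha3⟩ := get b c h3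
  have h13 : g1 ≠ g3 := by
    rintro rfl
    exact not_associated_binom hab ⟨a, hab, hac, Or.inl rfl⟩ (ha1.symm.trans ha3)
  have h23 : g2 ≠ g3 := by
    rintro rfl
    exact not_associated_binom hac ⟨a, hab, hac, Or.inl rfl⟩ (ha2.symm.trans ha3)
  have hspan : Ideal.span (S \ {g3}) = toricIdeal K A := by
    refine le_antisymm ((Ideal.span_mono Set.sdiff_subset).trans_eq hmin.1) ?_
    rw [← hmin.1]
    refine Ideal.span_le.2 fun s hs => ?_
    by_cases hs3 : s = g3
    · subst hs3
      have m1 : binom K a b ∈ Ideal.span (S \ {s}) :=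
        (Ideal.span (S \ {s})).mem_of_dvd ha1.dvd (Ideal.subset_span ⟨hg1, h13⟩)
      have m2 : binom K a c ∈ Ideal.span (S \ {s}) :=
        (Ideal.span (S \ {s})).mem_of_dvd ha2.dvd (Ideal.subset_span ⟨hg2, h23⟩)
      have m3 : binom K b c ∈ Ideal.span (S \ {s}) := by
        have := sub_mem m2 m1
        rwa [show binom K a c - binom K a b = binom K b c by simp [binom]] at this
      exact (Ideal.span (S \ {s})).mem_of_dvd ha3.symm.dvd m3
    · exact Ideal.subset_span ⟨hs, hs3⟩
  exact (hmin.2 hspan Set.sdiff_subset hg3).2 rfl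

end Quadrics

end ToricGraph

namespace ToricGraph

/-! ### Edge vectors, degrees, and quadratic binomials as 4-cycles. -/

section EdgeVectors

open MvPolynomial

universe u w

variable {V : Type u} {G : SimpleGraph V}

theorem sum_edgeVector [Fintype V] (e : G.edgeSet) : ∑ v, edgeVector G e v = 2 := by
  classical
  obtain ⟨e, he⟩ := e
  induction e using Sym2.ind with
  | h x y =>
    have hxy : x ≠ y := (show G.Adj x y from he).ne
    have : ∀ v, edgeVector G ⟨s(x, y), he⟩ v = (if v = x then 1 else 0) + if v = y then 1 else 0 := by
      intro v
      unfold edgeVector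
      by_cases h1 : v = x
      · subst h1; simp [hxy]
      · simp [h1]
    simp [this, Finset.sum_add_distrib]

theorem edgeVector_injective : Function.Injective (edgeVector G) := by
  intro e f h
  refine Subtype.ext (Sym2.ext fun v => ?_)
  have := congrFun h v
  unfold edgeVector at this
  by_cases h1 : v ∈ (e : Sym2 V) <;> by_cases h2 : v ∈ (f : Sym2 V) <;> simp_all

theorem wt_single (e : G.edgeSet) : wt (edgeVector G) (Finsupp.single e 1) = edgeVector G e := by
  simp [wt]

/-- The handshake count. It shows that the multidegree determines the degree, so the binomials of
the ideal are homogeneous. -/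
theorem two_mul_degree [Fintype V] (u : G.edgeSet →₀ ℕ) :
    ∑ v, wt (edgeVector G) u v = 2 * u.degree := by
  induction u using Finsupp.induction_linear with
  | zero => simp [wt]
  | add u v hu hv =>
    simp only [wt, map_add, Pi.add_apply, Finset.sum_add_distrib] at hu hv ⊢
    rw [hu, hv]; ring
  | single e k =>
    simp [wt, ← Finset.mul_sum, sum_edgeVector, mul_comm]

theorem degree_eq_of_wt_eq [Finite V] {u v : G.edgeSet →₀ ℕ}
    (h : wt (edgeVector G) u = wt (edgeVector G) v) : u.degree = v.degree := by
  have := Fintype.ofFinite V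
  have h1 := two_mul_degree u
  rw [h, two_mul_degree] at h1
  omega

theorem degree_eq_one {σ : Type*} {u : σ →₀ ℕ} (h : u.degree = 1) : ∃ e, u = Finsupp.single e 1 := by
  classical
  obtain ⟨e, he⟩ : ∃ e, u e ≠ 0 := by
    by_contra! hcon
    rw [show u = 0 from Finsupp.ext hcon] at h
    simp at h
  refine ⟨e, ?_⟩
  have hle : Finsupp.single e 1 ≤ u := by
    rw [Finsupp.single_le_iff]; omega
  have h1 := add_tsub_cancel_of_le hle
  have h2 : (u - Finsupp.single e 1).degree = 0 := by
    have := congrArg Finsupp.degree h1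
    rw [map_add, Finsupp.degree_single, h] at this
    omega
  rw [Finsupp.degree_eq_zero_iff] at h2
  rw [h2, add_zero] at h1
  exact h1.symm

theorem degree_eq_two {σ : Type*} {u : σ →₀ ℕ} (h : u.degree = 2) :
    ∃ e f, u = Finsupp.single e 1 + Finsupp.single f 1 := by
  classical
  obtain ⟨e, he⟩ : ∃ e, u e ≠ 0 := by
    by_contra! hcon
    rw [show u = 0 from Finsupp.ext hcon] at h
    simp at h
  have hle : Finsupp.single e 1 ≤ u := by
    rw [Finsupp.single_le_iff]; omega
  have h1 := add_tsub_cancel_of_le hle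
  have h2 : (u - Finsupp.single e 1).degree = 1 := by
    have := congrArg Finsupp.degree h1
    rw [map_add, Finsupp.degree_single, h] at this
    omega
  obtain ⟨f, hf⟩ := degree_eq_one h2
  exact ⟨e, f, by rw [← hf, h1]⟩

/-- In a simple graph different edges have different vectors, so there are no binomials of degree 1.
-/
theorem two_le_degree [Finite V] {u v : G.edgeSet →₀ ℕ}
    (h : wt (edgeVector G) u = wt (edgeVector G) v) (hne : u ≠ v) : 2 ≤ u.degree := by
  have hd := degree_eq_of_wt_eq h
  by_contra! hlt
  have : u.degree = 0 ∨ u.degree = 1 := by omega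
  rcases this with h0 | h1
  · rw [h0] at hd
    rw [Finsupp.degree_eq_zero_iff] at h0
    rw [eq_comm, Finsupp.degree_eq_zero_iff] at hd
    exact hne (h0.trans hd.symm)
  · rw [h1] at hd
    obtain ⟨e, rfl⟩ := degree_eq_one h1
    obtain ⟨f, rfl⟩ := degree_eq_one hd.symm
    rw [wt_single, wt_single] at h
    exact hne (by rw [edgeVector_injective h])

/-- A quadratic binomial in the ideal of a graph comes from a 4-cycle `p, q, s, r`. -/
theorem exists_square {e e' f f' : G.edgeSet}
    (hw : wt (edgeVector G) (Finsupp.single e 1 + Finsupp.single e' 1) =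
      wt (edgeVector G) (Finsupp.single f 1 + Finsupp.single f' 1))
    (hne : Finsupp.single e 1 + Finsupp.single e' 1 ≠
      (Finsupp.single f 1 + Finsupp.single f' 1 : G.edgeSet →₀ ℕ)) :
    ∃ p q r s, p ≠ s ∧ q ≠ r ∧ (e : Sym2 V) = s(p, q) ∧ (e' : Sym2 V) = s(r, s) ∧
      (((f : Sym2 V) = s(p, r) ∧ (f' : Sym2 V) = s(q, s)) ∨
        ((f' : Sym2 V) = s(p, r) ∧ (f : Sym2 V) = s(q, s))) := by
  classical
  obtain ⟨e, he⟩ := e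
  obtain ⟨e', he'⟩ := e'
  obtain ⟨f, hf⟩ := f
  obtain ⟨f', hf'⟩ := f'
  induction e using Sym2.ind with
  | h p q =>
  have hpq : p ≠ q := (show G.Adj p q from he).ne
  wlog hpf : p ∈ f generalizing f f'
  · have hp : p ∈ f' := by
      have := congrFun hw p
      simp only [wt, map_add, Pi.add_apply] at this
      by_contra hpf'
      simp [edgeVector, hpf, hpf'] at this
    obtain ⟨a, b, c, d, h1, h2, h3, h4, h5⟩ := this f' hf' f hf
      (by rw [hw, add_comm]) (fun h => hne (by rw [h, add_comm])) hp
    exact ⟨a, b, c, d, h1, h2, h3, h4, h5.symm⟩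
  obtain ⟨t, rfl⟩ := hpf
  have hpt : p ≠ t := (show G.Adj p t from hf).ne
  -- If `t = q`, the first edges of the two monomials agree. After cancelling them the other two
  -- edges have equal vectors, and the monomials coincide.
  have htq : t ≠ q := by
    rintro rfl
    apply hne
    simp only [wt, map_add] at hw
    have h1 := add_left_cancel hw
    rw [show (Finsupp.linearCombination ℕ (edgeVector G)) _ = _ from wt_single _,
      show (Finsupp.linearCombination ℕ (edgeVector G)) _ = _ from wt_single _] at h1
    rw [edgeVector_injective h1]
  have hte : t ∈ e' := by
    have := congrFun hw t
    simp only [wt, map_add, Pi.add_apply] at this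
    by_contra hpf'
    simp [edgeVector, htq, hpt.symm, hpf'] at this
    omega
  obtain ⟨s, rfl⟩ := hte
  have hts : t ≠ s := (show G.Adj t s from he').ne
  have hval : ∀ v, (if v = p ∨ v = q then 1 else 0) + (if v = t ∨ v = s then 1 else 0) =
      (if v = p ∨ v = t then 1 else 0) + (if v ∈ f' then 1 else 0) := by
    intro v
    have := congrFun hw v
    simpa [wt, map_add, Pi.add_apply, edgeVector] using this
  have hps : p ≠ s := by
    rintro rfl
    apply hne
    have h1 : (⟨f', hf'⟩ : G.edgeSet) = ⟨s(p, q), he⟩ := by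
      apply edgeVector_injective
      funext v
      have := hval v
      simp only [edgeVector, Sym2.mem_iff]
      simp only [or_comm (a := v = t)] at this
      rw [add_comm] at this
      exact (add_left_cancel this).symm
    rw [h1, add_comm]
    congr 2
    exact Subtype.ext Sym2.eq_swap
  refine ⟨p, q, t, s, hps, htq.symm, rfl, rfl, Or.inl ⟨rfl, ?_⟩⟩
  have hq : q ∈ f' := by
    have := hval q
    by_contra h
    simp [h, hpq.symm, htq.symm] at this
  have hs : s ∈ f' := by
    have := hval s
    by_contra h
    simp [h, hps.symm, hts.symm] at this
  have hqs : q ≠ s := by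
    rintro rfl
    have := hval q
    simp [hpq.symm, htq.symm, hq] at this
  exact ((Sym2.mem_and_mem_iff hqs).1 ⟨hq, hs⟩)

end EdgeVectors

end ToricGraph

namespace ToricGraph

/-! ### Edge weightings with zero vertex sums, and even cycles. -/

section Circuits

universe u w

variable {V : Type u} {G : SimpleGraph V} {K : Type w} [Field K]

/-- The vertex sums of an integral edge weighting. -/
noncomputable def vertexSum (G : SimpleGraph V) : (G.edgeSet →₀ ℤ) →ₗ[ℤ] (V → ℤ) :=
  Finsupp.linearCombination ℤ fun e v => (edgeVector G e v : ℤ)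

/-- The edge `xy` carries a nonzero weight. -/
def Carries (z : G.edgeSet →₀ ℤ) (x y : V) : Prop := ∃ h : s(x, y) ∈ G.edgeSet, z ⟨s(x, y), h⟩ ≠ 0

theorem Carries.adj {z : G.edgeSet →₀ ℤ} {x y : V} (h : Carries z x y) : G.Adj x y := h.1

theorem Carries.symm {z : G.edgeSet →₀ ℤ} {x y : V} (h : Carries z x y) : Carries z y x := by
  obtain ⟨h1, h2⟩ := h
  have he : s(x, y) = s(y, x) := Sym2.eq_swap
  exact ⟨he ▸ h1, by simpa [← he] using h2⟩

theorem carries_of_eq {z : G.edgeSet →₀ ℤ} {e : G.edgeSet} {x y : V} (h : (e : Sym2 V) = s(x, y))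
    (hz : z e ≠ 0) : Carries z x y := by
  obtain ⟨e, he⟩ := e
  subst h
  exact ⟨he, hz⟩

/-- A robust graph ideal generated by quadrics: the support of an edge weighting with zero vertex
sums contains a 4-cycle. -/
theorem exists_square_of_vertexSum_eq_zero [Finite V] (hr : IsRobust (graphIdeal K G))
    (hq : IsGeneratedByQuadrics (graphIdeal K G)) {z : G.edgeSet →₀ ℤ} (hz : z ≠ 0)
    (hker : vertexSum G z = 0) : ∃ a b c d, a ≠ c ∧ b ≠ d ∧ Carries z a b ∧ Carries z b c ∧
      Carries z c d ∧ Carries z d a := by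
  classical
  have : Fintype G.edgeSet := Fintype.ofFinite _
  -- The positive and the negative part of `z`. Zero vertex sums mean that they have the same
  -- multidegree.
  let a : G.edgeSet →₀ ℕ := z.mapRange Int.toNat rfl
  let b : G.edgeSet →₀ ℕ := (-z).mapRange Int.toNat rfl
  have hab : a ≠ b := by
    intro h
    apply hz
    ext e
    have := DFunLike.congr_fun h e
    simp only [a, b, Finsupp.mapRange_apply, Finsupp.neg_apply] at this
    simp only [Finsupp.zero_apply]
    omega
  have hw : wt (edgeVector G) a = wt (edgeVector G) b := by
    funext v
    have h1 := congrFun hker v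
    simp only [vertexSum, wt, Finsupp.linearCombination_apply, Finsupp.sum_fintype, zero_smul,
      implies_true, Finset.sum_apply, Pi.smul_apply, smul_eq_mul, Pi.zero_apply] at h1 ⊢
    zify
    rw [← sub_eq_zero, ← Finset.sum_sub_distrib, ← h1]
    refine Finset.sum_congr rfl fun e _ => ?_
    rw [← sub_mul]
    congr 1
    simp only [a, b, Finsupp.mapRange_apply, Finsupp.neg_apply]
    omega
  have ha : ∀ e, a e ≠ 0 → e ∈ {e | z e ≠ 0} := by
    intro e he
    simp only [a, Finsupp.mapRange_apply] at he
    simp only [Set.mem_ofPred_eq]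
    omega
  have hb : ∀ e, b e ≠ 0 → e ∈ {e | z e ≠ 0} := by
    intro e he
    simp only [b, Finsupp.mapRange_apply, Finsupp.neg_apply] at he
    simp only [Set.mem_ofPred_eq]
    omega
  obtain ⟨u, v, huv, hne, hu, hv, hmem⟩ := exists_mem_universalGroebnerBasis (K := K) hab hw ha hb
  have hd := degree_eq_two_of_robust (fun _ _ => degree_eq_of_wt_eq) (fun _ _ => two_le_degree)
    hr hq hne hmem huv
  obtain ⟨e, e', rfl⟩ := degree_eq_two hd
  obtain ⟨f, f', rfl⟩ := degree_eq_two ((degree_eq_of_wt_eq huv).symm.trans hd)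
  have he := hu e (by simp)
  have he' := hu e' (by simp)
  have hf := hv f (by simp)
  have hf' := hv f' (by simp)
  obtain ⟨p, q, r, s, hps, hqr, h1, h2, ⟨h3, h4⟩ | ⟨h3, h4⟩⟩ := exists_square huv hne
  · exact ⟨p, q, s, r, hps, hqr, carries_of_eq h1 he, carries_of_eq h4 hf',
      (carries_of_eq h2 he').symm, (carries_of_eq h3 hf).symm⟩
  · exact ⟨p, q, s, r, hps, hqr, carries_of_eq h1 he, carries_of_eq h4 hf,
      (carries_of_eq h2 he').symm, (carries_of_eq h3 hf').symm⟩

open Classical in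
/-- The indicator of the edge `xy`. -/
noncomputable def edgeInd (G : SimpleGraph V) (x y : V) : G.edgeSet →₀ ℤ :=
  if h : G.Adj x y then Finsupp.single ⟨s(x, y), h⟩ 1 else 0

theorem edgeInd_apply {x y : V} (h : G.Adj x y) (e : G.edgeSet) :
    edgeInd G x y e = open Classical in if (e : Sym2 V) = s(x, y) then 1 else 0 := by
  classical
  rw [edgeInd, dif_pos h, Finsupp.single_apply]
  simp only [eq_comm (a := (e : Sym2 V)), Subtype.ext_iff]

open Classical in
theorem vertexSum_edgeInd {x y : V} (h : G.Adj x y) :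
    vertexSum G (edgeInd G x y) = Pi.single x 1 + Pi.single y 1 := by
  rw [edgeInd, dif_pos h, vertexSum, Finsupp.linearCombination_single, one_smul]
  funext v
  simp only [edgeVector, Sym2.mem_iff, Pi.add_apply, Pi.single_apply]
  by_cases h1 : v = x
  · subst h1; simp [h.ne]
  · simp [h1]

/-- The alternating sum of the edges of a walk. -/
noncomputable def altSum (G : SimpleGraph V) (q : ℕ → V) (n : ℕ) : G.edgeSet →₀ ℤ :=
  ∑ i ∈ Finset.range n, (-1 : ℤ) ^ i • edgeInd G (q i) (q (i + 1))

open Classical in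
-- The sum telescopes to the two ends of the walk. On a closed walk it vanishes for even length and
-- is twice the base vertex for odd length.
theorem vertexSum_altSum {q : ℕ → V} {n : ℕ} (h : ∀ i < n, G.Adj (q i) (q (i + 1))) :
    vertexSum G (altSum G q n) = Pi.single (q 0) 1 - (-1 : ℤ) ^ n • Pi.single (q n) 1 := by
  induction n with
  | zero => simp [altSum]
  | succ n ih =>
    rw [altSum, Finset.sum_range_succ, map_add, ← altSum, ih fun i hi => h i (by omega), map_smul,
      vertexSum_edgeInd (h n (by omega)), pow_succ]
    module

theorem altSum_apply_ne_zero {q : ℕ → V} {n : ℕ} (h : ∀ i < n, G.Adj (q i) (q (i + 1)))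
    {e : G.edgeSet} (he : altSum G q n e ≠ 0) : ∃ i < n, (e : Sym2 V) = s(q i, q (i + 1)) := by
  classical
  by_contra! hcon
  apply he
  rw [altSum, Finsupp.finsetSum_apply]
  refine Finset.sum_eq_zero fun i hi => ?_
  rw [Finset.mem_range] at hi
  rw [Finsupp.smul_apply, edgeInd_apply (h i hi), if_neg (hcon i hi), smul_zero]

/-- Serves to show that a weighting is nonzero: the first edge is not used again, so nothing cancels
there. -/
theorem altSum_apply_first {q : ℕ → V} {n : ℕ} (hn : 0 < n)
    (h : ∀ i < n, G.Adj (q i) (q (i + 1)))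
    (hne : ∀ i, 0 < i → i < n → s(q 0, q 1) ≠ s(q i, q (i + 1))) :
    altSum G q n ⟨s(q 0, q 1), h 0 hn⟩ = 1 := by
  classical
  rw [altSum, Finsupp.finsetSum_apply, Finset.sum_eq_single 0]
  · rw [Finsupp.smul_apply, edgeInd_apply (h 0 hn)]; simp
  · intro i hi hi0
    rw [Finset.mem_range] at hi
    rw [Finsupp.smul_apply, edgeInd_apply (h i hi), if_neg (hne i (by omega) hi), smul_zero]
  · intro h; exact absurd (Finset.mem_range.2 hn) h

theorem IsCyc.adj_nat {n : ℕ} {c : ℤ → V} (h : IsCyc G n c) (i : ℕ) :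
    G.Adj (c i) (c (i + 1 : ℕ)) := by
  push_cast
  exact h.adj i

theorem IsCyc.first_ne {n : ℕ} {c : ℤ → V} (h : IsCyc G n c) {i : ℕ} (h0 : 0 < i) (hi : i < n) :
    s(c (0 : ℕ), c (1 : ℕ)) ≠ s(c i, c (i + 1 : ℕ)) := by
  intro he
  have h3 := h.three_le
  rcases Sym2.eq_iff.1 he with ⟨h1, -⟩ | ⟨h1, h2⟩
  · exact h.ne (by omega) (by omega) h1
  · have hi1 : i = 1 := by
      by_contra hi1
      exact h.ne (by omega) (by omega) h2
    subst hi1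
    exact h.ne (by omega) (by omega) h1

theorem IsCyc.nbr {n : ℕ} {c : ℤ → V} (h : IsCyc G n c) {i j : ℤ} {y : V}
    (he : s(c j, y) = s(c i, c (i + 1))) : y = c (j + 1) ∨ y = c (j - 1) := by
  rcases Sym2.eq_iff.1 he with ⟨h1, rfl⟩ | ⟨h1, rfl⟩
  · left
    rw [h.eq_iff] at h1 ⊢
    rw [← dvd_neg]
    rwa [show -(i + 1 - (j + 1)) = j - i by ring]
  · right
    rw [h.eq_iff] at h1 ⊢
    rw [← dvd_neg]
    rwa [show -(i - (j - 1)) = j - (i + 1) by ring]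

/-- A 4-cycle that runs into a cycle at vertices without further neighbours. -/
theorem IsCyc.square_eq {n : ℕ} {c : ℤ → V} (h : IsCyc G n c) {r : V → V → Prop} {j : ℤ}
    {q₀ q₂ q₃ : V} (h02 : q₀ ≠ q₂) (h13 : c j ≠ q₃)
    (hn0 : ∀ y, r (c j) y → y = c (j + 1) ∨ y = c (j - 1))
    (hn1 : ∀ y, r (c (j + 1)) y → y = c (j + 2) ∨ y = c j)
    (hn2 : ∀ y, r (c (j + 2)) y → y = c (j + 3) ∨ y = c (j + 1))
    (r0 : r (c j) q₀) (r2 : r (c j) q₂) (r23 : r q₂ q₃) (r30 : r q₃ q₀) (hq : q₂ = c (j + 1)) :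
    n = 4 := by
  have h0 : q₀ = c (j - 1) := (hn0 _ r0).resolve_left fun e => h02 (e.trans hq.symm)
  subst hq
  have h3 : q₃ = c (j + 2) := (hn1 _ r23).resolve_right fun e => h13 e.symm
  subst h3
  have h4 : q₀ = c (j + 3) := (hn2 _ r30).resolve_right h02
  rw [h0, eq_comm, h.eq_iff] at h4
  rw [show j + 3 - (j - 1) = 4 by ring] at h4
  have h3 := h.three_le
  have := Int.le_of_dvd (by norm_num) h4
  have : n = 3 ∨ n = 4 := by omega
  rcases this with rfl | rfl
  · omega
  · rfl

/-- Alternating signs along the cycle have zero vertex sums, so the edges of the cycle contain a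
4-cycle. As every vertex has only two neighbors along these edges, that 4-cycle is the whole cycle.
-/
theorem IsCyc.length_eq_four_of_even [Finite V] (hr : IsRobust (graphIdeal K G))
    (hq : IsGeneratedByQuadrics (graphIdeal K G)) {n : ℕ} {c : ℤ → V} (h : IsCyc G n c)
    (hn : Even n) : n = 4 := by
  classical
  have h3 := h.three_le
  let q : ℕ → V := fun i => c i
  have hadj : ∀ i < n, G.Adj (q i) (q (i + 1)) := fun i _ => h.adj_nat i
  have hz : altSum G q n ≠ 0 := by
    intro h0
    have := altSum_apply_first (by omega) hadj fun i h0 hi => h.first_ne h0 hi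
    rw [h0] at this
    simp at this
  have hker : vertexSum G (altSum G q n) = 0 := by
    rw [vertexSum_altSum hadj, hn.neg_one_pow]
    have : q n = q 0 := by simpa [q] using h.add_period 0
    rw [this]; simp
  obtain ⟨a, b, x, d, hax, hbd, r1, r2, r3, r4⟩ :=
    exists_square_of_vertexSum_eq_zero hr hq hz hker
  have hedge : ∀ {x y}, Carries (altSum G q n) x y → ∃ i : ℤ, s(x, y) = s(c i, c (i + 1)) := by
    rintro x y ⟨_, he⟩
    obtain ⟨i, -, hi⟩ := altSum_apply_ne_zero hadj he
    exact ⟨i, by simpa [q] using hi⟩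
  have hnbr : ∀ j y, Carries (altSum G q n) (c j) y → y = c (j + 1) ∨ y = c (j - 1) := by
    intro j y hy
    obtain ⟨i, hi⟩ := hedge hy
    exact h.nbr hi
  obtain ⟨j, rfl⟩ : ∃ j, b = c j := by
    obtain ⟨i, hi⟩ := hedge r2
    rcases Sym2.eq_iff.1 hi with ⟨rfl, -⟩ | ⟨rfl, -⟩
    · exact ⟨i, rfl⟩
    · exact ⟨i + 1, rfl⟩
  have n1 : ∀ y, Carries (altSum G q n) (c (j + 1)) y → y = c (j + 2) ∨ y = c j := fun y hy => by
    simpa [show j + 1 + 1 = j + 2 by ring] using hnbr _ _ hy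
  have n2 : ∀ y, Carries (altSum G q n) (c (j + 2)) y → y = c (j + 3) ∨ y = c (j + 1) :=
    fun y hy => by
      simpa [show j + 2 + 1 = j + 3 by ring, show j + 2 - 1 = j + 1 by ring] using hnbr _ _ hy
  rcases hnbr j x r2 with hx | hx
  · exact h.square_eq hax hbd (hnbr j) n1 n2 r1.symm r2 r3 r4 hx
  · have ha : a = c (j + 1) := (hnbr j a r1.symm).resolve_right fun e => hax (e.trans hx.symm)
    exact h.square_eq hax.symm hbd (hnbr j) n1 n2 r2 r1.symm r4.symm r3.symm ha

/-- A 4-cycle contains no vertex of an odd cycle that has no neighbours outside this cycle. -/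
theorem IsCyc.not_square {n : ℕ} {c : ℤ → V} (h : IsCyc G n c) (hodd : Odd n) {r : V → V → Prop}
    (hsymm : ∀ x y, r x y → r y x) (hirr : ∀ x, ¬ r x x)
    (hnbr : ∀ j, ¬ (n : ℤ) ∣ j → ∀ y, r (c j) y → y = c (j + 1) ∨ y = c (j - 1))
    {j : ℤ} (hj : ¬ (n : ℤ) ∣ j) {q₀ q₂ q₃ : V} (h02 : q₀ ≠ q₂) (h13 : c j ≠ q₃)
    (r0 : r (c j) q₀) (r2 : r (c j) q₂) (r23 : r q₂ q₃) (r30 : r q₃ q₀) : False := by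
  have h3 := h.three_le
  have h4 : n ≠ 4 := by rintro rfl; exact absurd hodd (by decide)
  wlog hq : q₂ = c (j + 1) generalizing q₀ q₂
  · have hq' := (hnbr j hj _ r2).resolve_left hq
    exact this h02.symm r2 r0 (hsymm _ _ r30) (hsymm _ _ r23)
      ((hnbr j hj _ r0).resolve_right fun e => h02 (e.trans hq'.symm))
  have h0 : q₀ = c (j - 1) := (hnbr j hj _ r0).resolve_left fun e => h02 (e.trans hq.symm)
  have up : ¬ (n : ℤ) ∣ j + 1 → q₃ = c (j + 2) := fun hd => by
    rw [hq] at r23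
    have := hnbr _ hd _ r23
    rw [show j + 1 + 1 = j + 2 by ring, show j + 1 - 1 = j by ring] at this
    exact this.resolve_right fun e => h13 e.symm
  have down : ¬ (n : ℤ) ∣ j - 1 → q₃ = c (j - 2) := fun hd => by
    rw [h0] at r30
    have := hnbr _ hd _ (hsymm _ _ r30)
    rw [show j - 1 + 1 = j by ring, show j - 1 - 1 = j - 2 by ring] at this
    exact this.resolve_left fun e => h13 e.symm
  by_cases hn3 : n = 3
  · subst hn3
    by_cases h1 : ((3 : ℕ) : ℤ) ∣ j + 1
    · have e := down (by omega)
      have : c (j - 2) = c (j + 1) := (h.eq_iff _ _).2 (by omega)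
      rw [hq, e, this] at r23
      exact hirr _ r23
    · have e := up h1
      have : c (j + 2) = c (j - 1) := (h.eq_iff _ _).2 (by omega)
      rw [h0, e, this] at r30
      exact hirr _ r30
  have small : ∀ k : ℤ, 0 < k → k < 5 → ¬ (n : ℤ) ∣ k := fun k h1 h2 hd => by
    have := Int.le_of_dvd h1 hd
    omega
  -- `IsCyc.square_eq` needs three consecutive vertices different from `c 0`. Now `n ≥ 5`, so either
  -- `j, j + 1, j + 2` or `j, j - 1, j - 2` will do, the latter after a reflection that fixes `j`.
  by_cases hu : ¬ (n : ℤ) ∣ j + 1 ∧ ¬ (n : ℤ) ∣ j + 2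
  · refine h4 (h.square_eq h02 h13 (hnbr j hj) (fun y hy => ?_) (fun y hy => ?_) r0 r2 r23 r30 hq)
    · have := hnbr _ hu.1 _ hy
      rwa [show j + 1 + 1 = j + 2 by ring, show j + 1 - 1 = j by ring] at this
    · have := hnbr _ hu.2 _ hy
      rwa [show j + 2 + 1 = j + 3 by ring, show j + 2 - 1 = j + 1 by ring] at this
  · have hd1 : ¬ (n : ℤ) ∣ j - 1 := fun hd => hu ⟨fun h1 => small 2 (by norm_num) (by norm_num) (by
        have := dvd_sub h1 hd
        rwa [show j + 1 - (j - 1) = 2 by ring] at this), fun h1 => small 3 (by norm_num)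
        (by norm_num) (by
        have := dvd_sub h1 hd
        rwa [show j + 2 - (j - 1) = 3 by ring] at this)⟩
    have hd2 : ¬ (n : ℤ) ∣ j - 2 := fun hd => hu ⟨fun h1 => small 3 (by norm_num) (by norm_num) (by
        have := dvd_sub h1 hd
        rwa [show j + 1 - (j - 2) = 3 by ring] at this), fun h1 => small 4 (by norm_num)
        (by norm_num) (by
        have := dvd_sub h1 hd
        rwa [show j + 2 - (j - 2) = 4 by ring] at this)⟩
    have e0 : 2 * j - j = j := by ring
    have e1 : 2 * j - (j + 1) = j - 1 := by ring
    have e2 : 2 * j - (j + 2) = j - 2 := by ring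
    have e3 : 2 * j - (j + 3) = j - 3 := by ring
    have e4 : 2 * j - (j - 1) = j + 1 := by ring
    refine h4 ((h.reflect (2 * j)).square_eq (r := r) (j := j) h02.symm ?_ ?_ ?_ ?_ ?_ ?_
      (hsymm _ _ r30) (hsymm _ _ r23) ?_) <;> simp only [e0, e1, e2, e3, e4]
    · exact h13
    · exact fun y hy => (hnbr j hj y hy).symm
    · intro y hy
      have := hnbr _ hd1 _ hy
      rw [show j - 1 + 1 = j by ring, show j - 1 - 1 = j - 2 by ring] at this
      exact this.symm
    · intro y hy
      have := hnbr _ hd2 _ hy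
      rw [show j - 2 + 1 = j - 1 by ring, show j - 2 - 1 = j - 3 by ring] at this
      exact this.symm
    · exact r2
    · exact r0
    · exact h0

end Circuits

end ToricGraph

namespace ToricGraph

/-! ### Two odd cycles of the graph share two vertices. -/

section OddCycles

universe u w

variable {V : Type u} {G : SimpleGraph V} {K : Type w} [Field K]

/-- Even cycles have length four, odd cycles share two vertices, and there is no `K₄`. -/
structure HasSquareCircuits (G : SimpleGraph V) : Prop where
  even : ∀ n c, IsCyc G n c → Even n → n = 4
  odd : ∀ n c m d, IsCyc G n c → IsCyc G m d → Odd n → Odd m →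
    ∃ i j i' j', c i = d i' ∧ c j = d j' ∧ c i ≠ c j
  not_K4 : ∀ x y z t, G.Adj x y → G.Adj x z → G.Adj x t → G.Adj y z → G.Adj y t → G.Adj z t → False

/-- Two odd cycles joined by a path. -/
theorem false_of_odd_cycles_path [Finite V] (hr : IsRobust (graphIdeal K G))
    (hq : IsGeneratedByQuadrics (graphIdeal K G)) {n m L : ℕ} {c d : ℤ → V} {q : ℕ → V}
    (hc : IsCyc G n c) (hd : IsCyc G m d) (hn : Odd n) (hm : Odd m)
    (hadj : ∀ i < L, G.Adj (q i) (q (i + 1))) (hinj : ∀ i j, i ≤ L → j ≤ L → q i = q j → i = j)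
    (h0 : q 0 = c 0) (hL : q L = d 0) (hcq : ∀ i k, k ≤ L → c i = q k → k = 0)
    (hdq : ∀ i k, k ≤ L → d i = q k → k = L)
    (hcd : ∀ i j, c i = d j → c i = c 0 ∧ d j = d 0) : False := by
  classical
  have hc3 := hc.three_le
  have hd3 := hd.three_le
  let c' : ℕ → V := fun i => c i
  let d' : ℕ → V := fun i => d i
  have hadjc : ∀ i < n, G.Adj (c' i) (c' (i + 1)) := fun i _ => hc.adj_nat i
  have hadjd : ∀ i < m, G.Adj (d' i) (d' (i + 1)) := fun i _ => hd.adj_nat i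
  -- An odd cycle contributes 2 at its base vertex. The path with coefficient 2 carries this to the
  -- other cycle, where the sign `(-1) ^ L` makes the contributions cancel.
  set z := altSum G c' n - (2 : ℤ) • altSum G q L - (-1 : ℤ) ^ L • altSum G d' m with hzdef
  have hc1 : c 1 ≠ c 0 := (hc.ne (by omega) (by omega) : c 0 ≠ c 1).symm
  have hz : z ≠ 0 := by
    intro hz0
    have h1 := altSum_apply_first (G := G) (q := c') (by omega) hadjc
      fun i h0 hi => hc.first_ne h0 hi
    have h2 : altSum G q L ⟨s(c' 0, c' 1), hadjc 0 (by omega)⟩ = 0 := by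
      by_contra hne
      obtain ⟨k, hk, he⟩ := altSum_apply_ne_zero hadj hne
      rcases Sym2.eq_iff.1 he with ⟨-, h⟩ | ⟨-, h⟩
      · have := hcq 1 (k + 1) (by omega) (by simpa [c'] using h)
        omega
      · have := hcq 1 k (by omega) (by simpa [c'] using h)
        subst this
        exact hc1 ((by simpa [c'] using h : c 1 = q 0).trans h0)
    have h3 : altSum G d' m ⟨s(c' 0, c' 1), hadjc 0 (by omega)⟩ = 0 := by
      by_contra hne
      obtain ⟨k, hk, he⟩ := altSum_apply_ne_zero hadjd hne
      rcases Sym2.eq_iff.1 he with ⟨-, h⟩ | ⟨-, h⟩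
      · exact hc1 (hcd 1 (k + 1 : ℕ) (by simpa [c', d'] using h)).1
      · exact hc1 (hcd 1 k (by simpa [c', d'] using h)).1
    have h4 := DFunLike.congr_fun hz0 ⟨s(c' 0, c' 1), hadjc 0 (by omega)⟩
    rw [hzdef] at h4
    simp only [Finsupp.sub_apply, Finsupp.smul_apply, h1, h2, h3, Finsupp.zero_apply] at h4
    simp at h4
  have hker : vertexSum G z = 0 := by
    rw [hzdef, map_sub, map_sub, map_smul, map_smul, vertexSum_altSum hadjc, vertexSum_altSum hadjd,
      vertexSum_altSum hadj, hn.neg_one_pow, hm.neg_one_pow]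
    have e1 : c' n = c 0 := by simpa [c'] using hc.add_period 0
    have e2 : d' m = d 0 := by simpa [d'] using hd.add_period 0
    have e3 : c' 0 = c 0 := by simp [c']
    have e4 : d' 0 = d 0 := by simp [d']
    rw [e1, e2, e3, e4, h0, hL]
    module
  obtain ⟨x₀, x₁, x₂, x₃, h02, h13, r01, r12, r23, r30⟩ :=
    exists_square_of_vertexSum_eq_zero hr hq hz hker
  have hsymm : ∀ x y, Carries z x y → Carries z y x := fun _ _ h => h.symm
  have hirr : ∀ x, ¬ Carries z x x := fun x h => h.adj.ne rfl
  have hedge : ∀ x y, Carries z x y → (∃ i : ℤ, s(x, y) = s(c i, c (i + 1))) ∨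
      (∃ k < L, s(x, y) = s(q k, q (k + 1))) ∨ ∃ i : ℤ, s(x, y) = s(d i, d (i + 1)) := by
    rintro x y ⟨hxy, hne⟩
    by_cases h1 : altSum G c' n ⟨s(x, y), hxy⟩ = 0
    · by_cases h2 : altSum G q L ⟨s(x, y), hxy⟩ = 0
      · by_cases h3 : altSum G d' m ⟨s(x, y), hxy⟩ = 0
        · rw [hzdef] at hne
          simp [h1, h2, h3] at hne
        · obtain ⟨i, -, hi⟩ := altSum_apply_ne_zero hadjd h3
          exact Or.inr (Or.inr ⟨i, by simpa [d'] using hi⟩)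
      · exact Or.inr (Or.inl (altSum_apply_ne_zero hadj h2))
    · obtain ⟨i, -, hi⟩ := altSum_apply_ne_zero hadjc h1
      exact Or.inl ⟨i, by simpa [c'] using hi⟩
  have hcn : ∀ j, c j = c 0 → (n : ℤ) ∣ j := fun j h => by simpa [hc.eq_iff] using h
  have hdn : ∀ j, d j = d 0 → (m : ℤ) ∣ j := fun j h => by simpa [hd.eq_iff] using h
  have hcq' : ∀ i k, k ≤ L → c i = q k → (n : ℤ) ∣ i := fun i k hk h => by
    have := hcq i k hk h
    subst this
    exact hcn i (h.trans h0)
  have hdq' : ∀ i k, k ≤ L → d i = q k → (m : ℤ) ∣ i := fun i k hk h => by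
    have := hdq i k hk h
    subst this
    exact hdn i (h.trans hL)
  have nbrc : ∀ j, ¬ (n : ℤ) ∣ j → ∀ y, Carries z (c j) y → y = c (j + 1) ∨ y = c (j - 1) := by
    intro j hj y hy
    rcases hedge _ _ hy with ⟨i, hi⟩ | ⟨k, hk, hi⟩ | ⟨i, hi⟩
    · exact hc.nbr hi
    · rcases Sym2.eq_iff.1 hi with ⟨h, -⟩ | ⟨h, -⟩
      · exact absurd (hcq' _ _ (by omega) h) hj
      · exact absurd (hcq' _ _ (by omega) h) hj
    · rcases Sym2.eq_iff.1 hi with ⟨h, -⟩ | ⟨h, -⟩ <;> exact absurd (hcn _ (hcd _ _ h).1) hj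
  have nbrd : ∀ j, ¬ (m : ℤ) ∣ j → ∀ y, Carries z (d j) y → y = d (j + 1) ∨ y = d (j - 1) := by
    intro j hj y hy
    rcases hedge _ _ hy with ⟨i, hi⟩ | ⟨k, hk, hi⟩ | ⟨i, hi⟩
    · rcases Sym2.eq_iff.1 hi with ⟨h, -⟩ | ⟨h, -⟩ <;>
        exact absurd (hdn _ (hcd _ _ h.symm).2) hj
    · rcases Sym2.eq_iff.1 hi with ⟨h, -⟩ | ⟨h, -⟩
      · exact absurd (hdq' _ _ (by omega) h) hj
      · exact absurd (hdq' _ _ (by omega) h) hj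
    · exact hd.nbr hi
  -- Away from `c 0` and `d 0` a vertex of either cycle has no neighbors in the support except along
  -- its cycle, so by `IsCyc.not_square` no 4-cycle passes through it. All vertices of the 4-cycle
  -- are thus pushed onto the path.
  have notc : ∀ a₀ a₁ a₂ a₃, a₀ ≠ a₂ → a₁ ≠ a₃ → Carries z a₀ a₁ → Carries z a₁ a₂ →
      Carries z a₂ a₃ → Carries z a₃ a₀ → ∃ k ≤ L, a₁ = q k := by
    intro a₀ a₁ a₂ a₃ h1 h2 s01 s12 s23 s30
    have out1 : ∀ j, ¬ (n : ℤ) ∣ j → a₁ ≠ c j := by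
      rintro j hj rfl
      exact hc.not_square hn hsymm hirr nbrc hj h1 h2 s01.symm s12 s23 s30
    have out2 : ∀ j, ¬ (n : ℤ) ∣ j → a₂ ≠ c j := by
      rintro j hj rfl
      exact hc.not_square hn hsymm hirr nbrc hj h2 h1.symm s12.symm s23 s30 s01
    have out3 : ∀ j, ¬ (m : ℤ) ∣ j → a₁ ≠ d j := by
      rintro j hj rfl
      exact hd.not_square hm hsymm hirr nbrd hj h1 h2 s01.symm s12 s23 s30
    have out4 : ∀ j, ¬ (m : ℤ) ∣ j → a₂ ≠ d j := by
      rintro j hj rfl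
      exact hd.not_square hm hsymm hirr nbrd hj h2 h1.symm s12.symm s23 s30 s01
    have hsucc : ∀ (l : ℕ), 3 ≤ l → ∀ i : ℤ, (l : ℤ) ∣ i → ¬ (l : ℤ) ∣ i + 1 := by
      intro l hl i h1 h2
      have := dvd_sub h2 h1
      rw [show i + 1 - i = 1 by ring] at this
      have := Int.le_of_dvd one_pos this
      omega
    rcases hedge _ _ s12 with ⟨i, hi⟩ | ⟨k, hk, hi⟩ | ⟨i, hi⟩
    · by_cases hdv : (n : ℤ) ∣ i
      · have := hsucc n hc3 i hdv
        rcases Sym2.eq_iff.1 hi with ⟨-, h⟩ | ⟨h, -⟩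
        · exact absurd h (out2 _ this)
        · exact absurd h (out1 _ this)
      · rcases Sym2.eq_iff.1 hi with ⟨h, -⟩ | ⟨-, h⟩
        · exact absurd h (out1 _ hdv)
        · exact absurd h (out2 _ hdv)
    · rcases Sym2.eq_iff.1 hi with ⟨h, -⟩ | ⟨h, -⟩
      · exact ⟨k, hk.le, h⟩
      · exact ⟨k + 1, hk, h⟩
    · by_cases hdv : (m : ℤ) ∣ i
      · have := hsucc m hd3 i hdv
        rcases Sym2.eq_iff.1 hi with ⟨-, h⟩ | ⟨h, -⟩
        · exact absurd h (out4 _ this)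
        · exact absurd h (out3 _ this)
      · rcases Sym2.eq_iff.1 hi with ⟨h, -⟩ | ⟨-, h⟩
        · exact absurd h (out3 _ hdv)
        · exact absurd h (out4 _ hdv)
  obtain ⟨k₁, hk₁, rfl⟩ := notc _ _ _ _ h02 h13 r01 r12 r23 r30
  obtain ⟨k₂, hk₂, rfl⟩ := notc _ _ _ _ h13 h02.symm r12 r23 r30 r01
  obtain ⟨k₃, hk₃, rfl⟩ := notc _ _ _ _ h02.symm h13.symm r23 r30 r01 r12
  obtain ⟨k₀, hk₀, rfl⟩ := notc _ _ _ _ h13.symm h02 r30 r01 r12 r23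
  -- Between path vertices the support has only path edges, so adjacent vertices have consecutive
  -- indices. No four indices with two distinct opposite pairs satisfy this cyclically.
  have step : ∀ k l, k ≤ L → l ≤ L → Carries z (q k) (q l) → l = k + 1 ∨ k = l + 1 := by
    intro k l hk hl h
    have hkl : q k ≠ q l := h.adj.ne
    rcases hedge _ _ h with ⟨i, hi⟩ | ⟨t, ht, hi⟩ | ⟨i, hi⟩
    · exfalso
      apply hkl
      rcases Sym2.eq_iff.1 hi with ⟨e1, e2⟩ | ⟨e1, e2⟩
      · rw [hcq _ _ hk e1.symm, hcq _ _ hl e2.symm]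
      · rw [hcq _ _ hk e1.symm, hcq _ _ hl e2.symm]
    · rcases Sym2.eq_iff.1 hi with ⟨e1, e2⟩ | ⟨e1, e2⟩
      · have := hinj _ _ hk (by omega) e1
        have := hinj _ _ hl (by omega) e2
        omega
      · have := hinj _ _ hk (by omega) e1
        have := hinj _ _ hl (by omega) e2
        omega
    · exfalso
      apply hkl
      rcases Sym2.eq_iff.1 hi with ⟨e1, e2⟩ | ⟨e1, e2⟩
      · rw [hdq _ _ hk e1.symm, hdq _ _ hl e2.symm]
      · rw [hdq _ _ hk e1.symm, hdq _ _ hl e2.symm]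
  have := step _ _ hk₀ hk₁ r01
  have := step _ _ hk₁ hk₂ r12
  have := step _ _ hk₂ hk₃ r23
  have := step _ _ hk₃ hk₀ r30
  have : k₀ ≠ k₂ := fun h => h02 (by rw [h])
  have : k₁ ≠ k₃ := fun h => h13 (by rw [h])
  omega

/-- Cycles that meet in a single vertex are joined there by a path of length 0, and disjoint cycles
are joined by a path that exists because the graph is connected. `false_of_odd_cycles_path` excludes
both. -/
theorem odd_cycles_share [Finite V] (hconn : G.Connected) (hr : IsRobust (graphIdeal K G))
    (hq : IsGeneratedByQuadrics (graphIdeal K G)) {n m : ℕ} {c d : ℤ → V}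
    (hc : IsCyc G n c) (hd : IsCyc G m d) (hn : Odd n) (hm : Odd m) :
    ∃ i j i' j', c i = d i' ∧ c j = d j' ∧ c i ≠ c j := by
  classical
  by_contra! hcon
  by_cases hmeet : ∃ i j, c i = d j
  · obtain ⟨i₀, j₀, h0⟩ := hmeet
    refine false_of_odd_cycles_path hr hq (L := 0) (q := fun _ => c i₀) (hc.shift i₀)
      (hd.shift j₀) hn hm (by simp) (by simp) (by simp) (by simpa) (by simp) (by simp) ?_
    intro i j he
    have := hcon _ _ _ _ he h0
    exact ⟨by simpa using this, by
      have h2 : d (j₀ + j) = d j₀ := he.symm.trans (this.trans h0)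
      simpa using h2⟩
  · push Not at hmeet
    obtain ⟨L, q, h0, hL, hS, hinj, hr', -⟩ := (reachable_iff_linked.1
      (hconn.preconnected (c 0) (d 0))).exists_path (S := Set.range d) (by simp) ⟨0, rfl⟩
    obtain ⟨j₀, hj₀⟩ := hL
    -- The path stops at its first vertex on `d` but may return to `c`, so only the part after its
    -- last visit to `c` is kept.
    let P : ℕ → Prop := fun k => q k ∈ Set.range c
    have hP : P (Nat.findGreatest P L) :=
      Nat.findGreatest_spec (P := P) (m := 0) (Nat.zero_le L) ⟨0, h0.symm⟩
    have hmax : ∀ j, Nat.findGreatest P L < j → j ≤ L → ¬ P j := fun j h1 h2 =>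
      Nat.findGreatest_is_greatest h1 h2
    have hle := Nat.findGreatest_le (P := P) L
    generalize Nat.findGreatest P L = k₀ at hP hmax hle
    obtain ⟨i₀, hi₀⟩ := hP
    refine false_of_odd_cycles_path hr hq (L := L - k₀) (q := fun k => q (k₀ + k)) (hc.shift i₀)
      (hd.shift j₀) hn hm (fun i hi => hr' _ (by omega)) (fun i j hi hj he => ?_)
      (by simp [hi₀]) (by simp [hj₀, Nat.add_sub_cancel' hle]) ?_ ?_
      (fun i j he => absurd he (hmeet _ _))
    · have := hinj _ _ (by omega) (by omega) he
      omega
    · intro i k hk he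
      by_contra hk0
      exact hmax (k₀ + k) (by omega) (by omega) ⟨_, he⟩
    · intro i k hk he
      by_contra hkL
      exact hS (k₀ + k) (by omega) ⟨_, he⟩

end OddCycles

end ToricGraph

namespace ToricGraph

/-! ### The two matchings of a 4-cycle, and the exclusion of `K₄`. -/

section Matchings

universe u w

variable {V : Type u} {G : SimpleGraph V} {K : Type w} [Field K]

/-- The monomial of a pair of edges. -/
noncomputable def pairMon {x y z t : V} (h : G.Adj x y) (h' : G.Adj z t) : G.edgeSet →₀ ℕ :=
  Finsupp.single ⟨s(x, y), h⟩ 1 + Finsupp.single ⟨s(z, t), h'⟩ 1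

theorem degree_pairMon {x y z t : V} (h : G.Adj x y) (h' : G.Adj z t) :
    (pairMon h h').degree = 2 := by
  simp [pairMon]

theorem wt_pairMon {x y z t : V} (h : G.Adj x y) (h' : G.Adj z t) :
    wt (edgeVector G) (pairMon h h') = edgeVector G ⟨s(x, y), h⟩ + edgeVector G ⟨s(z, t), h'⟩ := by
  rw [pairMon, wt, map_add]
  exact congrArg₂ _ (wt_single _) (wt_single _)

theorem wt_pairMon_eq {x y z t : V} (hxy : G.Adj x y) (hzt : G.Adj z t) (hxz : G.Adj x z)
    (hyt : G.Adj y t) (hxt : x ≠ t) (hyz : y ≠ z) :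
    wt (edgeVector G) (pairMon hxy hzt) = wt (edgeVector G) (pairMon hxz hyt) := by
  classical
  rw [wt_pairMon, wt_pairMon]
  funext v
  simp only [edgeVector, Pi.add_apply, Sym2.mem_iff]
  have := hxy.ne
  have := hzt.ne
  have := hxz.ne
  have := hyt.ne
  by_cases h1 : v = x
  · subst h1; simp_all
  by_cases h2 : v = y
  · subst h2; simp_all
  by_cases h3 : v = z
  · subst h3; simp_all
  by_cases h4 : v = t
  · subst h4; simp_all
  simp [h1, h2, h3, h4]

theorem edge_ne {x y z t : V} (h : G.Adj x y) (h' : G.Adj z t) (hne : s(x, y) ≠ s(z, t)) :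
    (⟨s(x, y), h⟩ : G.edgeSet) ≠ ⟨s(z, t), h'⟩ := fun e => hne (congrArg Subtype.val e)

theorem pairMon_ne {x y z t : V} (hxy : G.Adj x y) (hzt : G.Adj z t) (hxz : G.Adj x z)
    (hyt : G.Adj y t) (hxt : x ≠ t) (hyz : y ≠ z) : pairMon hxy hzt ≠ pairMon hxz hyt := by
  classical
  intro h
  have := DFunLike.congr_fun h ⟨s(x, y), hxy⟩
  simp only [pairMon, Finsupp.add_apply, Finsupp.single_apply, if_true] at this
  rw [if_neg (edge_ne hxz hxy (by simp [hyz.symm, hxy.ne])),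
    if_neg (edge_ne hyt hxy (by simp [hxy.ne.symm, hxt.symm]))] at this
  omega

/-- In the variables of a 4-cycle there is only one quadratic binomial. -/
theorem eq_pairMon {x y z t : V} (hxy : G.Adj x y) (hzt : G.Adj z t) (hxz : G.Adj x z)
    (hyt : G.Adj y t) (hxt : x ≠ t) (hyz : y ≠ z) {a b : G.edgeSet →₀ ℕ}
    (hw : wt (edgeVector G) a = wt (edgeVector G) b) (hab : a ≠ b)
    (ha : ∀ e, a e ≠ 0 → pairMon hxy hzt e ≠ 0 ∨ pairMon hxz hyt e ≠ 0)
    (hb : ∀ e, b e ≠ 0 → pairMon hxy hzt e ≠ 0 ∨ pairMon hxz hyt e ≠ 0)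
    (hda : a.degree = 2) (hdb : b.degree = 2) :
    (a = pairMon hxy hzt ∧ b = pairMon hxz hyt) ∨ (a = pairMon hxz hyt ∧ b = pairMon hxy hzt) := by
  classical
  have n1 := hxy.ne
  have n2 := hzt.ne
  have n3 := hxz.ne
  have n4 := hyt.ne
  have d1 := edge_ne hxy hzt (by simp [n3, hxt])
  have d2 := edge_ne hxy hxz (by simp [hyz, n3])
  have d3 := edge_ne hxy hyt (by simp [n1, hxt])
  have d4 := edge_ne hzt hxz (by simp [n3.symm, hxt.symm])
  have d5 := edge_ne hzt hyt (by simp [hyz.symm, n2])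
  have d6 := edge_ne hxz hyt (by simp [n1, hxt])
  have w1 : ∀ v, edgeVector G ⟨s(x, y), hxy⟩ v = if v = x ∨ v = y then 1 else 0 := fun v => by
    simp [edgeVector]
  have w2 : ∀ v, edgeVector G ⟨s(z, t), hzt⟩ v = if v = z ∨ v = t then 1 else 0 := fun v => by
    simp [edgeVector]
  have w3 : ∀ v, edgeVector G ⟨s(x, z), hxz⟩ v = if v = x ∨ v = z then 1 else 0 := fun v => by
    simp [edgeVector]
  have w4 : ∀ v, edgeVector G ⟨s(y, t), hyt⟩ v = if v = y ∨ v = t then 1 else 0 := fun v => by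
    simp [edgeVector]
  unfold pairMon at ha hb ⊢
  generalize (⟨s(x, y), hxy⟩ : G.edgeSet) = e₁ at *
  generalize (⟨s(z, t), hzt⟩ : G.edgeSet) = e₂ at *
  generalize (⟨s(x, z), hxz⟩ : G.edgeSet) = f₁ at *
  generalize (⟨s(y, t), hyt⟩ : G.edgeSet) = f₂ at *
  have expand : ∀ u : G.edgeSet →₀ ℕ,
      (∀ e, u e ≠ 0 → (Finsupp.single e₁ 1 + Finsupp.single e₂ 1 : G.edgeSet →₀ ℕ) e ≠ 0 ∨
        (Finsupp.single f₁ 1 + Finsupp.single f₂ 1 : G.edgeSet →₀ ℕ) e ≠ 0) →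
      u = Finsupp.single e₁ (u e₁) + Finsupp.single e₂ (u e₂) + Finsupp.single f₁ (u f₁) +
        Finsupp.single f₂ (u f₂) := by
    intro u hu
    ext e
    have hue := hu e
    simp only [Finsupp.add_apply, Finsupp.single_apply] at hue ⊢
    by_cases h1 : e₁ = e
    · subst h1; simp [d1.symm, d2.symm, d3.symm]
    by_cases h2 : e₂ = e
    · subst h2; simp [h1, d4.symm, d5.symm]
    by_cases h3 : f₁ = e
    · subst h3; simp [h1, h2, d6.symm]
    by_cases h4 : f₂ = e
    · subst h4; simp [h1, h2, h3]
    simp only [h1, h2, h3, h4, if_false, add_zero, ne_eq, not_true_eq_false, or_self] at hue ⊢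
    by_contra hne
    exact hue hne
  have ea := expand a ha
  have eb := expand b hb
  clear expand ha hb
  generalize a e₁ = a₁ at ea
  generalize a e₂ = a₂ at ea
  generalize a f₁ = a₃ at ea
  generalize a f₂ = a₄ at ea
  generalize b e₁ = b₁ at eb
  generalize b e₂ = b₂ at eb
  generalize b f₁ = b₃ at eb
  generalize b f₂ = b₄ at eb
  subst ea eb
  simp only [map_add, Finsupp.degree_single] at hda hdb
  have ev : ∀ v, wt (edgeVector G) (Finsupp.single e₁ a₁ + Finsupp.single e₂ a₂ +
      Finsupp.single f₁ a₃ + Finsupp.single f₂ a₄) v = wt (edgeVector G) (Finsupp.single e₁ b₁ +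
      Finsupp.single e₂ b₂ + Finsupp.single f₁ b₃ + Finsupp.single f₂ b₄) v := fun v => by rw [hw]
  simp only [wt, map_add, Finsupp.linearCombination_single, Pi.add_apply, Pi.smul_apply,
    smul_eq_mul, w1, w2, w3, w4] at ev
  have v1 := ev x
  have v2 := ev y
  have v3 := ev z
  have v4 := ev t
  simp [n1, n2, n3, n4, n1.symm, n2.symm, n3.symm, n4.symm, hxt, hyz, hxt.symm, hyz.symm]
    at v1 v2 v3 v4
  -- The four vertex equations say that `b₁ - a₁`, `b₂ - a₂`, `a₃ - b₃` and `a₄ - b₄` are equal. The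
  -- sign of this number selects the alternative, and degree 2 then fixes all exponents.
  have hcase : (a₁ = 1 ∧ a₂ = 1 ∧ a₃ = 0 ∧ a₄ = 0 ∧ b₁ = 0 ∧ b₂ = 0 ∧ b₃ = 1 ∧ b₄ = 1) ∨
      (a₁ = 0 ∧ a₂ = 0 ∧ a₃ = 1 ∧ a₄ = 1 ∧ b₁ = 1 ∧ b₂ = 1 ∧ b₃ = 0 ∧ b₄ = 0) := by
    have : ¬ (a₁ = b₁ ∧ a₂ = b₂ ∧ a₃ = b₃ ∧ a₄ = b₄) := by
      rintro ⟨rfl, rfl, rfl, rfl⟩; exact hab rfl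
    clear ev hw hab
    rcases lt_trichotomy a₁ b₁ with h | h | h
    · right; refine ⟨?_, ?_, ?_, ?_, ?_, ?_, ?_, ?_⟩ <;> omega
    · exact absurd ⟨h, by omega, by omega, by omega⟩ this
    · left; refine ⟨?_, ?_, ?_, ?_, ?_, ?_, ?_, ?_⟩ <;> omega
  rcases hcase with ⟨rfl, rfl, rfl, rfl, rfl, rfl, rfl, rfl⟩ | ⟨rfl, rfl, rfl, rfl, rfl, rfl, rfl, rfl⟩
  · left; constructor <;> simp
  · right; constructor <;> simp

theorem hasSquareCircuits_of_robust [Finite V] (hconn : G.Connected)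
    (hr : IsRobust (graphIdeal K G)) (hq : IsGeneratedByQuadrics (graphIdeal K G)) :
    HasSquareCircuits G where
  even n c h hn := h.length_eq_four_of_even hr hq hn
  odd n c m d hc hd hn hm := odd_cycles_share hconn hr hq hc hd hn hm
  not_K4 := by
    -- The three perfect matchings of a `K₄` have the same multidegree. Any two of them form a
    -- 4-cycle, whose binomial is the only quadratic one in its variables and so occurs in the
    -- universal Gröbner basis up to sign.
    intro x y z t hxy hxz hxt hyz hyt hzt
    have hdeg : ∀ u v, binom K u v ∈ universalGroebnerBasis (toricIdeal K (edgeVector G)) →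
        u ≠ v → wt (edgeVector G) u = wt (edgeVector G) v → u.degree = 2 :=
      fun u v hm hne hw => degree_eq_two_of_robust (fun _ _ => degree_eq_of_wt_eq)
        (fun _ _ => two_le_degree) hr hq hne hm hw
    have key : ∀ {x y z t : V} (hxy : G.Adj x y) (hzt : G.Adj z t) (hxz : G.Adj x z)
        (hyt : G.Adj y t), x ≠ t → y ≠ z →
        binom K (pairMon hxy hzt) (pairMon hxz hyt) ∈
          universalGroebnerBasis (toricIdeal K (edgeVector G)) ∨
        binom K (pairMon hxz hyt) (pairMon hxy hzt) ∈
          universalGroebnerBasis (toricIdeal K (edgeVector G)) := by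
      intro x y z t hxy hzt hxz hyt hxt hyz
      exact binom_mem_universalGroebnerBasis (pairMon_ne hxy hzt hxz hyt hxt hyz)
        (wt_pairMon_eq hxy hzt hxz hyt hxt hyz)
        (fun u v hw hne hu hv hd => eq_pairMon hxy hzt hxz hyt hxt hyz hw hne hu hv hd
          ((degree_eq_of_wt_eq hw).symm.trans hd)) hdeg
    have swap : ∀ {x y z t : V} (h : G.Adj x y) (h' : G.Adj z t), pairMon h h' = pairMon h h'.symm := by
      intro x y z t h h'
      have : (⟨s(z, t), h'⟩ : G.edgeSet) = ⟨s(t, z), h'.symm⟩ := Subtype.ext Sym2.eq_swap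
      rw [pairMon, pairMon, this]
    refine not_robust_of_triangle (a := pairMon hxy hzt) (b := pairMon hxz hyt)
      (c := pairMon hxt hyz) (pairMon_ne hxy hzt hxz hyt hxt.ne hyz.ne) ?_
      (key hxy hzt hxz hyt hxt.ne hyz.ne) ?_ ?_ hr
    · rw [swap hxy hzt]
      exact pairMon_ne hxy hzt.symm hxt hyz hxz.ne hyt.ne
    · rw [swap hxy hzt]
      exact key hxy hzt.symm hxt hyz hxz.ne hyt.ne
    · rw [swap hxz hyt, swap hxt hyz]
      exact key hxz hyt.symm hxt hyz.symm hxy.ne hzt.ne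

end Matchings

end ToricGraph

namespace ToricGraph

/-! ### Alternating closed walks contain alternating 4-cycles. -/

section Alternating

variable {V : Type*} {G : SimpleGraph V}

/-- The graph induced on a set of vertices, with the other vertices isolated. -/
def restrict (G : SimpleGraph V) (S : Set V) : SimpleGraph V where
  Adj x y := G.Adj x y ∧ x ∈ S ∧ y ∈ S
  symm := ⟨fun _ _ h => ⟨h.1.symm, h.2.2, h.2.1⟩⟩
  loopless := ⟨fun _ h => h.1.ne rfl⟩

theorem color_seq {f : V → Bool} {x : ℕ → V} {k l : ℕ} (hkl : k ≤ l)
    (h : ∀ i, k ≤ i → i < l → f (x i) ≠ f (x (i + 1))) : f (x l) = f (x k) ↔ Even (l - k) := by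
  induction l, hkl using Nat.le_induction with
  | base => simp
  | succ l hkl ih =>
    have h1 := h l hkl (by omega)
    have h2 := ih fun i h1 h2 => h i h1 (by omega)
    rw [Nat.succ_sub hkl, Nat.even_add_one, ← h2]
    revert h1
    cases f (x l) <;> cases f (x (l + 1)) <;> cases f (x k) <;> simp

/-- `E 0` and `E 1` are disjoint sets of edges such that every vertex covered by one of them is
covered by the other. -/
theorem exists_alternating_square [Finite V] (hG : HasSquareCircuits G) {E : ℕ → V → V → Prop}
    (hE : ∀ k l x y, k % 2 = l % 2 → E k x y → E l x y) (hsymm : ∀ k x y, E k x y → E k y x)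
    (hadj : ∀ k x y, E k x y → G.Adj x y) (hdisj : ∀ x y, E 0 x y → ¬ E 1 x y)
    (hnext : ∀ k x y, E k x y → ∃ z, E (k + 1) y z) (hne : ∃ x y, E 0 x y) :
    ∃ a b c d, a ≠ c ∧ b ≠ d ∧ E 0 a b ∧ E 1 b c ∧ E 0 c d ∧ E 1 d a := by
  classical
  -- Closed walks of positive even length that alternate between `E 0` and `E 1`. The number `β`
  -- records which set comes first. A shortest one is studied below.
  have hex : ∃ n, 0 < n ∧ n % 2 = 0 ∧ ∃ (x : ℕ → V) (β : ℕ), x n = x 0 ∧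
      ∀ i < n, E (β + i) (x i) (x (i + 1)) := by
    have hseq : ∃ x : ℕ → V, ∀ i, E i (x i) (x (i + 1)) := by
      obtain ⟨x₀, y₀, h₀⟩ := hne
      let T := {p : ℕ × V × V // E p.1 p.2.1 p.2.2}
      let nxt : T → T := fun p => ⟨(p.1.1 + 1, p.1.2.2, (hnext _ _ _ p.2).choose),
        (hnext _ _ _ p.2).choose_spec⟩
      let s : ℕ → T := fun k => nxt^[k] ⟨(0, x₀, y₀), h₀⟩
      have hs : ∀ k, s (k + 1) = nxt (s k) := fun k => Function.iterate_succ_apply' _ _ _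
      have hk : ∀ k, (s k).1.1 = k := by
        intro k
        induction k with
        | zero => rfl
        | succ k ih => rw [hs]; simp only [nxt, ih]
      refine ⟨fun k => (s k).1.2.1, fun k => ?_⟩
      have h1 := (s k).2
      rw [hk] at h1
      have h2 : (s (k + 1)).1.2.1 = (s k).1.2.2 := by rw [hs]
      beta_reduce
      rw [h2]
      exact h1
    obtain ⟨x, hx⟩ := hseq
    -- The pigeonhole principle for vertex and parity together, so that the closed walk has even
    -- length and alternates also where it closes.
    obtain ⟨i, j, hij, he⟩ := Finite.exists_ne_map_eq_of_infinite
      fun k : ℕ => (x k, decide (k % 2 = 0))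
    wlog hlt : i < j generalizing i j
    · exact this j i hij.symm he.symm (by omega)
    simp only [Prod.mk.injEq, decide_eq_decide] at he
    refine ⟨j - i, by omega, by omega, fun k => x (i + k), i, ?_, fun k _ => hx _⟩
    simp only [add_zero, Nat.add_sub_cancel' hlt.le, he.1]
  obtain ⟨hpos, heven, x, β, hx0, hx⟩ := Nat.find_spec hex
  have hmin := fun m hm => Nat.find_min (H := hex) (m := m) hm
  generalize Nat.find hex = n at hpos heven hx0 hx hmin
  have hpar : ∀ i j, i < j → j < n → x i = x j → (j - i) % 2 = 1 := by
    intro i j hij hj he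
    by_contra hcon
    refine hmin (j - i) (by omega) ⟨by omega, by omega, fun k => x (i + k), β + i, ?_, ?_⟩
    · simp only [add_zero, Nat.add_sub_cancel' hij.le, he]
    · intro k hk
      rw [add_assoc]
      exact hx (i + k) (by omega)
  -- For crossing repetitions walk from `i` to `a`, jump to `b` at the same vertex, and go backwards
  -- to `j`. As `j - i` and `b - a` are odd, this closed walk is even and still alternates at the
  -- jump, but it is shorter.
  have hcross : ∀ i a j b, i < a → a < j → j < b → b < n → x i = x j → x a = x b → False := by
    intro i a j b h1 h2 h3 h4 hij hab
    have p1 := hpar i j (by omega) (by omega) hij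
    have p2 := hpar a b (by omega) (by omega) hab
    refine hmin ((a - i) + (b - j)) (by omega) ⟨by omega, by omega,
      fun t => if t ≤ a - i then x (i + t) else x (b - (t - (a - i))), β + i, ?_, ?_⟩
    · beta_reduce
      rw [if_neg (by omega), if_pos (by omega)]
      rw [show b - (a - i + (b - j) - (a - i)) = j by omega, add_zero, hij]
    · intro t ht
      beta_reduce
      by_cases hta : t < a - i
      · rw [if_pos (by omega), if_pos (by omega)]
        rw [add_assoc]
        exact hx (i + t) (by omega)
      · have hstep := hsymm _ _ _ (hx (b - (t - (a - i)) - 1) (by omega))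
        rw [show b - (t - (a - i)) - 1 + 1 = b - (t - (a - i)) by omega] at hstep
        have : (if t ≤ a - i then x (i + t) else x (b - (t - (a - i)))) =
            x (b - (t - (a - i))) := by
          split_ifs with h
          · rw [show i + t = a by omega, hab]; congr 1; omega
          · rfl
        rw [this, if_neg (by omega), show b - (t + 1 - (a - i)) = b - (t - (a - i)) - 1 by omega]
        exact hE _ _ _ _ (by omega) hstep
  have hloop : ∀ i < n, x i ≠ x (i + 1) := fun i hi => (hadj _ _ _ (hx i hi)).ne
  by_cases hinj : ∀ i j, i < j → j < n → x i ≠ x j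
  · have hn2 : n ≠ 2 := by
      rintro rfl
      have e0 := hx 0 (by omega)
      have e1 := hsymm _ _ _ (hx 1 (by omega))
      rw [show (1 + 1 : ℕ) = 2 by rfl, hx0] at e1
      rcases Nat.mod_two_eq_zero_or_one β with hb | hb
      · exact hdisj _ _ (hE _ 0 _ _ (by omega) e0) (hE _ 1 _ _ (by omega) e1)
      · exact hdisj _ _ (hE _ 0 _ _ (by omega) e1) (hE _ 1 _ _ (by omega) e0)
    have hcyc := IsCyc.of_path (G := G) (p := x) (n := n) (by omega) (by
        intro i j hi hj he
        rcases lt_trichotomy i j with h | h | h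
        · exact absurd he (hinj i j h hj)
        · exact h
        · exact absurd he.symm (hinj j i h hi)) (fun i hi => hadj _ _ _ (hx i (by omega))) (by
        have := hadj _ _ _ (hx (n - 1) (by omega))
        rwa [show n - 1 + 1 = n by omega, hx0] at this)
    have hn4 := hG.even _ _ hcyc (Nat.even_iff.2 heven)
    subst hn4
    have e0 := hx 0 (by omega)
    have e1 := hx 1 (by omega)
    have e2 := hx 2 (by omega)
    have e3 := hx 3 (by omega)
    rw [show (3 + 1 : ℕ) = 4 by rfl, hx0] at e3
    have n02 := hinj 0 2 (by omega) (by omega)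
    have n13 := hinj 1 3 (by omega) (by omega)
    rcases Nat.mod_two_eq_zero_or_one β with hb | hb
    · exact ⟨x 0, x 1, x 2, x 3, n02, n13, hE _ _ _ _ (by omega) e0, hE _ _ _ _ (by omega) e1,
        hE _ _ _ _ (by omega) e2, hE _ _ _ _ (by omega) e3⟩
    · exact ⟨x 1, x 2, x 3, x 0, n13, n02.symm, hE _ _ _ _ (by omega) e1,
        hE _ _ _ _ (by omega) e2, hE _ _ _ _ (by omega) e3, hE _ _ _ _ (by omega) e0⟩
  · exfalso
    push Not at hinj
    -- A repetition at least distance `d` encloses a loop without repetitions. It is an odd cycle,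
    -- because repetitions at even distance contradict minimality.
    have hex' : ∃ d i, 0 < d ∧ i + d < n ∧ x i = x (i + d) := by
      obtain ⟨i, j, h1, h2, h3⟩ := hinj
      exact ⟨j - i, i, by omega, by omega, by rwa [Nat.add_sub_cancel' h1.le]⟩
    obtain ⟨i, hd, hid, he⟩ := Nat.find_spec hex'
    have hdmin := fun m hm => Nat.find_min (H := hex') (m := m) hm
    generalize Nat.find hex' = d at hd hid he hdmin
    have hdodd := hpar i (i + d) (by omega) hid he
    have hd3 : 3 ≤ d := by
      by_contra hlt
      have : d = 1 := by omega
      subst this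
      exact hloop i (by omega) he
    have hC1 := IsCyc.of_path (G := G) (p := fun t => x (i + t)) (n := d) hd3 (by
        intro a b ha hb hab
        by_contra hne
        rcases lt_or_gt_of_ne hne with h | h
        · exact hdmin (b - a) (by omega) ⟨i + a, by omega, by omega, by
            rw [hab]; congr 1; omega⟩
        · exact hdmin (a - b) (by omega) ⟨i + b, by omega, by omega, by
            rw [← hab]; congr 1; omega⟩)
      (fun t ht => hadj _ _ _ (hx (i + t) (by omega))) (by
        have := hadj _ _ _ (hx (i + (d - 1)) (by omega))
        rw [show i + (d - 1) + 1 = i + d by omega, ← he] at this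
        simpa using this)
    -- The vertices of the walk outside the loop. The rest is a closed walk of odd length `n - d`,
    -- so the graph on `S` has an odd cycle.
    let S : Set V := {y | ∃ k, (k ≤ i ∨ i + d ≤ k) ∧ k < n ∧ y = x k}
    have hSmem : ∀ k, (k ≤ i ∨ i + d ≤ k) → k ≤ n → x k ∈ S := by
      intro k hk hkn
      rcases hkn.lt_or_eq with h | rfl
      · exact ⟨k, hk, h, rfl⟩
      · exact ⟨0, Or.inl (Nat.zero_le _), hpos, hx0⟩
    have hnb : ¬ (restrict G S).IsBipartite := by
      rw [isBipartite_iff_bool]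
      rintro ⟨f, hf⟩
      have c1 := color_seq (f := f) (x := x) (k := 0) (l := i) (Nat.zero_le _) fun t _ ht =>
        hf _ _ ⟨hadj _ _ _ (hx t (by omega)), hSmem t (by omega) (by omega),
          hSmem (t + 1) (by omega) (by omega)⟩
      have c2 := color_seq (f := f) (x := x) (k := i + d) (l := n) (by omega) fun t h1 ht =>
        hf _ _ ⟨hadj _ _ _ (hx t (by omega)), hSmem t (by omega) (by omega),
          hSmem (t + 1) (by omega) (by omega)⟩
      rw [hx0, ← he, eq_comm, c1, Nat.even_iff, Nat.even_iff] at c2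
      omega
    obtain ⟨m, c, hc, hm⟩ := exists_odd_isCyc hnb
    obtain ⟨k, l, k', l', h1, h2, h3⟩ := hG.odd _ _ _ _ hC1
      (hc.mono fun t => (hc.adj t).1) (Nat.odd_iff.2 (by omega)) hm
    -- The loop meets the rest of the walk only in `x i`: any other common vertex gives a crossing
    -- repetition or one at distance below `d`. So the two odd cycles share at most one vertex.
    have key : ∀ (k k' : ℤ), x (i + (k % d).toNat) = c k' → x (i + (k % d).toNat) = x i := by
      intro k k' h
      obtain ⟨t, ht, htn, hct⟩ := (hc.adj k').2.1
      have hlt : (k % d).toNat < d := by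
        have := Int.emod_lt_of_pos k (show (0 : ℤ) < d by omega)
        omega
      generalize (k % d).toNat = a at h hlt
      rcases Nat.eq_zero_or_pos a with rfl | ha
      · rfl
      exfalso
      rw [hct] at h
      rcases ht with ht | ht
      · rcases ht.lt_or_eq with ht | rfl
        · exact hcross t i (i + a) (i + d) ht (by omega) (by omega) hid h.symm he
        · exact hdmin a (by omega) ⟨t, ha, by omega, h.symm⟩
      · rcases ht.lt_or_eq with ht | rfl
        · exact hcross i (i + a) (i + d) t (by omega) (by omega) ht htn he h
        · exact hdmin (d - a) (by omega) ⟨i + a, by omega, by omega, by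
            rw [h]; congr 1; omega⟩
    exact h3 ((key k k' h1).trans (key l l' h2).symm)

end Alternating

end ToricGraph

namespace ToricGraph

/-! ### Toric ideals with quadratic fibers of at most two monomials are robust. -/

section QuadraticFibers

open MvPolynomial
open scoped MonomialOrder

universe u w

variable {σ : Type u} {ι : Type*} {K : Type w} [Field K] {A : σ → ι → ℕ} {m : MonomialOrder σ}

/-- Any two monomials of the same multidegree are divisible by different quadratic monomials
of the same multidegree, and quadratic fibers have at most two elements. -/
structure HasQuadraticFibers (A : σ → ι → ℕ) : Prop where
  degree_eq : ∀ u v, wt A u = wt A v → u.degree = v.degree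
  two_le : ∀ u v, wt A u = wt A v → u ≠ v → 2 ≤ u.degree
  exists_le : ∀ u v, wt A u = wt A v → u ≠ v →
    ∃ a b, a ≤ u ∧ b ≤ v ∧ a ≠ b ∧ wt A a = wt A b ∧ a.degree = 2
  eq_or : ∀ a b c, wt A a = wt A b → wt A a = wt A c → a.degree = 2 → a = b ∨ a = c ∨ b = c

namespace HasQuadraticFibers

theorem isNormal_of_degree_lt (hA : HasQuadraticFibers A) {u : σ →₀ ℕ} (hu : u.degree < 2) :
    IsNormal m A u := by
  intro v hv
  by_cases h : u = v
  · rw [h]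
  · have := hA.two_le u v hv.symm h
    omega

/-- Compare `u` with its normal form. The quadratic divisor of the normal form is again normal, so
the different quadratic divisor of `u` with the same multidegree is not. The initial ideal is
therefore generated by quadratic monomials, for every term order. -/
theorem exists_le_not_isNormal (hA : HasQuadraticFibers A) {u : σ →₀ ℕ} (hu : ¬ IsNormal m A u) :
    ∃ a ≤ u, ¬ IsNormal m A a ∧ a.degree = 2 := by
  obtain ⟨v, hv, hn⟩ := exists_isNormal m A u
  obtain ⟨a, b, hau, hbv, hab, hw, hd⟩ := hA.exists_le u v hv (by rintro rfl; exact hu hn)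
  exact ⟨a, hau, fun h => hab (h.eq (hn.of_le hbv) hw), hd⟩

/-- The leading monomial has a quadratic non-normal divisor, which in turn is divisible by a leading
monomial of the basis. Reducedness makes that the same basis element, so its leading monomial is the
quadratic one. -/
theorem degree_of_mem_universalGroebnerBasis (hA : HasQuadraticFibers A) {f : MvPolynomial σ K}
    (hf : f ∈ universalGroebnerBasis (toricIdeal K A)) :
    ∃ u v, wt A u = wt A v ∧ u ≠ v ∧ u.degree = 2 ∧ f = binom K u v := by
  obtain ⟨m, B, hB, hfB⟩ := hf
  obtain ⟨u, v, hw, hlt, rfl⟩ := hB.exists_binom hfB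
  have hne : u ≠ v := by rintro rfl; exact lt_irrefl _ hlt
  refine ⟨u, v, hw, hne, ?_, rfl⟩
  obtain ⟨a, hau, hna, hd⟩ := hA.exists_le_not_isNormal (m := m) (u := u) fun h =>
    absurd (h v hw.symm) (not_le.2 hlt)
  obtain ⟨b, hab, hb⟩ := exists_isNormal m A a
  have hba := hb.lt hab hna
  have hne' : a ≠ b := by rintro rfl; exact lt_irrefl _ hba
  obtain ⟨g, hg, hle⟩ := hB.initial (binom K a b) (binomial_mem hab) (binom_ne_zero hne')
  rw [degree_binom hba] at hle
  by_cases hgf : g = binom K u v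
  · rw [hgf, degree_binom hlt] at hle
    rw [le_antisymm hle hau, hd]
  · exact absurd (hle.trans hau) (hB.reduced _ hfB g hg hgf u
      ((mem_support_binom hne).2 (Or.inl rfl)))

/-- The quadratic binomials, with leading monomial first. -/
def basis (K : Type w) [Field K] (m : MonomialOrder σ) (A : σ → ι → ℕ) : Set (MvPolynomial σ K) :=
  {g | ∃ u v, wt A u = wt A v ∧ v ≺[m] u ∧ u.degree = 2 ∧ g = binom K u v}

/-- In a fiber with two monomials the smaller one is normal. Proper divisors of the larger one have
degree below 2 and are normal too, so the binomial belongs to the explicit reduced Gröbner basis. -/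
theorem basis_subset (hA : HasQuadraticFibers A) (m : MonomialOrder.{u, u} σ) :
    basis K m A ⊆ universalGroebnerBasis (toricIdeal K A) := by
  rintro _ ⟨u, v, hw, hlt, hd, rfl⟩
  refine ⟨m, _, isReducedGroebnerBasis_toric m A, u, v, hw, ?_, fun h =>
    absurd (h v hw.symm) (not_le.2 hlt), fun c hc hcu => hA.isNormal_of_degree_lt ?_, rfl⟩
  · intro x hx
    rcases hA.eq_or u v x hw (hw.trans hx.symm) hd with rfl | rfl | rfl
    · exact absurd hlt (lt_irrefl _)
    · exact hlt.le
    · exact le_rfl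
  · rw [← hd]
    have h1 := add_tsub_cancel_of_le hc
    rw [← h1, map_add]
    have : u - c ≠ 0 := fun h0 => hcu (by rw [← h1, h0, add_zero])
    have : (u - c).degree ≠ 0 := by rwa [Ne, Finsupp.degree_eq_zero_iff]
    omega

/-- Induction on the degree: with quadratic divisors `a ≤ u` and `b ≤ v` of the same multidegree,
the binomial of `u, v` is a multiple of that of `a, b` plus a multiple of that of `u - a, v - b`. -/
theorem span_basis (hA : HasQuadraticFibers A) (m : MonomialOrder σ) :
    Ideal.span (basis K m A) = toricIdeal K A := by
  refine le_antisymm (Ideal.span_le.2 ?_) (Ideal.span_le.2 ?_)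
  · rintro _ ⟨u, v, hw, -, -, rfl⟩
    exact binomial_mem hw
  rintro _ ⟨u, v, hw, rfl⟩
  suffices h : ∀ n (u v : σ →₀ ℕ), u.degree = n → wt A u = wt A v →
      binom K u v ∈ Ideal.span (basis K m A) from h _ u v rfl hw
  clear hw u v
  intro n
  induction n using Nat.strong_induction_on with
  | _ n ih =>
    rintro u v rfl hw
    by_cases huv : u = v
    · subst huv; simp [binom]
    obtain ⟨a, b, hau, hbv, hab, hwab, hd⟩ := hA.exists_le u v hw huv
    have hmem : binom K a b ∈ Ideal.span (basis K m A) := by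
      rcases lt_trichotomy (m.toSyn a) (m.toSyn b) with h | h | h
      · rw [show binom K a b = - binom K b a by simp [binom]]
        exact neg_mem (Ideal.subset_span ⟨b, a, hwab.symm, h, (hA.degree_eq _ _ hwab) ▸ hd, rfl⟩)
      · exact absurd (m.toSyn.injective h) hab
      · exact Ideal.subset_span ⟨a, b, hwab, h, hd, rfl⟩
    have h1 := add_tsub_cancel_of_le hau
    have h2 := add_tsub_cancel_of_le hbv
    have hw' : wt A (u - a) = wt A (v - b) := by
      have : wt A a + wt A (u - a) = wt A b + wt A (v - b) := by
        rw [← map_add, ← map_add, h1, h2, show Finsupp.linearCombination ℕ A u = _ from hw]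
      rw [hwab] at this
      exact add_left_cancel this
    have hlt : (u - a).degree < u.degree := by
      conv_rhs => rw [← h1, map_add, hd]
      omega
    have hmem' := ih _ hlt (u - a) (v - b) rfl hw'
    have : binom K u v = monomial (u - a) 1 * binom K a b +
        monomial b 1 * binom K (u - a) (v - b) := by
      simp only [binom, mul_sub, monomial_mul, one_mul]
      rw [add_comm (u - a) a, h1, h2, add_comm b (u - a)]
      ring
    rw [this]
    exact add_mem (Ideal.mul_mem_left _ _ hmem) (Ideal.mul_mem_left _ _ hmem')

theorem isGeneratedByQuadrics (hA : HasQuadraticFibers A) [Finite σ] :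
    IsGeneratedByQuadrics (toricIdeal K A) := by
  obtain ⟨m, -⟩ := exists_elimination_order (∅ : Set σ)
  refine ⟨basis K m A, ?_, hA.span_basis m⟩
  rintro _ ⟨u, v, hw, -, hd, rfl⟩
  exact isHomogeneous_binom hd (hA.degree_eq _ _ hw ▸ hd)

/-- A quadratic binomial is determined by one of its monomials, up to the order. -/
theorem pair_eq (hA : HasQuadraticFibers A) {u v a b : σ →₀ ℕ} (hw : wt A u = wt A v)
    (hlt : v ≺[m] u) (hd : u.degree = 2) (hw' : wt A a = wt A b) (hlt' : b ≺[m] a)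
    (h : u = a ∨ u = b) : u = a ∧ v = b := by
  rcases h with rfl | rfl
  · rcases hA.eq_or u v b hw hw' hd with rfl | rfl | rfl
    · exact absurd hlt (lt_irrefl _)
    · exact absurd hlt' (lt_irrefl _)
    · exact ⟨rfl, rfl⟩
  · rcases hA.eq_or u v a hw hw'.symm hd with rfl | rfl | rfl
    · exact absurd hlt (lt_irrefl _)
    · exact absurd hlt' (lt_irrefl _)
    · exact absurd (hlt.trans hlt') (lt_irrefl _)

/-- The quadratic binomials for one term order represent the universal Gröbner basis up to units.
Each is indispensable, because no other one contains a divisor of its leading monomial. -/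
theorem isRobust (hA : HasQuadraticFibers A) [Finite σ] : IsRobust (toricIdeal K A) := by
  obtain ⟨m, -⟩ := exists_elimination_order (∅ : Set σ)
  have hne : ∀ {u v : σ →₀ ℕ}, v ≺[m] u → u ≠ v := by
    rintro u v h rfl
    exact lt_irrefl _ h
  have hassoc : ∀ g ∈ basis K m A, ∀ g' ∈ basis K m A, Associated g g' → g = g' := by
    rintro _ ⟨u, v, hw, hlt, hd, rfl⟩ _ ⟨a, b, hw', hlt', hd', rfl⟩ hass
    by_cases h : u = a ∨ u = b
    · obtain ⟨rfl, rfl⟩ := hA.pair_eq hw hlt hd hw' hlt' h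
      rfl
    · push Not at h
      exact absurd hass (not_associated_binom (hne hlt) ⟨u, h.1, h.2, Or.inl rfl⟩)
  refine ⟨basis K m A, hA.basis_subset m, fun f hf => ?_, hA.span_basis m, fun T hT hTS => ?_⟩
  · obtain ⟨u, v, hw, huv, hd, rfl⟩ := hA.degree_of_mem_universalGroebnerBasis hf
    have : ∃ g ∈ basis K m A, Associated g (binom K u v) := by
      rcases lt_trichotomy (m.toSyn u) (m.toSyn v) with h | h | h
      · refine ⟨binom K v u, ⟨v, u, hw.symm, h, hA.degree_eq _ _ hw ▸ hd, rfl⟩, ?_⟩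
        rw [show binom K v u = - binom K u v by simp [binom]]
        exact Associated.neg_left (Associated.refl _)
      · exact absurd (m.toSyn.injective h) huv
      · exact ⟨binom K u v, ⟨u, v, hw, h, hd, rfl⟩, Associated.refl _⟩
    obtain ⟨g, hg, hgf⟩ := this
    exact ⟨g, ⟨hg, hgf⟩, fun g' hg' => hassoc _ hg'.1 _ hg (hg'.2.trans hgf.symm)⟩
  · rintro _ ⟨u, v, hw, hlt, hd, rfl⟩
    by_contra hcon
    -- All binomials of `T` have coefficient 0 at the divisors of `u`, and this property passes to
    -- the ideal they span. The omitted binomial has coefficient 1 at `u`.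
    have hzero : ∀ f ∈ Ideal.span T, ∀ c ≤ u, coeff c f = 0 := by
      intro f hf
      induction hf using Submodule.span_induction with
      | mem f hf =>
        intro c hc
        obtain ⟨a, b, hw', hlt', hd', rfl⟩ := hTS hf
        have hdb : b.degree = 2 := hA.degree_eq _ _ hw' ▸ hd'
        have key : ∀ x : σ →₀ ℕ, x.degree = 2 → x ≤ u → x = u := by
          intro x hx hxu
          have h1 := add_tsub_cancel_of_le hxu
          have h2 := congrArg Finsupp.degree h1
          rw [map_add, hx, hd] at h2
          have h3 : (u - x).degree = 0 := by omega
          rw [Finsupp.degree_eq_zero_iff] at h3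
          rw [← h1, h3, add_zero]
        refine coeff_binom_of_ne ?_ ?_ <;> rintro rfl
        · obtain ⟨rfl, rfl⟩ := hA.pair_eq hw hlt hd hw' hlt' (Or.inl (key _ hd' hc).symm)
          exact hcon hf
        · obtain ⟨rfl, rfl⟩ := hA.pair_eq hw hlt hd hw' hlt' (Or.inr (key _ hdb hc).symm)
          exact hcon hf
      | zero => simp
      | add f g _ _ hf hg => intro c hc; rw [coeff_add, hf c hc, hg c hc, add_zero]
      | smul p f _ hf =>
        intro c hc
        classical
        rw [smul_eq_mul, coeff_mul]
        refine Finset.sum_eq_zero fun x hx => ?_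
        rw [Finset.HasAntidiagonal.mem_antidiagonal] at hx
        rw [hf x.2 (le_trans (by rw [← hx]; exact le_add_self) hc), mul_zero]
    have h1 := hzero (binom K u v) (by
      have h2 : Ideal.span T = toricIdeal K A := hT
      rw [h2]; exact binomial_mem hw) u le_rfl
    rw [coeff_binom_left (hne hlt)] at h1
    exact one_ne_zero h1

end HasQuadraticFibers

end QuadraticFibers

/-! ### Square circuits imply quadratic fibers for graphs. -/

section GraphFibers

universe u w

variable {V : Type u} {G : SimpleGraph V}

theorem exists_of_wt_ne_zero {u : G.edgeSet →₀ ℕ} {x : V} (h : wt (edgeVector G) u x ≠ 0) :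
    ∃ y, ∃ h : G.Adj x y, u ⟨s(x, y), h⟩ ≠ 0 := by
  classical
  rw [wt, Finsupp.linearCombination_apply, Finsupp.sum, Finset.sum_apply] at h
  obtain ⟨⟨e, he⟩, hu, hx⟩ := Finset.exists_ne_zero_of_sum_ne_zero h
  have hxe : x ∈ e := by
    by_contra hcon
    exact hx (by simp [edgeVector, hcon])
  obtain ⟨y, rfl⟩ := hxe
  exact ⟨y, he, Finsupp.mem_support_iff.1 hu⟩

theorem wt_ne_zero {u : G.edgeSet →₀ ℕ} {x y : V} (h : G.Adj x y) (hu : u ⟨s(x, y), h⟩ ≠ 0) :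
    wt (edgeVector G) u y ≠ 0 := by
  classical
  rw [wt, Finsupp.linearCombination_apply, Finsupp.sum, Finset.sum_apply]
  intro h0
  rw [Finset.sum_eq_zero_iff] at h0
  have := h0 _ (Finsupp.mem_support_iff.2 hu)
  simp [edgeVector] at this
  exact hu this

theorem pairMon_le {u : G.edgeSet →₀ ℕ} {x y z t : V} (h : G.Adj x y) (h' : G.Adj z t)
    (hne : s(x, y) ≠ s(z, t)) (hu : u ⟨s(x, y), h⟩ ≠ 0) (hu' : u ⟨s(z, t), h'⟩ ≠ 0) :
    pairMon h h' ≤ u := by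
  classical
  intro e
  have := edge_ne h h' hne
  simp only [pairMon, Finsupp.add_apply, Finsupp.single_apply]
  split_ifs with h1 h2 h2
  · exact absurd (h1.trans h2.symm) this
  · subst h1; omega
  · subst h2; omega
  · omega

/-- Once the common part is cancelled, `u - v` and `v - u` still have the same multidegree, so their
edges cover the same vertices. An alternating 4-cycle has one matching below `u` and the other below
`v`. -/
theorem HasSquareCircuits.exists_le [Finite V] (hG : HasSquareCircuits G) {u v : G.edgeSet →₀ ℕ}
    (hw : wt (edgeVector G) u = wt (edgeVector G) v) (huv : u ≠ v) :
    ∃ a b, a ≤ u ∧ b ≤ v ∧ a ≠ b ∧ wt (edgeVector G) a = wt (edgeVector G) b ∧ a.degree = 2 := by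
  have hu : u - v + u ⊓ v = u := by ext e; simp
  have hv : v - u + u ⊓ v = v := by ext e; simp; omega
  have hw' : wt (edgeVector G) (u - v) = wt (edgeVector G) (v - u) := by
    have h1 : wt (edgeVector G) (u - v + u ⊓ v) = wt (edgeVector G) (v - u + u ⊓ v) := by
      rw [hu, hv, hw]
    rw [wt, wt, map_add, map_add] at h1
    exact add_right_cancel h1
  let U : ℕ → G.edgeSet →₀ ℕ := fun k => if k % 2 = 0 then u - v else v - u
  have hU : ∀ k, wt (edgeVector G) (U k) = wt (edgeVector G) (u - v) := by
    intro k
    simp only [U]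
    split_ifs
    · rfl
    · exact hw'.symm
  let E : ℕ → V → V → Prop := fun k x y => ∃ h : G.Adj x y, U k ⟨s(x, y), h⟩ ≠ 0
  have h0 : ∀ {x y}, E 0 x y → ∃ h : G.Adj x y, v ⟨s(x, y), h⟩ < u ⟨s(x, y), h⟩ := by
    rintro x y ⟨h, hne⟩
    refine ⟨h, ?_⟩
    simp only [U, Nat.zero_mod, if_true, Finsupp.tsub_apply] at hne
    omega
  have h1 : ∀ {x y}, E 1 x y → ∃ h : G.Adj x y, u ⟨s(x, y), h⟩ < v ⟨s(x, y), h⟩ := by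
    rintro x y ⟨h, hne⟩
    refine ⟨h, ?_⟩
    simp only [U, Nat.one_mod, one_ne_zero, if_false, Finsupp.tsub_apply] at hne
    omega
  obtain ⟨a, b, c, d, hac, hbd, e1, e2, e3, e4⟩ := exists_alternating_square hG (E := E) (by
      rintro k l x y hkl ⟨h, hne⟩
      refine ⟨h, ?_⟩
      simp only [U] at hne ⊢
      rwa [← hkl]) (by
      rintro k x y ⟨h, hne⟩
      refine ⟨h.symm, ?_⟩
      convert hne using 3
      exact Subtype.ext Sym2.eq_swap) (fun k x y h => h.1) (by
      intro x y h h'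
      obtain ⟨_, h2⟩ := h0 h
      obtain ⟨_, h3⟩ := h1 h'
      omega) (by
      rintro k x y ⟨h, hne⟩
      have h2 := wt_ne_zero h hne
      rw [hU, ← hU (k + 1)] at h2
      exact exists_of_wt_ne_zero h2) (by
      have : u - v ≠ 0 := by
        intro h2
        rw [h2, wt, map_zero] at hw'
        have hvu : v - u = 0 := by
          ext ⟨e, he⟩
          induction e using Sym2.ind with
          | h x y =>
            by_contra hcon
            exact wt_ne_zero he hcon (congrFun hw'.symm y)
        rw [h2] at hu
        rw [hvu] at hv
        exact huv (hu.symm.trans hv)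
      obtain ⟨⟨e, he⟩, h2⟩ := Finsupp.ne_iff.1 this
      induction e using Sym2.ind with
      | h x y => exact ⟨x, y, he, h2⟩)
  obtain ⟨h1', e1⟩ := h0 e1
  obtain ⟨h2', e2⟩ := h1 e2
  obtain ⟨h3', e3⟩ := h0 e3
  obtain ⟨h4', e4⟩ := h1 e4
  have n1 := h1'.ne
  have n2 := h2'.ne
  have n3 := h3'.ne
  have n4 := h4'.ne
  refine ⟨pairMon h1' h3'.symm, pairMon h4'.symm h2', pairMon_le _ _ ?_ (by omega) ?_,
    pairMon_le _ _ ?_ ?_ (by omega), ?_, ?_, degree_pairMon _ _⟩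
  · simp [hac, n4.symm]
  · have : (⟨s(d, c), h3'.symm⟩ : G.edgeSet) = ⟨s(c, d), h3'⟩ := Subtype.ext Sym2.eq_swap
    rw [this]; omega
  · simp [hac, n1]
  · have : (⟨s(a, d), h4'.symm⟩ : G.edgeSet) = ⟨s(d, a), h4'⟩ := Subtype.ext Sym2.eq_swap
    rw [this]; omega
  · exact pairMon_ne _ _ _ _ hac hbd
  · exact wt_pairMon_eq _ _ _ _ hac hbd

theorem HasSquareCircuits.hasQuadraticFibers [Finite V] (hG : HasSquareCircuits G) :
    HasQuadraticFibers (edgeVector G) where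
  degree_eq _ _ h := degree_eq_of_wt_eq h
  two_le _ _ h h' := two_le_degree h h'
  exists_le _ _ h h' := hG.exists_le h h'
  eq_or := by
    classical
    intro a b c hab hac hd
    by_contra! hcon
    obtain ⟨n1, n2, n3⟩ := hcon
    obtain ⟨e, e', rfl⟩ := degree_eq_two hd
    obtain ⟨f, f', rfl⟩ := degree_eq_two (degree_eq_of_wt_eq hab ▸ hd)
    obtain ⟨g, g', rfl⟩ := degree_eq_two (degree_eq_of_wt_eq hac ▸ hd)
    obtain ⟨p, q, r, s, hps, hqr, he, he', hf⟩ := exists_square hab n1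
    obtain ⟨p', q', r', s', hps', hqr', h1, h1', hg⟩ := exists_square hac n2
    obtain ⟨e, heG⟩ := e
    obtain ⟨e', heG'⟩ := e'
    obtain ⟨f, hfG⟩ := f
    obtain ⟨f', hfG'⟩ := f'
    obtain ⟨g, hgG⟩ := g
    obtain ⟨g', hgG'⟩ := g'
    simp only at he he' h1 h1' hf hg
    have hfs : s(p, r) ∈ G.edgeSet ∧ s(q, s) ∈ G.edgeSet ∧
        (s(f, f') : Sym2 (Sym2 V)) = s(s(p, r), s(q, s)) := by
      rcases hf with ⟨rfl, rfl⟩ | ⟨rfl, rfl⟩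
      · exact ⟨hfG, hfG', rfl⟩
      · exact ⟨hfG', hfG, Sym2.eq_swap⟩
    have hgs : s(p', r') ∈ G.edgeSet ∧ s(q', s') ∈ G.edgeSet ∧
        (s(g, g') : Sym2 (Sym2 V)) = s(s(p', r'), s(q', s')) := by
      rcases hg with ⟨rfl, rfl⟩ | ⟨rfl, rfl⟩
      · exact ⟨hgG, hgG', rfl⟩
      · exact ⟨hgG', hgG, Sym2.eq_swap⟩
    have hfg : (s(f, f') : Sym2 (Sym2 V)) ≠ s(g, g') := by
      intro h
      rcases Sym2.eq_iff.1 h with ⟨rfl, rfl⟩ | ⟨rfl, rfl⟩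
      · exact n3 rfl
      · exact n3 (add_comm _ _)
    have hpq : G.Adj p q := by rw [he] at heG; exact heG
    have hrs : G.Adj r s := by rw [he'] at heG'; exact heG'
    rw [hfs.2.2, hgs.2.2] at hfg
    rw [he] at h1
    rw [he'] at h1'
    -- Both 4-cycles contain the edges `pq` and `rs`. The other two matchings differ, so together
    -- they supply all the remaining edges between `{p, q}` and `{r, s}`, and a `K₄` appears.
    have key : G.Adj p s ∧ G.Adj q r := by
      rcases Sym2.eq_iff.1 h1 with ⟨rfl, rfl⟩ | ⟨rfl, rfl⟩ <;>
        rcases Sym2.eq_iff.1 h1' with ⟨rfl, rfl⟩ | ⟨rfl, rfl⟩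
      · exact absurd rfl hfg
      · exact ⟨hgs.1, hgs.2.1⟩
      · exact ⟨hgs.2.1, hgs.1⟩
      · exact absurd Sym2.eq_swap hfg
    exact hG.not_K4 p q r s hpq hfs.1 key.1 key.2 hfs.2.1 hrs

end GraphFibers

end ToricGraph

namespace ToricGraph

/-! ### The three families of blocks: cycles in graphs glued along two vertices. -/

section Glue

variable {V W : Type*}

/-- Every cycle has length 4, or is odd and passes through two fixed vertices. -/
def HasPoles (H : SimpleGraph W) : Prop :=
  ∃ v w : W, v ≠ w ∧ ∀ n c, IsCyc H n c → n = 4 ∨ Odd n ∧ (∃ i, c i = v) ∧ ∃ j, c j = w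

theorem HasPoles.of_iso {H : SimpleGraph W} {H' : SimpleGraph V} (h : HasPoles H) (e : H' ≃g H) :
    HasPoles H' := by
  obtain ⟨v, w, hvw, h⟩ := h
  refine ⟨e.symm v, e.symm w, fun he => hvw (e.symm.injective he), fun n c hc => ?_⟩
  rcases h n (fun i => e (c i)) (hc.map (fun i => e.map_rel_iff.2 (hc.adj i))
    fun i j hij => e.injective hij) with h | ⟨h1, ⟨i, rfl⟩, ⟨j, rfl⟩⟩
  · exact Or.inl h
  · exact Or.inr ⟨h1, ⟨i, by simp⟩, ⟨j, by simp⟩⟩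

/-- Two graphs whose cycles have length 4, glued along two vertices of different relative
colors. -/
theorem hasPoles_of_glue {B H₁ H₂ : SimpleGraph W} {v w : W} {f₁ f₂ : W → Bool}
    (hB : ∀ x y, B.Adj x y → H₁.Adj x y ∨ H₂.Adj x y)
    (hmeet : ∀ x y z, H₁.Adj x y → H₂.Adj x z → x = v ∨ x = w)
    (hf₁ : ∀ x y, H₁.Adj x y → f₁ x ≠ f₁ y) (hf₂ : ∀ x y, H₂.Adj x y → f₂ x ≠ f₂ y)
    (hpar : f₁ v = f₁ w ↔ f₂ v ≠ f₂ w) (h₁ : ∀ n c, IsCyc H₁ n c → n = 4)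
    (h₂ : ∀ n c, IsCyc H₂ n c → n = 4) : HasPoles B := by
  classical
  refine ⟨v, w, by rintro rfl; simp at hpar, fun n c hc => ?_⟩
  have h3 := hc.three_le
  by_cases hall₁ : ∀ i, H₁.Adj (c i) (c (i + 1))
  · exact Or.inl (h₁ n c (hc.mono hall₁))
  by_cases hall₂ : ∀ i, ¬ H₁.Adj (c i) (c (i + 1))
  · exact Or.inl (h₂ n c (hc.mono fun i => (hB _ _ (hc.adj i)).resolve_left (hall₂ i)))
  push Not at hall₁ hall₂
  obtain ⟨j, hj⟩ := hall₁
  obtain ⟨i, hi⟩ := hall₂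
  -- A cycle that uses edges of `H₁` and edges outside it. It is rotated to start with an edge
  -- outside `H₁`.
  suffices hsuff : ∀ c : ℤ → W, IsCyc B n c → ¬ H₁.Adj (c 0) (c 1) →
      (∃ i : ℤ, H₁.Adj (c i) (c (i + 1))) → Odd n ∧ (∃ i, c i = v) ∧ ∃ j, c j = w by
    obtain ⟨h1, ⟨k, hk⟩, ⟨l, hl⟩⟩ := hsuff _ (hc.shift j) (by simpa using hj)
      ⟨i - j, by
        rw [show j + (i - j) = i by ring, show j + (i - j + 1) = i + 1 by ring]
        exact hi⟩
    exact Or.inr ⟨h1, ⟨_, hk⟩, ⟨_, hl⟩⟩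
  clear hj hi hc c
  intro c hc hzero ⟨i, hi⟩
  have hper : ∀ k : ℤ, c (k + n) = c k := hc.add_period
  let P : ℕ → Prop := fun k => H₁.Adj (c k) (c (k + 1))
  have hP2 : ∀ k, ¬ P k → H₂.Adj (c k) (c (k + 1)) := fun k hk =>
    (hB _ _ (hc.adj k)).resolve_left hk
  have hPn : ∀ k, P (k + n) ↔ P k := by
    intro k
    simp only [P]
    push_cast
    rw [hper, show (k : ℤ) + n + 1 = k + 1 + n by ring, hper]
  have hsw : ∀ k, ¬ (P k ↔ P (k + 1)) → c (k + 1) = v ∨ c (k + 1) = w := by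
    intro k hk
    by_cases h : P k
    · have h' : ¬ P (k + 1) := fun h' => hk ⟨fun _ => h', fun _ => h⟩
      have := hP2 _ h'
      push_cast at this
      exact hmeet _ _ _ h.symm this
    · have h' : P (k + 1) := by by_contra h'; exact hk ⟨fun h2 => absurd h2 h, fun h2 => absurd h2 h'⟩
      simp only [P] at h'
      push_cast at h'
      exact hmeet _ _ _ h' (hP2 _ h).symm
  have hP0 : ¬ P 0 := by simpa [P] using hzero
  have hex : ∃ a, P a := by
    obtain ⟨a, -, ha⟩ := hc.exists_index 0 i
    refine ⟨a, ?_⟩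
    obtain ⟨t, ht⟩ := (hc.eq_iff _ _).1 ha
    have : c (i + 1) = c (a + 1) := (hc.eq_iff _ _).2 ⟨t, by linarith⟩
    simp only [P]
    rw [zero_add] at ha
    rwa [← ha, ← this]
  -- The edges from index `a` up to index `b` form the first stretch in `H₁`. At both of its ends
  -- the cycle changes parts, which can happen only at `v` or `w`.
  obtain ⟨a, ha, hamin⟩ : ∃ a, P a ∧ ∀ k < a, ¬ P k :=
    ⟨Nat.find hex, Nat.find_spec hex, fun k hk => Nat.find_min hex hk⟩
  have ha0 : a ≠ 0 := by rintro rfl; exact hP0 ha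
  have han : a < n := by
    by_contra hcon
    refine hamin (a - n) (by omega) ?_
    rw [← hPn, Nat.sub_add_cancel (by omega)]
    exact ha
  have hex' : ∃ b, a < b ∧ ¬ P b := ⟨n, han, by rw [← Nat.zero_add n, hPn]; exact hP0⟩
  obtain ⟨b, hab, hb, hbmin⟩ : ∃ b, a < b ∧ ¬ P b ∧ ∀ k, a < k → k < b → P k := by
    refine ⟨Nat.find hex', (Nat.find_spec hex').1, (Nat.find_spec hex').2, fun k h1 h2 => ?_⟩
    have := Nat.find_min hex' h2
    by_contra h3
    exact this ⟨h1, h3⟩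
  have hbn : b ≤ n := by
    by_contra hcon
    exact hP0 ((hPn 0).1 (by rw [Nat.zero_add]; exact hbmin n han (by omega)))
  have hca : c a = v ∨ c a = w := by
    have := hsw (a - 1) (by
      rw [show a - 1 + 1 = a by omega]
      exact fun h => hamin (a - 1) (by omega) (h.2 ha))
    rwa [show ((a - 1 : ℕ) : ℤ) + 1 = a by omega] at this
  have hPb : P (b - 1) := by
    rcases (show a < b - 1 ∨ a = b - 1 by omega) with h | h
    · exact hbmin _ h (by omega)
    · exact h ▸ ha
  have hcb : c b = v ∨ c b = w := by
    have := hsw (b - 1) (by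
      rw [show b - 1 + 1 = b by omega]
      exact fun h => hb (h.1 hPb))
    rwa [show ((b - 1 : ℕ) : ℤ) + 1 = b by omega] at this
  have hne : c a ≠ c b := hc.ne (by omega) (by omega)
  -- A further change of parts before the cycle closes would need a third vertex among `v` and `w`.
  -- So the rest of the cycle is a single stretch in `H₂`.
  have hrest : ∀ k, b ≤ k → k < n + a → ¬ P k := by
    intro k hbk
    induction k, hbk using Nat.le_induction with
    | base => exact fun _ => hb
    | succ k hbk ih =>
      intro hk hPk
      have h1 := hsw k (fun h => ih (by omega) (h.2 hPk))
      have h2 : c b ≠ c (k + 1) := hc.ne (by omega) (by omega)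
      have h3 : c (k + 1) ≠ c (a + n) := hc.ne (by omega) (by omega)
      rw [hper] at h3
      rcases hca with h4 | h4 <;> rcases hcb with h5 | h5 <;> rcases h1 with h6 | h6 <;>
        simp_all
  have e1 := color_seq (f := f₁) (x := fun k => c k) hab.le (fun k h1 h2 => by
    push_cast
    rcases h1.lt_or_eq with h | rfl
    · exact hf₁ _ _ (hbmin k h h2)
    · exact hf₁ _ _ ha)
  have e2 := color_seq (f := f₂) (x := fun k => c k) (k := b) (l := n + a) (by omega)
    (fun k h1 h2 => by
      push_cast
      exact hf₂ _ _ (hP2 _ (hrest k h1 h2)))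
  beta_reduce at e1 e2
  push_cast at e2
  rw [add_comm (n : ℤ) a, hper] at e2
  -- The two stretches have the same ends `v` and `w`. By `hpar` the colorings give their lengths
  -- different parity.
  have hodd : Odd n := by
    have : Even (b - a) ↔ ¬ Even (n + a - b) := by
      rw [← e1, ← e2]
      rcases hca with h4 | h4 <;> rcases hcb with h5 | h5
      · exact absurd (h4.trans h5.symm) hne
      · rw [h4, h5, eq_comm]; exact hpar
      · rw [h4, h5, eq_comm (a := f₂ w)]; exact hpar
      · exact absurd (h4.trans h5.symm) hne
    rw [Nat.even_iff, Nat.even_iff] at this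
    rw [Nat.odd_iff]
    omega
  rcases hca with h4 | h4 <;> rcases hcb with h5 | h5
  · exact absurd (h4.trans h5.symm) hne
  · exact ⟨hodd, ⟨_, h4⟩, ⟨_, h5⟩⟩
  · exact ⟨hodd, ⟨_, h5⟩, ⟨_, h4⟩⟩
  · exact absurd (h4.trans h5.symm) hne

theorem color_K2 {l : ℕ} (x y : Fin 2 ⊕ Fin l) (h : (K2 l).Adj x y) : x.isLeft ≠ y.isLeft := by
  rcases x with x | x <;> rcases y with y | y <;> simp_all [completeBipartiteGraph]

theorem isLeft_eq_of_not_adj {l : ℕ} {x y : Fin 2 ⊕ Fin l} (h : ¬ (K2 l).Adj x y) :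
    x.isLeft = y.isLeft := by
  rcases x with x | x <;> rcases y with y | y <;> simp_all [completeBipartiteGraph]

/-- The cycle alternates between the sides, and one side has only two vertices. Hence `c 0` and `c
4` agree if `c 0` is on that side, and `n` divides 4. -/
theorem IsCyc.length_of_K2 {l n : ℕ} {c : ℤ → Fin 2 ⊕ Fin l} (h : IsCyc (K2 l) n c) : n = 4 := by
  wlog h0 : (c 0).isLeft generalizing c
  · refine this (h.shift 1) ?_
    have := color_K2 _ _ (h.adj 0)
    rw [zero_add] at this
    show (c (1 + 0)).isLeft = true
    rw [add_zero]
    revert h0 this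
    cases (c 0).isLeft <;> cases (c 1).isLeft <;> simp
  have h3 := h.three_le
  have h2 : (c 2).isLeft := by
    have := (h.color_eq_iff (f := Sum.isLeft) color_K2 0 2).2 (by decide)
    rw [show (0 : ℤ) + (2 : ℕ) = 2 by rfl] at this
    rw [this, h0]
  have h4 : (c 4).isLeft := by
    have := (h.color_eq_iff (f := Sum.isLeft) color_K2 0 4).2 (by decide)
    rw [show (0 : ℤ) + (4 : ℕ) = 4 by rfl] at this
    rw [this, h0]
  have n02 : c 0 ≠ c 2 := h.ne (by omega) (by omega)
  have n24 : c 2 ≠ c 4 := h.ne (by omega) (by omega)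
  obtain ⟨x, hx⟩ := Sum.isLeft_iff.1 h0
  obtain ⟨y, hy⟩ := Sum.isLeft_iff.1 h2
  obtain ⟨z, hz⟩ := Sum.isLeft_iff.1 h4
  have hxz : x = z := by
    rw [hx, hy, Ne, Sum.inl.injEq] at n02
    rw [hy, hz, Ne, Sum.inl.injEq] at n24
    omega
  have h04 : c 4 = c 0 := by rw [hx, hz, hxz]
  rw [h.eq_iff, sub_zero] at h04
  have h5 : n ∣ 4 := by exact_mod_cast h04
  have h6 := Nat.le_of_dvd (by omega) h5
  interval_cases n
  · omega
  · rfl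

theorem IsCyc.length_of_isK2 {H : SimpleGraph V} (hH : IsK2 H) {n : ℕ} {c : ℤ → V}
    (h : IsCyc H n c) : n = 4 := by
  obtain ⟨l, -, ⟨e⟩⟩ := hH
  exact (h.map (f := e) (fun i => e.map_rel_iff.2 (h.adj i)) fun i j hij =>
    e.injective hij).length_of_K2

theorem not_isCyc_of_le_pair {H : SimpleGraph V} {a b : V}
    (hH : ∀ x y, H.Adj x y → x = a ∨ x = b) {n : ℕ} {c : ℤ → V} : ¬ IsCyc H n c := by
  intro h
  have h3 := h.three_le
  have n1 : c 0 ≠ c 1 := h.ne (by omega) (by omega)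
  have n2 : c 0 ≠ c 2 := h.ne (by omega) (by omega)
  have n3 : c 1 ≠ c 2 := h.ne (by omega) (by omega)
  rcases hH _ _ (h.adj 0) with h4 | h4 <;> rcases hH _ _ (h.adj 1) with h5 | h5 <;>
    rcases hH _ _ (h.adj 2) with h6 | h6 <;> simp_all

theorem IsCyc.exists_of_map {H : SimpleGraph V} {f : V ↪ W} {n : ℕ} {c : ℤ → W}
    (h : IsCyc (H.map f) n c) : ∃ c', IsCyc H n c' := by
  have : ∀ i, ∃ x, f x = c i := by
    intro i
    obtain ⟨x, y, -, hx, -⟩ := (SimpleGraph.map_adj _ _ _ _).1 (h.adj i)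
    exact ⟨x, hx⟩
  choose c' hc' using this
  refine ⟨c', h.three_le, fun i => ?_, fun i j => ?_⟩
  · have := h.adj i
    rw [← hc' i, ← hc' (i + 1)] at this
    simpa using this
  · rw [← f.injective.eq_iff, hc', hc', h.eq_iff]

/-- The ends of the new edge lie on the same side of the `K_{2,ℓ}`, but the edge as a graph of its
own gives them different colors. -/
theorem IsK2PlusEdge.hasPoles {B : SimpleGraph W} (h : IsK2PlusEdge B) : HasPoles B := by
  obtain ⟨l, -, a, b, hab, hnadj, ⟨e⟩⟩ := h
  refine HasPoles.of_iso ?_ e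
  have hedge : ∀ x y, (SimpleGraph.edge a b).Adj x y → (x = a ∧ y = b) ∨ (x = b ∧ y = a) := by
    intro x y hxy
    rw [SimpleGraph.edge_adj] at hxy
    tauto
  refine hasPoles_of_glue (H₁ := K2 l) (H₂ := SimpleGraph.edge a b) (v := a) (w := b)
    (f₁ := Sum.isLeft) (f₂ := fun x => decide (x = a)) (fun x y h => h) ?_ color_K2 ?_ ?_
    (fun n c hc => hc.length_of_K2) ?_
  · intro x y z _ h
    rcases hedge _ _ h with h | h
    · exact Or.inl h.1
    · exact Or.inr h.1
  · intro x y h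
    rcases hedge _ _ h with ⟨rfl, rfl⟩ | ⟨rfl, rfl⟩ <;> simp [hab.symm]
  · simp [isLeft_eq_of_not_adj hnadj, hab.symm]
  · intro n c hc
    exact absurd hc (not_isCyc_of_le_pair (a := a) (b := b) fun x y h => by
      rcases hedge _ _ h with h | h
      · exact Or.inl h.1
      · exact Or.inr h.1)

/-- The identified edge is counted as an edge of the second `K_{2,s}`. Its ends have different
colors there, and the same color in the first part, which is then the plain `K_{2,r}`. -/
theorem IsDoubleK2.hasPoles {B : SimpleGraph W} (h : IsDoubleK2 B) : HasPoles B := by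
  classical
  obtain ⟨r, s, -, -, a, b, c, d, hab, hnadj, -, hcd, f₁, f₂, hac, hbd, -, hmeet, rfl⟩ := h
  have hcol : ∀ {l : ℕ} (f : Fin 2 ⊕ Fin l ↪ W) (x : Fin 2 ⊕ Fin l),
      decide (∃ y, f y = f x ∧ y.isLeft) = x.isLeft := by
    intro l f x
    rw [Bool.eq_iff_iff, decide_eq_true_eq]
    constructor
    · rintro ⟨y, hy, h⟩
      rwa [← f.injective hy]
    · exact fun h => ⟨x, rfl, h⟩
  have hproper : ∀ {l : ℕ} (f : Fin 2 ⊕ Fin l ↪ W) (x y : W), ((K2 l).map f).Adj x y →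
      decide (∃ z, f z = x ∧ z.isLeft) ≠ decide (∃ z, f z = y ∧ z.isLeft) := by
    intro l f x y h
    obtain ⟨x, y, hxy, rfl, rfl⟩ := (SimpleGraph.map_adj _ _ _ _).1 h
    rw [hcol, hcol]
    exact color_K2 _ _ hxy
  refine hasPoles_of_glue (H₁ := (K2 r).map f₁) (H₂ := (K2 s).map f₂) (v := f₁ a) (w := f₁ b)
    (f₁ := fun x => decide (∃ y, f₁ y = x ∧ y.isLeft))
    (f₂ := fun x => decide (∃ y, f₂ y = x ∧ y.isLeft)) ?_ ?_ (hproper f₁) (hproper f₂) ?_ ?_ ?_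
  · intro x y h
    rcases h with h | h
    · obtain ⟨x, y, hxy, rfl, rfl⟩ := (SimpleGraph.map_adj _ _ _ _).1 h
      rcases hxy with hxy | hxy
      · exact Or.inl (by simpa using hxy)
      · rw [SimpleGraph.edge_adj] at hxy
        right
        rcases hxy.1 with ⟨rfl, rfl⟩ | ⟨rfl, rfl⟩
        · rw [hac, hbd]; simpa using hcd
        · rw [hac, hbd]; simpa using hcd.symm
    · exact Or.inr h
  · intro x y z h1 h2
    obtain ⟨x, y, -, rfl, -⟩ := (SimpleGraph.map_adj _ _ _ _).1 h1
    obtain ⟨x', y', -, hx', -⟩ := (SimpleGraph.map_adj _ _ _ _).1 h2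
    have : f₁ x ∈ Set.range f₁ ∩ Set.range f₂ := ⟨⟨x, rfl⟩, ⟨x', hx'⟩⟩
    rw [hmeet] at this
    exact this
  · rw [hcol, hcol, hac, hbd, hcol, hcol]
    simp only [isLeft_eq_of_not_adj hnadj, color_K2 _ _ hcd, ne_eq, not_false_eq_true]
  · intro n c hc
    obtain ⟨c', hc'⟩ := hc.exists_of_map
    exact hc'.length_of_K2
  · intro n c hc
    obtain ⟨c', hc'⟩ := hc.exists_of_map
    exact hc'.length_of_K2

theorem not_isCyc_of_isCutEdge {G : SimpleGraph V} {C : G.Subgraph} (h : IsCutEdge G C) {n : ℕ}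
    {c : ℤ → C.verts} : ¬ IsCyc C.coe n c := by
  obtain ⟨a, b, hab, -, rfl⟩ := h
  refine not_isCyc_of_le_pair (a := ⟨a, by simp⟩) (b := ⟨b, by simp⟩) fun x y _ => ?_
  have := x.2
  simpa [Subtype.ext_iff] using this

theorem length_of_blocks [Finite V] {R : SimpleGraph V}
    (h : ∀ C : R.Subgraph, IsBlock R C → IsK2 C.coe ∨ IsCutEdge R C) {n : ℕ} {c : ℤ → V}
    (hc : IsCyc R n c) : n = 4 := by
  obtain ⟨C, hC, hadj⟩ := hc.exists_isBlock
  rcases h C hC with h | h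
  · exact (hc.coe hadj).length_of_isK2 h
  · exact absurd (hc.coe hadj) (not_isCyc_of_isCutEdge h)

/-- A vertex of a block with a neighbor outside of the block is a cut vertex. -/
theorem IsBlock.isCutVertex {R : SimpleGraph V} {B : R.Subgraph} (hB : IsBlock R B) {x y d : V}
    (hx : x ∈ B.verts) (hd : d ∈ B.verts) (hdx : d ≠ x) (hy : y ∉ B.verts) (hxy : R.Adj x y) :
    IsCutVertex R x := by
  rw [isCutVertex_iff]
  refine ⟨y, d, hxy.ne', hdx, ?_, hB.not_linked hx hy hxy hd⟩
  refine (Linked.single hxy.symm (by simp) (by simp)).trans ?_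
  exact ((isBlock_iff.1 hB).1.2 ∅ (by simp) x hx d hd (by simp) (by simp)).mono
    (fun _ _ h => B.adj_sub h) (by simp)

theorem blockTree_adj {R : SimpleGraph V} {B : {B : R.Subgraph // IsBlock R B}}
    {x : {v : V // IsCutVertex R v}} :
    (blockTree R).Adj (Sum.inl B) (Sum.inr x) ↔ x.1 ∈ B.1.verts := by
  simp [blockTree]

theorem not_blockTree_adj {R : SimpleGraph V} {B B' : {B : R.Subgraph // IsBlock R B}} :
    ¬ (blockTree R).Adj (Sum.inl B) (Sum.inl B') := by
  simp [blockTree]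

/-- In a chain of at least two blocks, a cut vertex separates the ends. -/
theorem IsBlockChain.exists_separating {R : SimpleGraph V} {k : ℕ}
    {B B' : {B : R.Subgraph // IsBlock R B}} (h : IsBlockChain R k B B') (hk : 1 ≤ k) {x₁ x₂ : V}
    (hx₁ : x₁ ∈ B.1.verts) (hx₂ : x₂ ∈ B'.1.verts) (hc₁ : ¬ IsCutVertex R x₁)
    (hc₂ : ¬ IsCutVertex R x₂) : ∃ z, z ≠ x₁ ∧ z ≠ x₂ ∧ ¬ Linked R.Adj {z} x₁ x₂ := by
  obtain ⟨φ, h0, hlast⟩ := h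
  have hnbr : ∀ i j : Fin (2 * k + 1), i.val + 1 = j.val ∨ j.val + 1 = i.val →
      (blockTree R).Adj (φ i) (φ j) := by
    intro i j hij
    rw [φ.map_rel_iff, SimpleGraph.pathGraph_adj]
    exact hij
  have hcut : ∀ (C : {B : R.Subgraph // IsBlock R B}) (i j : Fin (2 * k + 1)), φ i = Sum.inl C →
      (i.val + 1 = j.val ∨ j.val + 1 = i.val) → ∃ z, φ j = Sum.inr z ∧ z.1 ∈ C.1.verts := by
    intro C i j hi hij
    have := hnbr i j hij
    rw [hi] at this
    rcases hj : φ j with D | z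
    · rw [hj] at this
      exact absurd this not_blockTree_adj
    · rw [hj] at this
      exact ⟨z, rfl, blockTree_adj.1 this⟩
  -- The cut vertex next to the first block of the chain; the following `z'` is the one next to the
  -- last block.
  obtain ⟨z, hz, hzB⟩ := hcut B 0 ⟨1, by omega⟩ h0 (by simp)
  obtain ⟨z', -, hzB'⟩ := hcut B' (Fin.last _) ⟨2 * k - 1, by omega⟩ hlast (by simp; omega)
  have hBB' : B ≠ B' := by
    rintro rfl
    have := φ.injective (h0.trans hlast.symm)
    rw [Fin.ext_iff] at this
    simp at this
    omega
  have hzx₁ : z.1 ≠ x₁ := fun h => hc₁ (h ▸ z.2)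
  have hzx₂ : z.1 ≠ x₂ := fun h => hc₂ (h ▸ z.2)
  refine ⟨z, hzx₁, hzx₂, fun hl => ?_⟩
  -- A walk leaves `B` only at a cut vertex of `B`, and an end block of the chain has no other than
  -- `z`. So a walk that avoids `z` stays in `B`, and `x₂` would be in both end blocks without being
  -- a cut vertex.
  have hx₂B : x₂ ∈ B.1.verts := by
    refine hl.mem_of_closed hx₁ fun x y hxy hxz _ hx => ?_
    by_contra hy
    have hxc := B.2.isCutVertex hx hzB (fun h => hxz h.symm) hy hxy
    have hadj : (blockTree R).Adj (Sum.inl B) (Sum.inr ⟨x, hxc⟩) := blockTree_adj.2 hx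
    obtain ⟨j, hj⟩ := φ.surjective (Sum.inr ⟨x, hxc⟩)
    rw [← h0, ← hj, φ.map_rel_iff, SimpleGraph.pathGraph_adj] at hadj
    have hj1 : j = ⟨1, by omega⟩ := by
      ext
      simp at hadj ⊢
      omega
    rw [hj1, hz] at hj
    exact hxz (congrArg Subtype.val (Sum.inr.inj hj)).symm
  have hz'x₂ : z'.1 ≠ x₂ := fun h => hc₂ (h ▸ z'.2)
  obtain ⟨y, hy⟩ : ∃ y, B'.1.Adj x₂ y := by
    have := (isBlock_iff.1 B'.2).1.2 ∅ (by simp) x₂ hx₂ z' hzB' (by simp) (by simp)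
    rcases Relation.ReflTransGen.cases_head this with h | ⟨y, h, -⟩
    · exact absurd h.symm hz'x₂
    · exact ⟨y, h.1⟩
  refine hc₂ (B.2.isCutVertex hx₂B hzB hzx₂ (fun hyB => hBB' (Subtype.ext ?_)) hy.adj_sub)
  exact B.2.eq_of_two B'.2 hy.adj_sub.ne hx₂B hx₂ hyB hy.snd_mem

/-- A cut vertex `z` between `x₁` and `x₂` divides the chain into two parts. In the necklace they
are glued at `z` and at the identified vertex, and the odd distance of `x₁` and `x₂` is the parity
condition. -/
theorem IsNecklaceK2.hasPoles {B : SimpleGraph W} (h : IsNecklaceK2 B) : HasPoles B := by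
  classical
  obtain ⟨n, R, k, B₁, B₂, x₁, x₂, π, hbip, hk, hchain, hblocks, hx₁, hx₂, hc₁, hc₂, -, hodd, hsurj,
    hπ, rfl⟩ := h
  obtain ⟨z, hz₁, hz₂, hsep⟩ := hchain.exists_separating hk hx₁ hx₂ hc₁ hc₂
  obtain ⟨col, hcol⟩ := isBipartite_iff_bool.1 hbip
  have hcol12 : col x₁ ≠ col x₂ := by
    have hr : R.Reachable x₁ x₂ := by
      by_contra hr
      rw [SimpleGraph.dist_eq_zero_of_not_reachable hr] at hodd
      simp at hodd
    obtain ⟨p, hp⟩ := hr.exists_walk_length_eq_dist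
    rw [← hp] at hodd
    have := (SimpleGraph.Coloring.odd_length_iff_not_congr
      (SimpleGraph.Coloring.mk col fun {a b} h => hcol a b h) p).1 hodd
    change (¬ col x₁ = true) ↔ col x₂ = true at this
    intro he
    rw [he] at this
    simp at this
  have hx12 : x₁ ≠ x₂ := fun h => hcol12 (by rw [h])
  have hπx : π x₁ = π x₂ := (hπ _ _).2 (Or.inr (Or.inl ⟨rfl, rfl⟩))
  obtain ⟨s, hs⟩ := hsurj.hasRightInverse
  -- Two sections of `π`, which choose `x₁` respectively `x₂` over the identified vertex. They lift
  -- the two parts of the necklace back to `R`.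
  let s₁ : W → Fin n := fun y => if y = π x₁ then x₁ else s y
  let s₂ : W → Fin n := fun y => if y = π x₁ then x₂ else s y
  have hs₁ : ∀ a, a ≠ x₂ → s₁ (π a) = a := by
    intro a ha
    simp only [s₁]
    split_ifs with h
    · rcases (hπ _ _).1 h with h | h | h
      · exact h.symm
      · exact absurd h.2 (by tauto)
      · exact absurd h.1 ha
    · rcases (hπ _ _).1 (hs (π a)) with h' | h' | h'
      · exact h'
      · exact absurd h'.2 ha
      · exact absurd (by rw [h'.2]) h
  have hs₂ : ∀ a, a ≠ x₁ → s₂ (π a) = a := by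
    intro a ha
    simp only [s₂]
    split_ifs with h
    · rcases (hπ _ _).1 h with h | h | h
      · exact absurd h ha
      · exact absurd h.1 ha
      · exact h.1.symm
    · rcases (hπ _ _).1 (hs (π a)) with h' | h' | h'
      · exact h'
      · exact absurd (by rw [h'.2, hπx]) h
      · exact absurd h'.2 ha
  have hs₁inj : Function.Injective s₁ := by
    have : ∀ y, π (s₁ y) = y := by
      intro y
      simp only [s₁]
      split_ifs with h
      · exact h.symm
      · exact hs y
    exact Function.LeftInverse.injective this
  have hs₂inj : Function.Injective s₂ := by
    have : ∀ y, π (s₂ y) = y := by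
      intro y
      simp only [s₂]
      split_ifs with h
      · rw [h, hπx]
      · exact hs y
    exact Function.LeftInverse.injective this
  -- The component of `x₁` after deletion of `z`. Edges that meet it form the part `H₁`, the others
  -- `H₂`.
  let L : Set (Fin n) := {a | Linked R.Adj {z} x₁ a}
  have hzL : z ∉ L := fun h => absurd rfl (h.notMem (by simpa using hz₁.symm))
  have hLadj : ∀ a b, R.Adj a b → a ∈ L → b ∈ L ∨ b = z := by
    intro a b hab ha
    by_cases hb : b = z
    · exact Or.inr hb
    · exact Or.inl (ha.trans (.single hab (fun h => hzL (h ▸ ha)) hb))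
  have hLx₁ : x₁ ∈ L := Linked.refl
  have hLx₂ : x₂ ∉ L := hsep
  let H₁ : SimpleGraph W := SimpleGraph.fromRel fun x y =>
    ∃ a b, R.Adj a b ∧ a ∈ L ∧ π a = x ∧ π b = y
  let H₂ : SimpleGraph W := SimpleGraph.fromRel fun x y =>
    ∃ a b, R.Adj a b ∧ a ∉ L ∧ b ∉ L ∧ π a = x ∧ π b = y
  have hH₁ : ∀ x y, H₁.Adj x y → ∃ a b, R.Adj a b ∧ (a ∈ L ∨ a = z) ∧ (b ∈ L ∨ b = z) ∧
      π a = x ∧ π b = y := by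
    rintro x y ⟨-, ⟨a, b, h, ha, rfl, rfl⟩ | ⟨a, b, h, ha, rfl, rfl⟩⟩
    · exact ⟨a, b, h, Or.inl ha, hLadj a b h ha, rfl, rfl⟩
    · exact ⟨b, a, h.symm, hLadj a b h ha, Or.inl ha, rfl, rfl⟩
  have hH₂ : ∀ x y, H₂.Adj x y → ∃ a b, R.Adj a b ∧ a ∉ L ∧ b ∉ L ∧ π a = x ∧ π b = y := by
    rintro x y ⟨-, ⟨a, b, h, ha, hb, rfl, rfl⟩ | ⟨a, b, h, ha, hb, rfl, rfl⟩⟩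
    · exact ⟨a, b, h, ha, hb, rfl, rfl⟩
    · exact ⟨b, a, h.symm, hb, ha, rfl, rfl⟩
  have hL2 : ∀ a, (a ∈ L ∨ a = z) → a ≠ x₂ := by
    rintro a (ha | rfl) rfl
    · exact hLx₂ ha
    · exact hz₂ rfl
  have hL1 : ∀ a, a ∉ L → a ≠ x₁ := by
    rintro a ha rfl
    exact ha hLx₁
  have hlift₁ : ∀ x y, H₁.Adj x y → R.Adj (s₁ x) (s₁ y) := by
    intro x y h
    obtain ⟨a, b, hab, ha, hb, rfl, rfl⟩ := hH₁ x y h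
    rwa [hs₁ a (hL2 a ha), hs₁ b (hL2 b hb)]
  have hlift₂ : ∀ x y, H₂.Adj x y → R.Adj (s₂ x) (s₂ y) := by
    intro x y h
    obtain ⟨a, b, hab, ha, hb, rfl, rfl⟩ := hH₂ x y h
    rwa [hs₂ a (hL1 a ha), hs₂ b (hL1 b hb)]
  refine hasPoles_of_glue (H₁ := H₁) (H₂ := H₂) (v := π x₁) (w := π z) (f₁ := col ∘ s₁)
    (f₂ := col ∘ s₂) ?_ ?_ (fun x y h => hcol _ _ (hlift₁ x y h))
    (fun x y h => hcol _ _ (hlift₂ x y h)) ?_ ?_ ?_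
  · intro x y h
    have hne := h.ne
    obtain ⟨-, a, b, hab, rfl, rfl⟩ := h
    by_cases ha : a ∈ L
    · exact Or.inl ⟨hne, Or.inl ⟨a, b, hab, ha, rfl, rfl⟩⟩
    by_cases hb : b ∈ L
    · exact Or.inl ⟨hne, Or.inr ⟨b, a, hab.symm, hb, rfl, rfl⟩⟩
    · exact Or.inr ⟨hne, Or.inl ⟨a, b, hab, ha, hb, rfl, rfl⟩⟩
  · intro x y t h1 h2
    obtain ⟨a, b, hab, ha, hb, rfl, rfl⟩ := hH₁ _ _ h1
    obtain ⟨a', b', hab', ha', hb', hx', -⟩ := hH₂ _ _ h2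
    rcases (hπ _ _).1 hx' with rfl | ⟨rfl, rfl⟩ | ⟨rfl, rfl⟩
    · rcases ha with ha | rfl
      · exact absurd ha ha'
      · exact Or.inr rfl
    · exact absurd hLx₁ ha'
    · exact Or.inl rfl
  · simp only [Function.comp]
    rw [hs₁ x₁ hx12, hs₁ z hz₂, hπx, hs₂ x₂ hx12.symm, hs₂ z hz₁]
    revert hcol12
    cases col x₁ <;> cases col x₂ <;> cases col z <;> simp
  · intro n c hc
    exact length_of_blocks hblocks (hc.map (f := s₁) (fun i => hlift₁ _ _ (hc.adj i))
      fun i j h => hs₁inj h)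
  · intro n c hc
    exact length_of_blocks hblocks (hc.map (f := s₂) (fun i => hlift₂ _ _ (hc.adj i))
      fun i j h => hs₂inj h)

theorem exists_triangle {G : SimpleGraph V} {x y z : V} (hxy : G.Adj x y) (hxz : G.Adj x z)
    (hyz : G.Adj y z) : ∃ c, IsCyc G 3 c ∧ ∀ i, c i = x ∨ c i = y ∨ c i = z := by
  obtain ⟨c, h, h'⟩ := exists_isCyc_of_list (G := G) (a := x) (l := [y, z]) (by simp)
    (by simp [hxy.ne, hxz.ne, hyz.ne]) (by simp [hxy, hyz]) (by simpa using hxz.symm)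
  exact ⟨c, h, fun i => by simpa using h' i⟩

/-- Each cycle lies in one block, so an odd one is in `B` and contains both poles; hence any two
share these. In a `K₄` all four triangles would have to contain the pole `v`, but each vertex is
missed by one of them. -/
theorem HasPoles.hasSquareCircuits [Finite V] {G : SimpleGraph V} {B : G.Subgraph}
    (hB : HasPoles B.coe)
    (hC : ∀ C : G.Subgraph, IsBlock G C → C ≠ B → ∀ n c, IsCyc C.coe n c → n = 4) :
    HasSquareCircuits G := by
  obtain ⟨v, w, hvw, h⟩ := hB
  have key : ∀ n c, IsCyc G n c → n = 4 ∨ Odd n ∧ (∃ i, c i = v) ∧ ∃ j, c j = w := by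
    intro n c hc
    obtain ⟨C, hCB, hadj⟩ := hc.exists_isBlock
    by_cases hCe : C = B
    · subst hCe
      rcases h n _ (hc.coe hadj) with h | ⟨h1, ⟨i, hi⟩, ⟨j, hj⟩⟩
      · exact Or.inl h
      · exact Or.inr ⟨h1, ⟨i, congrArg Subtype.val hi⟩, ⟨j, congrArg Subtype.val hj⟩⟩
    · exact Or.inl (hC C hCB hCe n _ (hc.coe hadj))
  refine ⟨fun n c hc hn => ?_, fun n c m d hc hd hn hm => ?_, fun x y z t h1 h2 h3 h4 h5 h6 => ?_⟩
  · rcases key n c hc with h | ⟨h, -⟩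
    · exact h
    · exact absurd hn (Nat.not_even_iff_odd.2 h)
  · rcases key n c hc with rfl | ⟨-, ⟨i, hi⟩, ⟨j, hj⟩⟩
    · exact absurd hn (by decide)
    rcases key m d hd with rfl | ⟨-, ⟨i', hi'⟩, ⟨j', hj'⟩⟩
    · exact absurd hm (by decide)
    exact ⟨i, j, i', j', hi.trans hi'.symm, hj.trans hj'.symm, fun he =>
      hvw (Subtype.ext (hi.symm.trans (he.trans hj)))⟩
  · have tri : ∀ {x y z : V}, G.Adj x y → G.Adj x z → G.Adj y z →
        (v : V) = x ∨ (v : V) = y ∨ (v : V) = z := by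
      intro x y z h1 h2 h3
      obtain ⟨c, hc, hmem⟩ := exists_triangle h1 h2 h3
      rcases key 3 c hc with h | ⟨-, ⟨i, hi⟩, -⟩
      · omega
      · rw [← hi]; exact hmem i
    have t1 := tri h1 h2 h4
    have t2 := tri h1 h3 h5
    have t3 := tri h2 h3 h6
    have t4 := tri h4 h5 h6
    have := h1.ne
    have := h2.ne
    have := h3.ne
    have := h4.ne
    have := h5.ne
    have := h6.ne
    rcases t1 with h | h | h <;> rcases t2 with h' | h' | h' <;> simp_all

end Glue

end ToricGraph

namespace ToricGraph

/-! ### Ears, and biconnected graphs with 4-cycles only. -/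

section Ears

variable {W : Type*} {B : SimpleGraph W}

/-- `q 0, …, q L` is a path. -/
structure IsPathSeq (B : SimpleGraph W) (L : ℕ) (q : ℕ → W) : Prop where
  inj : ∀ i j, i ≤ L → j ≤ L → q i = q j → i = j
  adj : ∀ i < L, B.Adj (q i) (q (i + 1))

/-- The sequence `a, q 0, q 1, …`. -/
def consSeq (a : W) (q : ℕ → W) : ℕ → W
  | 0 => a
  | i + 1 => q i

theorem IsPathSeq.cons {L : ℕ} {q : ℕ → W} (h : IsPathSeq B L q) {a : W} (ha : B.Adj a (q 0))
    (hne : ∀ i ≤ L, q i ≠ a) : IsPathSeq B (L + 1) (consSeq a q) := by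
  refine ⟨fun i j hi hj he => ?_, fun i hi => ?_⟩
  · cases i <;> cases j
    · rfl
    · exact absurd he.symm (hne _ (by omega))
    · exact absurd he (hne _ (by omega))
    · rw [h.inj _ _ (by omega) (by omega) he]
  · cases i
    · exact ha
    · exact h.adj _ (by omega)

/-- If all ears of `C` have length at most 2, then the vertices outside of `C` have at least two
neighbors in `C` and no others. -/
theorem neighbors_of_ears
    (hB : ∀ A : Set W, A.Subsingleton → ∀ a b, a ∉ A → b ∉ A → Linked B.Adj A a b) {C : Set W}
    (hC : C.Nontrivial)
    (hear : ∀ L q, IsPathSeq B L q → q 0 ∈ C → q L ∈ C → (∀ i, 0 < i → i < L → q i ∉ C) → L ≤ 2)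
    {u : W} (hu : u ∉ C) :
    (∀ y, B.Adj u y → y ∈ C) ∧ ∃ a b, a ≠ b ∧ a ∈ C ∧ b ∈ C ∧ B.Adj u a ∧ B.Adj u b := by
  -- A path from `u` to `C` that avoids `a`, extended by `a`, is an ear. Since it has length at most
  -- 2, the path is a single edge to another neighbor in `C`.
  have two : ∀ u a, u ∉ C → a ∈ C → B.Adj u a → ∃ b ∈ C, b ≠ a ∧ B.Adj u b := by
    intro u a hu ha hua
    obtain ⟨c, hc, hca⟩ := hC.exists_ne a
    obtain ⟨L, q, h0, hL, hS, hinj, hr, hA⟩ :=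
      (hB {a} (by simp) u c hua.ne hca).exists_path (S := C) hua.ne hc
    have hL0 : L ≠ 0 := by rintro rfl; rw [h0] at hL; exact hu hL
    have := hear (L + 1) (consSeq a q) (IsPathSeq.cons ⟨hinj, hr⟩ (by rw [h0]; exact hua.symm) hA)
      ha hL (fun i h1 h2 => by
        obtain ⟨i, rfl⟩ := Nat.exists_eq_succ_of_ne_zero h1.ne'
        exact hS i (by omega))
    have hL1 : L = 1 := by omega
    subst hL1
    exact ⟨q 1, hL, hA 1 le_rfl, by simpa [h0] using hr 0 (by omega)⟩
  -- For adjacent `u`, `u'` outside `C`, a path from `u'` to `C` without `u` extends through `u` to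
  -- an ear with at least three edges. The start `b` is the one of two neighbors of `u` in `C` that
  -- is not the end of the path.
  have indep : ∀ u u' a, u ∉ C → u' ∉ C → a ∈ C → B.Adj u a → B.Adj u u' → False := by
    intro u u' a hu hu' ha hua huu'
    obtain ⟨a', ha', haa', hua'⟩ := two u a hu ha hua
    obtain ⟨L, q, h0, hL, hS, hinj, hr, hA⟩ :=
      (hB {u} (by simp) u' a huu'.ne' hua.ne').exists_path (S := C) huu'.ne' ha
    have hL0 : L ≠ 0 := by rintro rfl; rw [h0] at hL; exact hu' hL
    obtain ⟨b, hb, hub, hbL⟩ : ∃ b ∈ C, B.Adj u b ∧ q L ≠ b := by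
      by_cases h : q L = a
      · exact ⟨a', ha', hua', by rw [h]; exact haa'.symm⟩
      · exact ⟨a, ha, hua, h⟩
    have h1 : IsPathSeq B (L + 1) (consSeq u q) :=
      IsPathSeq.cons ⟨hinj, hr⟩ (by rw [h0]; exact huu') hA
    have h2 := h1.cons (a := b) hub.symm (by
      intro i hi
      cases i with
      | zero => exact hub.ne
      | succ i =>
        rcases (show i < L ∨ i = L by omega) with h | rfl
        · exact fun he => hS i h (show q i ∈ C by rw [show q i = b from he]; exact hb)
        · exact hbL)
    have := hear _ _ h2 hb hL (fun i h1 h2 => by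
      obtain ⟨i, rfl⟩ := Nat.exists_eq_succ_of_ne_zero h1.ne'
      cases i with
      | zero => exact hu
      | succ i => exact hS i (by omega))
    omega
  have hall : ∀ u ∉ C, ∃ a ∈ C, B.Adj u a := by
    intro u hu
    obtain ⟨c, hc⟩ := hC.nonempty
    have h := (hB ∅ (by simp) c u (by simp) (by simp)).mem_of_closed
      (S := {x | x ∈ C ∨ ∃ a ∈ C, B.Adj x a}) (Or.inl hc) (fun x y hxy _ _ hx => by
        by_cases hy : y ∈ C
        · exact Or.inl hy
        by_cases hxC : x ∈ C
        · exact Or.inr ⟨x, hxC, hxy.symm⟩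
        · obtain ⟨a, ha, hxa⟩ := hx.resolve_left hxC
          exact (indep x y a hxC hy ha hxa hxy).elim)
    exact h.resolve_left hu
  obtain ⟨a, ha, hua⟩ := hall u hu
  obtain ⟨b, hb, hba, hub⟩ := two u a hu ha hua
  refine ⟨fun y hy => ?_, a, b, hba.symm, ha, hb, hua, hub⟩
  by_contra hyC
  exact indep u y a hu hyC ha hua hy

/-- The two cycles formed by a cycle and an ear. -/
theorem IsCyc.ear_lengths {n : ℕ} {c : ℤ → W} (hc : IsCyc B n c) {L : ℕ} {q : ℕ → W}
    (hq : IsPathSeq B L q) (hL : 2 ≤ L) {i : ℤ} (h0 : q 0 = c i) {d : ℕ} (hd : 0 < d) (hdn : d < n)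
    (hqL : q L = c (i + d)) (hout : ∀ k, 0 < k → k < L → ∀ j, q k ≠ c j) :
    (∃ c', IsCyc B (L + d) c') ∧ ∃ c', IsCyc B (L + (n - d)) c' := by
  refine ⟨hc.exists_of_ear hd hdn (by omega) (by omega) h0 hqL hq.inj hout hq.adj, ?_⟩
  refine (hc.reflect 0).exists_of_ear (i := -i) (d := n - d) (by omega) (by omega) (by omega)
    (by omega) (q := q) ?_ ?_ hq.inj (fun k h1 h2 j => hout k h1 h2 _) hq.adj
  · rw [h0]; congr 1; ring
  · rw [hqL, hc.eq_iff]
    exact ⟨1, by omega⟩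

theorem isK2_of_pair [Finite W] {p q a b : W} (hpq : p ≠ q)
    (h : ∀ x y, B.Adj x y ↔ ¬ ((x = p ∨ x = q) ↔ (y = p ∨ y = q))) (hab : a ≠ b)
    (ha : ¬ (a = p ∨ a = q)) (hb : ¬ (b = p ∨ b = q)) : IsK2 B := by
  classical
  have := Fintype.ofFinite W
  let P : W → Prop := fun x => x = p ∨ x = q
  have h2 : Fintype.card {x // P x} = 2 := by
    rw [Fintype.card_subtype]
    have : Finset.univ.filter P = {p, q} := by ext x; simp [P]
    rw [this, Finset.card_pair hpq]
  let e₁ : {x // P x} ≃ Fin 2 := Fintype.equivFinOfCardEq h2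
  let e₂ : {x // ¬ P x} ≃ Fin (Fintype.card {x // ¬ P x}) := Fintype.equivFin _
  refine ⟨Fintype.card {x // ¬ P x}, ?_, ⟨⟨(Equiv.sumCompl P).symm.trans (Equiv.sumCongr e₁ e₂), ?_⟩⟩⟩
  · have : (1 : ℕ) < Fintype.card {x // ¬ P x} := by
      rw [Fintype.one_lt_card_iff]
      exact ⟨⟨a, ha⟩, ⟨b, hb⟩, fun h => hab (congrArg Subtype.val h)⟩
    omega
  · intro x y
    rw [h x y]
    have key : ∀ x, ((((Equiv.sumCompl P).symm.trans (Equiv.sumCongr e₁ e₂)) x).isLeft ↔ P x) := by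
      intro x
      by_cases hx : P x
      · simp [Equiv.sumCompl_symm_apply_of_pos hx, hx]
      · simp [Equiv.sumCompl_symm_apply_of_neg hx, hx]
    have hx := key x
    have hy := key y
    generalize ((Equiv.sumCompl P).symm.trans (Equiv.sumCongr e₁ e₂)) x = x' at hx ⊢
    generalize ((Equiv.sumCompl P).symm.trans (Equiv.sumCongr e₁ e₂)) y = y' at hy ⊢
    change _ ↔ ¬ (P x ↔ P y)
    rw [← hx, ← hy]
    rcases x' with x' | x' <;> rcases y' with y' | y' <;> simp [completeBipartiteGraph]

/-- A biconnected graph with a cycle all of whose cycles have length 4 is a `K_{2,ℓ}`. -/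
theorem isK2_of_cycles [Finite W] (hB : IsBiconnected B) (h4 : ∀ n c, IsCyc B n c → n = 4)
    (hex : ∃ n c, IsCyc B n c) : IsK2 B := by
  have hbi := (isBiconnected_iff.1 hB).2
  have hbip : B.IsBipartite := by
    by_contra hcon
    obtain ⟨n, c, hc, hn⟩ := exists_odd_isCyc hcon
    rw [h4 n c hc] at hn
    exact absurd hn (by decide)
  obtain ⟨f, hf⟩ := isBipartite_iff_bool.1 hbip
  obtain ⟨n, c, hc⟩ := hex
  obtain rfl := h4 n c hc
  have hmem : ∀ {c : ℤ → W}, IsCyc B 4 c → ∀ i, c i = c 0 ∨ c i = c 1 ∨ c i = c 2 ∨ c i = c 3 := by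
    intro c hc i
    obtain ⟨j, hj, h⟩ := hc.exists_index 0 i
    rw [h]
    interval_cases j <;> simp
  have hfar : ∀ {c : ℤ → W}, IsCyc B 4 c → f (c 2) = f (c 0) ∧ f (c 3) = f (c 1) ∧
      f (c 0) ≠ f (c 1) := by
    intro c hc
    have h1 := (hc.color_eq_iff hf 0 2).2 (by decide)
    have h2 := (hc.color_eq_iff hf 1 2).2 (by decide)
    have h3 := hf _ _ (hc.adj 0)
    norm_num at h1 h2 h3
    exact ⟨h1, h2, h3⟩
  -- An outside vertex has at least two neighbors on the 4-cycle, all of the same color, so they are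
  -- precisely one pair of opposite vertices.
  have hout : ∀ {c : ℤ → W}, IsCyc B 4 c → ∀ u ∉ Set.range c,
      (∀ y, B.Adj u y ↔ y = c 0 ∨ y = c 2) ∨ (∀ y, B.Adj u y ↔ y = c 1 ∨ y = c 3) := by
    intro c hc u hu
    obtain ⟨h1, a, b, hab, ⟨i, rfl⟩, ⟨j, rfl⟩, hua, hub⟩ := neighbors_of_ears hbi (C := Set.range c)
      ⟨c 0, ⟨0, rfl⟩, c 1, ⟨1, rfl⟩, (hc.adj 0).ne⟩ (by
        rintro L q hq ⟨i, hi⟩ ⟨j, hj⟩ hint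
        by_contra hlt
        obtain ⟨d, hd, hjd⟩ := hc.exists_index i j
        rw [hjd] at hj
        have hd0 : 0 < d := by
          rcases Nat.eq_zero_or_pos d with rfl | h
          · rw [Nat.cast_zero, add_zero, hi] at hj
            have := hq.inj 0 L (by omega) le_rfl hj
            omega
          · exact h
        obtain ⟨⟨c₁, hc₁⟩, c₂, hc₂⟩ := hc.ear_lengths hq (by omega) hi.symm hd0 hd hj.symm
          fun k h1 h2 j he => hint k h1 h2 ⟨j, he.symm⟩
        have e1 := h4 _ _ hc₁
        have e2 := h4 _ _ hc₂
        omega) hu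
    have hcol : ∀ y, B.Adj u y → f y = f (c i) := by
      intro y hy
      have h1 := hf _ _ hy
      have h2 := hf _ _ hua
      revert h1 h2
      cases f y <;> cases f u <;> cases f (c i) <;> simp
    obtain ⟨e1, e2, e3⟩ := hfar hc
    have hij := hcol _ hub
    have hi := hmem hc i
    have hj := hmem hc j
    by_cases hfi : f (c i) = f (c 0)
    · left
      have r : ∀ y, B.Adj u y → y = c 0 ∨ y = c 2 := by
        intro y hy
        obtain ⟨k, rfl⟩ := h1 y hy
        have := hcol _ hy
        rw [hfi] at this
        rcases hmem hc k with h | h | h | h <;> rw [h] at this ⊢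
        · exact Or.inl rfl
        · exact absurd this.symm e3
        · exact Or.inr rfl
        · exact absurd (e2.symm.trans this).symm e3
      have hi' := r _ hua
      have hj' := r _ hub
      refine fun y => ⟨r y, ?_⟩
      rintro (rfl | rfl) <;> rcases hi' with h | h <;> rcases hj' with h' | h' <;> simp_all
    · right
      have r : ∀ y, B.Adj u y → y = c 1 ∨ y = c 3 := by
        intro y hy
        obtain ⟨k, rfl⟩ := h1 y hy
        have := hcol _ hy
        rcases hmem hc k with h | h | h | h <;> rw [h] at this ⊢
        · exact absurd this.symm hfi
        · exact Or.inl rfl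
        · exact absurd (e1.symm.trans this).symm hfi
        · exact Or.inr rfl
      have hi' := r _ hua
      have hj' := r _ hub
      refine fun y => ⟨r y, ?_⟩
      rintro (rfl | rfl) <;> rcases hi' with h | h <;> rcases hj' with h' | h' <;> simp_all
  -- All outside vertices are attached to the same pair of opposite vertices. If this is the pair `c
  -- 1`, `c 3`, the cycle is rotated by one.
  wlog hside : ∀ u ∉ Set.range c, ∀ y, B.Adj u y ↔ y = c 0 ∨ y = c 2 generalizing c
  · have hr : Set.range (fun i => c (1 + i)) = Set.range c := by
      ext x
      constructor
      · rintro ⟨i, rfl⟩; exact ⟨_, rfl⟩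
      · rintro ⟨i, rfl⟩; exact ⟨i - 1, by simp⟩
    refine this _ (hc.shift 1) fun u hu y => ?_
    rw [hr] at hu
    push Not at hside
    obtain ⟨u', hu', y', hy'⟩ := hside
    have hu1 : ∀ y, B.Adj u' y ↔ y = c 1 ∨ y = c 3 := by
      refine (hout hc u' hu').resolve_left fun h => ?_
      have := h y'
      tauto
    have n01 := (hc.adj 0).ne
    have n12 := (hc.adj 1).ne
    have n23 := (hc.adj 2).ne
    have n02 : c 0 ≠ c 2 := hc.ne (by omega) (by norm_num)
    have n03 : c 0 ≠ c 3 := hc.ne (by omega) (by norm_num)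
    have n13 : c 1 ≠ c 3 := hc.ne (by omega) (by norm_num)
    have a12 := hc.adj 1
    have a30 : B.Adj (c 3) (c 0) := by
      have := hc.adj 3
      rwa [show (3 : ℤ) + 1 = 0 + (4 : ℕ) by norm_num, hc.add_period] at this
    rcases hout hc u hu with h | h
    · exfalso
      have huc : ∀ i, u ≠ c i := fun i hi => hu ⟨i, hi.symm⟩
      have huc' : ∀ i, u' ≠ c i := fun i hi => hu' ⟨i, hi.symm⟩
      have huu : u ≠ u' := by
        rintro rfl
        have := (h (c 0)).2 (Or.inl rfl)
        rw [hu1] at this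
        norm_num at *
        tauto
      norm_num at n01 n12 n23 a12
      -- Outside vertices attached to different pairs are used as detours, which yields a 6-cycle.
      obtain ⟨c', hc', -⟩ := exists_isCyc_of_list (G := B) (a := c 0) (l := [u, c 2, c 1, u', c 3])
        (by simp) (by
          simp only [List.nodup_cons, List.mem_cons, List.not_mem_nil, or_false, not_or]
          have := huc' 0
          have := huc' 1
          have := huc' 2
          have := huc' 3
          have := huc 0
          have := huc 1
          have := huc 2
          have := huc 3
          simp_all [eq_comm]) (by
          simp only [List.isChain_cons_cons, List.isChain_singleton, and_true]
          exact ⟨((h _).2 (Or.inl rfl)).symm, (h _).2 (Or.inr rfl), a12.symm,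
            ((hu1 _).2 (Or.inl rfl)).symm, (hu1 _).2 (Or.inr rfl)⟩) (by simpa using a30)
      have := h4 _ _ hc'
      simp at this
    · rw [h]
      simp only [add_zero]
      norm_num
  have n02 : c 0 ≠ c 2 := hc.ne (by omega) (by norm_num)
  have n13 : c 1 ≠ c 3 := hc.ne (by omega) (by norm_num)
  obtain ⟨e1, e2, e3⟩ := hfar hc
  have a01 := hc.adj 0
  have a12 := hc.adj 1
  have a23 := hc.adj 2
  have a30 : B.Adj (c 3) (c 0) := by
    have := hc.adj 3
    rwa [show (3 : ℤ) + 1 = 0 + (4 : ℕ) by norm_num, hc.add_period] at this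
  norm_num at a01 a12 a23
  have n01 := a01.ne
  have n12 := a12.ne
  have n23 := a23.ne
  have n30 := a30.ne
  -- `c 0` and `c 2` form one side of the `K_{2,ℓ}`; all other vertices, including `c 1` and `c 3`,
  -- form the other.
  have hN : ∀ x, ¬ (x = c 0 ∨ x = c 2) → ∀ y, B.Adj x y ↔ y = c 0 ∨ y = c 2 := by
    intro x hx y
    by_cases hxr : x ∈ Set.range c
    · obtain ⟨i, rfl⟩ := hxr
      have hi : c i = c 1 ∨ c i = c 3 := by have := hmem hc i; tauto
      have hfi : f (c i) = f (c 1) := by rcases hi with h | h <;> rw [h]; exact e2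
      constructor
      · intro hy
        have hfy := hf _ _ hy
        by_contra hcon
        by_cases hyr : y ∈ Set.range c
        · obtain ⟨j, rfl⟩ := hyr
          rcases hmem hc j with h | h | h | h <;> simp_all
        · exact hx ((hside y hyr _).1 hy.symm)
      · rcases hi with h | h <;> rw [h] <;> rintro (rfl | rfl)
        · exact a01.symm
        · exact a12
        · exact a30
        · exact a23.symm
    · exact hside x hxr y
  refine isK2_of_pair n02 (a := c 1) (b := c 3) (fun x y => ?_) n13 (by simp [n01.symm, n12])
    (by simp [n30, n23.symm])
  by_cases hx : x = c 0 ∨ x = c 2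
  · by_cases hy : y = c 0 ∨ y = c 2
    · simp only [hx, hy]
      simp only [not_true_eq_false, iff_false]
      intro h
      refine hf _ _ h ?_
      rcases hx with rfl | rfl <;> rcases hy with rfl | rfl <;> simp [e1]
    · rw [B.adj_comm, hN y hy]
      simp [hx, hy]
  · rw [hN x hx]
    simp only [hx, false_iff, not_not]

end Ears

/-! ### Blocks with 4-cycles only. -/

section BipartiteBlocks

variable {V : Type*} {R : SimpleGraph V}

/-- A biconnected graph with at least three vertices has a cycle. -/
theorem exists_isCyc_of_three
    (hB : ∀ A : Set V, A.Subsingleton → ∀ a b, a ∉ A → b ∉ A → Linked R.Adj A a b)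
    {a b d : V} (hab : R.Adj a b) (hda : d ≠ a) (hdb : d ≠ b) : ∃ n c, IsCyc R n c := by
  obtain ⟨e, hbe, hea⟩ : ∃ e, R.Adj b e ∧ e ≠ a := by
    rcases Relation.ReflTransGen.cases_head (hB {a} (by simp) b d hab.ne' hda) with h | ⟨e, h, -⟩
    · exact absurd h.symm hdb
    · exact ⟨e, h.1, h.2.2⟩
  obtain ⟨L, q, h0, hL, hS, hinj, hr, hA⟩ :=
    (hB {b} (by simp) e a hbe.ne' hab.ne).exists_path (S := {a}) hbe.ne' rfl
  have hL0 : L ≠ 0 := by rintro rfl; rw [h0] at hL; exact hea hL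
  have hp : IsPathSeq R (L + 1) (consSeq b q) :=
    IsPathSeq.cons ⟨hinj, hr⟩ (by rw [h0]; exact hbe) hA
  exact ⟨_, _, IsCyc.of_path (n := L + 2) (by omega) (fun i j hi hj => hp.inj i j (by omega)
    (by omega)) (fun i hi => hp.adj i (by omega)) (by
      show R.Adj (q L) b
      rw [show q L = a from hL]
      exact hab)⟩

/-- A block without edges is a single vertex, and an edge at this vertex is a larger inseparable
subgraph. -/
theorem IsBlock.exists_adj (hR : ∀ x, ∃ y, R.Adj x y) {B : R.Subgraph} (hB : IsBlock R B) :
    ∃ a b, B.Adj a b := by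
  have hins := (isBlock_iff.1 hB).1
  obtain ⟨a, ha⟩ := hins.1
  obtain ⟨b, hb⟩ := hR a
  by_contra! hcon
  have hsub : ∀ y ∈ B.verts, y = a := by
    intro y hy
    rcases Relation.ReflTransGen.cases_head (hins.2 ∅ (by simp) a ha y hy (by simp) (by simp))
      with h | ⟨e, h, -⟩
    · exact h.symm
    · exact absurd h.1 (hcon _ _)
  have hle : B ≤ R.subgraphOfAdj hb :=
    ⟨fun y hy => by rw [hsub y hy]; simp, fun x y hxy => absurd hxy (hcon _ _)⟩
  have := (isBlock_iff.1 hB).eq_of_ge (inseparable_subgraphOfAdj hb) hle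
  exact hcon a b (by rw [← this]; simp)

/-- A block with cycles of length 4 only. -/
theorem IsBlock.isK2_or_isCutEdge [Finite V] (hR : ∀ x, ∃ y, R.Adj x y) {B : R.Subgraph}
    (hB : IsBlock R B) (h4 : ∀ n c, IsCyc B.coe n c → n = 4) : IsK2 B.coe ∨ IsCutEdge R B := by
  have hins := (isBlock_iff.1 hB).1
  have hbi := (isBiconnected_iff.1 (isBiconnected_coe_iff.2 hins)).2
  by_cases hex : ∃ n c, IsCyc B.coe n c
  · exact Or.inl (isK2_of_cycles (isBiconnected_coe_iff.2 hins) h4 hex)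
  right
  obtain ⟨a, b, hab⟩ := hB.exists_adj hR
  have hverts : ∀ d ∈ B.verts, d = a ∨ d = b := by
    intro d hd
    by_contra! hcon
    exact hex (exists_isCyc_of_three hbi (a := ⟨a, hab.fst_mem⟩) (b := ⟨b, hab.snd_mem⟩)
      (d := ⟨d, hd⟩) hab (fun h => hcon.1 (congrArg Subtype.val h))
      (fun h => hcon.2 (congrArg Subtype.val h)))
  have hRab := hab.adj_sub
  refine ⟨a, b, hRab, ?_, ?_⟩
  -- If the edge were not a bridge, it would close a cycle. The block of this cycle shares `a` and
  -- `b` with `B`, so it is `B`, which has no third vertex.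
  · by_contra hbr
    rw [SimpleGraph.isBridge_iff] at hbr
    push Not at hbr
    have hreach := hbr
    rw [reachable_iff_linked] at hreach
    obtain ⟨L, q, h0, hL, hS, hinj, hr, -⟩ := hreach.exists_path (S := {b}) (by simp) rfl
    have hL : q L = b := hL
    have hL0 : L ≠ 0 := by rintro rfl; exact hRab.ne (h0.symm.trans hL)
    have hL1 : L ≠ 1 := by
      rintro rfl
      have := hr 0 (by omega)
      rw [zero_add, h0, hL] at this
      simp at this
    have hcyc := IsCyc.of_path (G := R) (p := q) (n := L + 1) (by omega)
      (fun i j hi hj => hinj i j (by omega) (by omega))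
      (fun i hi => ((hr i (by omega)) : _ ∧ _).1) (by
        rw [Nat.add_sub_cancel, hL, h0]; exact hRab.symm)
    obtain ⟨D, hD, hDadj⟩ := hcyc.exists_isBlock
    have hqD : ∀ i, i ≤ L → q i ∈ D.verts := by
      intro i hi
      have := (hDadj i).fst_mem
      rwa [show ((i : ℤ) % ((L + 1 : ℕ) : ℤ)).toNat = i by
        rw [Int.emod_eq_of_lt (by omega) (by omega)]; rfl] at this
    have hBD := hB.eq_of_two hD hRab.ne hab.fst_mem (h0 ▸ hqD 0 (by omega)) hab.snd_mem
      (hL ▸ hqD L le_rfl)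
    have h1 := hqD 1 (by omega)
    rw [← hBD] at h1
    rcases hverts _ h1 with h | h
    · have := hinj 1 0 (by omega) (by omega) (h.trans h0.symm)
      omega
    · have := hinj 1 L (by omega) (by omega) (h.trans hL.symm)
      omega
  · have hle : B ≤ R.subgraphOfAdj hRab :=
      ⟨fun d hd => by simpa using hverts d hd, fun x y hxy => by
        have := hxy.adj_sub.ne
        rcases hverts _ hxy.fst_mem with rfl | rfl <;>
          rcases hverts _ hxy.snd_mem with rfl | rfl <;> simp_all⟩
    exact le_antisymm hle ((SimpleGraph.subgraphOfAdj_le_iff _ _).2 hab)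

end BipartiteBlocks

end ToricGraph

namespace ToricGraph

/-! ### The longest odd cycle of a biconnected graph with square circuits. -/

section LongestOddCycle

variable {W : Type*} {B : SimpleGraph W}

theorem IsCyc.le_card [Finite W] {n : ℕ} {c : ℤ → W} (h : IsCyc B n c) : n ≤ Nat.card W := by
  have : Function.Injective fun i : Fin n => c i := by
    intro i j hij
    by_contra hne
    rcases lt_or_gt_of_ne hne with hlt | hlt
    · exact h.ne (i := i) (j := j) (by exact_mod_cast hlt) (by omega) hij
    · exact h.ne (i := j) (j := i) (by exact_mod_cast hlt) (by omega) hij.symm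
  simpa using Nat.card_le_card_of_injective _ this

/-- `c` is a longest odd cycle. -/
structure IsLongestOdd (B : SimpleGraph W) (n : ℕ) (c : ℤ → W) : Prop where
  cyc : IsCyc B n c
  odd : Odd n
  max : ∀ m d, IsCyc B m d → Odd m → m ≤ n

theorem exists_isLongestOdd [Finite W] (h : ¬ B.IsBipartite) : ∃ n c, IsLongestOdd B n c := by
  have hfin : {n | ∃ c, IsCyc B n c ∧ Odd n}.Finite :=
    (Set.finite_Iic (Nat.card W)).subset fun n ⟨c, hc, _⟩ => hc.le_card
  obtain ⟨n, c, hc, hn⟩ := exists_odd_isCyc h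
  obtain ⟨m, -, ⟨⟨d, hd, hm⟩, hmax⟩⟩ := hfin.exists_le_maximal ⟨c, hc, hn⟩
  refine ⟨m, d, hd, hm, fun m' d' hd' hm' => ?_⟩
  by_contra hlt
  exact hlt (hmax ⟨d', hd', hm'⟩ (by omega))

namespace IsLongestOdd

variable {n : ℕ} {c : ℤ → W}

theorem shift (h : IsLongestOdd B n c) (k : ℤ) : IsLongestOdd B n (fun i => c (k + i)) := ⟨h.cyc.shift k, h.odd, h.max⟩

/-- The two cycles through the ear have lengths of different parity. The even one has length 4 and
the odd one is at most `n`, which leaves only an ear of length 2 over an arc of length 2. -/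
theorem ear (hG : HasSquareCircuits B) (h : IsLongestOdd B n c)
    {L : ℕ} {q : ℕ → W} (hq : IsPathSeq B L q) (hL : 2 ≤ L) {i : ℤ} (h0 : q 0 = c i)
    {d : ℕ} (hd : 0 < d) (hdn : d < n) (hqL : q L = c (i + d))
    (hout : ∀ k, 0 < k → k < L → ∀ j, q k ≠ c j) : L = 2 ∧ (d = 2 ∨ n - d = 2) := by
  obtain ⟨⟨c₁, h₁⟩, c₂, h₂⟩ := h.cyc.ear_lengths hq hL h0 hd hdn hqL hout
  have hodd := Nat.odd_iff.1 h.odd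
  rcases Nat.even_or_odd (L + d) with he | ho
  · have e1 := hG.even _ _ h₁ he
    have e2 := h.max _ _ h₂ (by rw [Nat.odd_iff]; omega)
    omega
  · have e1 := h.max _ _ h₁ ho
    rw [Nat.odd_iff] at ho
    have e2 := hG.even _ _ h₂ (by rw [Nat.even_iff]; omega)
    omega

/-- A chord divides an odd cycle into an even and an odd one, and the even one has length 4. The
values 1 stand for edges of the cycle itself. -/
theorem chord (hG : HasSquareCircuits B) (h : IsLongestOdd B n c)
    {i : ℤ} {d : ℕ} (hd : 0 < d) (hdn : d < n) (hadj : B.Adj (c i) (c (i + d))) :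
    d = 1 ∨ n - d = 1 ∨ d = 3 ∨ n - d = 3 := by
  by_contra! hcon
  have hodd := Nat.odd_iff.1 h.odd
  have hne : c i ≠ c (i + d) := hadj.ne
  have path : ∀ {a b : W}, a ≠ b → ∀ k l, k ≤ 1 → l ≤ 1 →
      (if k = 0 then a else b) = (if l = 0 then a else b) → k = l := by
    intro a b hab k l hk hl he
    interval_cases k <;> interval_cases l <;> simp_all
  obtain ⟨c₁, h₁⟩ := h.cyc.exists_of_ear (L := 1) hd hdn (by omega) (by omega)
    (q := fun k => if k = 0 then c i else c (i + d)) rfl rfl (path hne) (fun k h1 h2 => by omega)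
    (fun k hk => by interval_cases k; simpa using hadj)
  have hd' : c (i + d + (n - d : ℕ)) = c i := by
    rw [show i + d + ((n - d : ℕ) : ℤ) = i + n by omega, h.cyc.add_period]
  obtain ⟨c₂, h₂⟩ := h.cyc.exists_of_ear (L := 1) (i := i + d) (d := n - d) (by omega) (by omega)
    (by omega) (by omega) (q := fun k => if k = 0 then c (i + d) else c i) rfl hd'.symm
    (path hne.symm) (fun k h1 h2 => by omega)
    (fun k hk => by interval_cases k; simpa using hadj.symm)
  rcases Nat.even_or_odd (1 + d) with he | ho
  · have e1 := hG.even _ _ h₁ he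
    omega
  · rw [Nat.odd_iff] at ho
    have e2 := hG.even _ _ h₂ (by rw [Nat.even_iff]; omega)
    omega

/-- Two neighbors of a vertex outside of a longest odd cycle. -/
theorem span_two (hG : HasSquareCircuits B) (h : IsLongestOdd B n c)
    {u : W} (hu : u ∉ Set.range c) {i : ℤ} {d : ℕ} (hd : 0 < d) (hdn : d < n)
    (h1 : B.Adj u (c i)) (h2 : B.Adj u (c (i + d))) : d = 2 ∨ n - d = 2 := by
  have hne : c i ≠ c (i + d) := h.cyc.ne (by omega) (by omega)
  have huc : ∀ j, u ≠ c j := fun j hj => hu ⟨j, hj.symm⟩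
  have hp : IsPathSeq B 2 (consSeq (c i) (consSeq u fun _ => c (i + d))) := by
    refine IsPathSeq.cons (L := 1) (IsPathSeq.cons (L := 0) ⟨fun i j hi hj _ => by omega,
      fun i hi => by omega⟩ h2 fun j _ => (huc _).symm) h1.symm ?_
    intro j hj
    interval_cases j
    · exact huc _
    · exact hne.symm
  exact (ear hG h hp le_rfl rfl hd hdn rfl fun k h1 h2 j => by
    have : k = 1 := by omega
    subst this
    exact huc j).2

/-- By `ear` all ears have length at most 2, so an outside vertex has at least two neighbors on the
cycle and none elsewhere. Any two of them are at distance 2 along the cycle, and three such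
neighbors are impossible. -/
theorem twin (hG : HasSquareCircuits B) (h : IsLongestOdd B n c)
    (hB : ∀ A : Set W, A.Subsingleton → ∀ a b, a ∉ A → b ∉ A → Linked B.Adj A a b)
    {u : W} (hu : u ∉ Set.range c) : ∃ i, ∀ y, B.Adj u y ↔ y = c (i - 1) ∨ y = c (i + 1) := by
  have h3 := h.cyc.three_le
  have hodd := Nat.odd_iff.1 h.odd
  obtain ⟨hN, a, b, hab, ⟨j, rfl⟩, ⟨l, rfl⟩, hua, hub⟩ := neighbors_of_ears hB (C := Set.range c)
    ⟨c 0, ⟨0, rfl⟩, c 1, ⟨1, rfl⟩, (h.cyc.adj 0).ne⟩ (by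
      rintro L q hq ⟨i, hi⟩ ⟨j, hj⟩ hint
      by_contra hlt
      obtain ⟨d, hd, hjd⟩ := h.cyc.exists_index i j
      rw [hjd] at hj
      have hd0 : 0 < d := by
        rcases Nat.eq_zero_or_pos d with rfl | h
        · rw [Nat.cast_zero, add_zero, hi] at hj
          have := hq.inj 0 L (by omega) le_rfl hj
          omega
        · exact h
      have := (ear hG h hq (by omega) hi.symm hd0 hd hj.symm
        fun k h1 h2 j he => hint k h1 h2 ⟨j, he.symm⟩).1
      omega) hu
  obtain ⟨i, hi1, hi2⟩ : ∃ i, B.Adj u (c (i - 1)) ∧ B.Adj u (c (i + 1)) := by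
    obtain ⟨d, hd, hl⟩ := h.cyc.exists_index j l
    rw [hl] at hub hab
    have hd0 : 0 < d := by
      rcases Nat.eq_zero_or_pos d with rfl | h
      · simp at hab
      · exact h
    rcases span_two hG h hu hd0 hd hua hub with rfl | hd2
    · exact ⟨j + 1, by simpa using hua, by rw [add_assoc]; exact hub⟩
    · refine ⟨j - 1, ?_, by simpa using hua⟩
      rw [← h.cyc.add_period, show j - 1 - 1 + (n : ℤ) = j + d by omega]
      exact hub
  refine ⟨i, fun y => ⟨fun hy => ?_, ?_⟩⟩
  · by_contra! hcon
    obtain ⟨k, rfl⟩ := hN y hy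
    obtain ⟨e, he, hk⟩ := h.cyc.exists_index (i - 1) k
    rw [hk] at hy hcon
    have he0 : e ≠ 0 := by rintro rfl; simp at hcon
    have he2 : e ≠ 2 := by
      rintro rfl
      exact hcon.2 (by congr 1; push_cast; ring)
    have s1 := span_two hG h hu (by omega) he hi1 hy
    rcases (show e = 1 ∨ 2 < e by omega) with rfl | hlt
    · have hn3 : n = 3 := by omega
      subst hn3
      have e1 := h.cyc.adj (i - 1)
      have e2 := h.cyc.adj i
      have e3 := h.cyc.adj (i + 1)
      rw [show i + 1 + 1 = i - 1 + (3 : ℕ) by push_cast; ring, h.cyc.add_period] at e3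
      rw [sub_add_cancel] at e1
      rw [Nat.cast_one, sub_add_cancel] at hy
      exact hG.not_K4 _ _ _ _ hi1 hy hi2 e1 e3.symm e2
    · have s2 := span_two hG h hu (i := i + 1) (d := e - 2) (by omega) (by omega) hi2 (by
        rw [show i + 1 + ((e - 2 : ℕ) : ℤ) = i - 1 + e by omega]
        exact hy)
      omega
  · rintro (rfl | rfl)
    · exact hi1
    · exact hi2

end IsLongestOdd

/-- Some vertex outside of the cycle can replace `c i`. -/
def HasTwin (B : SimpleGraph W) (c : ℤ → W) (i : ℤ) : Prop :=
  ∃ u ∉ Set.range c, B.Adj u (c (i - 1)) ∧ B.Adj u (c (i + 1))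

/-- A chord cuts off `c i` and `c (i + 1)`. -/
def HasChord (B : SimpleGraph W) (c : ℤ → W) (i : ℤ) : Prop :=
  B.Adj (c (i - 1)) (c (i + 2))

/-- No odd cycle close to `c` avoids `c i`. -/
def IsFixed (B : SimpleGraph W) (c : ℤ → W) (i : ℤ) : Prop :=
  ¬ HasTwin B c i ∧ ¬ HasChord B c i ∧ ¬ HasChord B c (i - 1)

namespace IsLongestOdd

variable {n : ℕ} {c : ℤ → W}

theorem five_le_of_hasChord (h : IsLongestOdd B n c) {i : ℤ} (hi : HasChord B c i) : 5 ≤ n := by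
  have h3 := h.cyc.three_le
  have hodd := Nat.odd_iff.1 h.odd
  by_contra hlt
  have : n = 3 := by omega
  subst this
  refine hi.ne ?_
  rw [show i + 2 = i - 1 + (3 : ℕ) by push_cast; ring, h.cyc.add_period]

theorem false_of_hexagon (hG : HasSquareCircuits B) {a b x y z t : W} (hn : [a, b, x, y, z, t].Nodup) (h1 : B.Adj a b)
    (h2 : B.Adj b x) (h3 : B.Adj x y) (h4 : B.Adj y z) (h5 : B.Adj z t) (h6 : B.Adj t a) :
    False := by
  obtain ⟨c', hc', -⟩ := exists_isCyc_of_list (G := B) (a := a) (l := [b, x, y, z, t]) (by simp) hn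
    (by simp [h1, h2, h3, h4, h5]) (by simpa using h6)
  have := hG.even _ _ hc' (by simp; decide)
  simp at this

/-- With both twins as detours there is a 6-cycle that passes through `c i` and `c (i + 1)` as well.
-/
theorem not_hasTwin_hasTwin (hG : HasSquareCircuits B) (h : IsLongestOdd B n c)
    (hB : ∀ A : Set W, A.Subsingleton → ∀ a b, a ∉ A → b ∉ A → Linked B.Adj A a b) {i : ℤ}
    (h1 : HasTwin B c i) (h2 : HasTwin B c (i + 1)) : False := by
  have h3 := h.cyc.three_le
  have hodd := Nat.odd_iff.1 h.odd
  obtain ⟨u, hu, ha, hb⟩ := h1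
  obtain ⟨u', hu', ha', hb'⟩ := h2
  rw [add_sub_cancel_right] at ha'
  rw [show i + 1 + 1 = i + 2 by ring] at hb'
  have huc : ∀ j, u ≠ c j := fun j hj => hu ⟨j, hj.symm⟩
  have huc' : ∀ j, u' ≠ c j := fun j hj => hu' ⟨j, hj.symm⟩
  have a1 := h.cyc.adj_of_eq (i := i - 1) (j := i) (by ring)
  have a2 := h.cyc.adj i
  have a3 := h.cyc.adj_of_eq (i := i + 1) (j := i + 2) (by ring)
  have n1 : c (i - 1) ≠ c (i + 1) := h.cyc.ne (by omega) (by omega)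
  have huu : u ≠ u' := by
    rintro rfl
    obtain ⟨j, hj⟩ := twin hG h hB hu
    have := a1.ne
    have := a2.ne
    rcases (hj _).1 ha with e1 | e1 <;> rcases (hj _).1 hb with e2 | e2 <;>
      rcases (hj _).1 ha' with e3 | e3 <;> simp_all
  -- In a triangle the vertices `c (i + 2)` and `c (i - 1)` coincide. The two twins then give an odd
  -- cycle of length 5, longer than a longest one.
  rcases (show n = 3 ∨ 5 ≤ n by omega) with hn | hn
  · have e : c (i + 2) = c (i - 1) := by
      rw [show i + 2 = i - 1 + (n : ℤ) by omega, h.cyc.add_period]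
    rw [e] at hb'
    obtain ⟨c', hc', -⟩ := exists_isCyc_of_list (G := B) (a := u)
      (l := [c (i + 1), c i, u', c (i - 1)]) (by simp)
      (by simp [huc, (huc' _).symm, huc', huu, a1.ne', n1.symm, a2.ne'])
      (by simp [hb, a2.symm, ha'.symm, hb']) (by simpa using ha.symm)
    have := h.max _ _ hc' (by simp; decide)
    simp at this
    omega
  · have n2 : c i ≠ c (i + 2) := h.cyc.ne (by omega) (by omega)
    have n3 : c (i - 1) ≠ c (i + 2) := h.cyc.ne (by omega) (by omega)
    exact false_of_hexagon hG (a := c (i - 1)) (b := u) (x := c (i + 1)) (y := c (i + 2)) (z := u')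
      (t := c i) (by simp [huc, (huc _).symm, (huc' _).symm, huc', huu, a1.ne, n1, a2.ne', n2.symm,
        n3, a3.ne]) ha.symm hb a3 hb'.symm ha' a1.symm

/-- The chord from `c i` to `c (i + 3)` and the twin as a detour around `c i` form a 6-cycle.
`not_hasChord_hasTwin` is the mirror image. -/
theorem not_hasTwin_hasChord (hG : HasSquareCircuits B) (h : IsLongestOdd B n c)
    {i : ℤ} (h1 : HasTwin B c i) (h2 : HasChord B c (i + 1)) : False := by
  have h5 := five_le_of_hasChord h h2
  obtain ⟨u, hu, ha, hb⟩ := h1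
  unfold HasChord at h2
  rw [add_sub_cancel_right, show i + 1 + 2 = i + 3 by ring] at h2
  have huc : ∀ j, u ≠ c j := fun j hj => hu ⟨j, hj.symm⟩
  have a1 := h.cyc.adj_of_eq (i := i - 1) (j := i) (by ring)
  have a3 := h.cyc.adj_of_eq (i := i + 1) (j := i + 2) (by ring)
  have a4 := h.cyc.adj_of_eq (i := i + 2) (j := i + 3) (by ring)
  have n1 : c (i - 1) ≠ c (i + 1) := h.cyc.ne (by omega) (by omega)
  have n2 : c (i - 1) ≠ c (i + 2) := h.cyc.ne (by omega) (by omega)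
  have n3 : c (i - 1) ≠ c (i + 3) := h.cyc.ne (by omega) (by omega)
  have n4 : c (i + 1) ≠ c (i + 3) := h.cyc.ne (by omega) (by omega)
  have n5 : c i ≠ c (i + 1) := h.cyc.ne (by omega) (by omega)
  have n6 : c i ≠ c (i + 2) := h.cyc.ne (by omega) (by omega)
  exact false_of_hexagon hG (a := c (i - 1)) (b := u) (x := c (i + 1)) (y := c (i + 2))
    (z := c (i + 3)) (t := c i) (by simp [huc, (huc _).symm, a1.ne, n1, n2, n3, n4, n5.symm,
      n6.symm, a3.ne, a4.ne, h2.ne']) ha.symm hb a3 a4 h2.symm a1.symm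

theorem not_hasChord_hasTwin (hG : HasSquareCircuits B) (h : IsLongestOdd B n c)
    {i : ℤ} (h1 : HasChord B c i) (h2 : HasTwin B c (i + 2)) : False := by
  have h5 := five_le_of_hasChord h h1
  obtain ⟨u, hu, ha, hb⟩ := h2
  unfold HasChord at h1
  rw [show i + 2 - 1 = i + 1 by ring] at ha
  rw [show i + 2 + 1 = i + 3 by ring] at hb
  have huc : ∀ j, u ≠ c j := fun j hj => hu ⟨j, hj.symm⟩
  have a1 := h.cyc.adj_of_eq (i := i - 1) (j := i) (by ring)
  have a3 := h.cyc.adj_of_eq (i := i) (j := i + 1) (by ring)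
  have a4 := h.cyc.adj_of_eq (i := i + 2) (j := i + 3) (by ring)
  have n1 : c (i - 1) ≠ c (i + 1) := h.cyc.ne (by omega) (by omega)
  have n3 : c (i - 1) ≠ c (i + 3) := h.cyc.ne (by omega) (by omega)
  have n4 : c (i + 1) ≠ c (i + 3) := h.cyc.ne (by omega) (by omega)
  have n5 : c i ≠ c (i + 3) := h.cyc.ne (by omega) (by omega)
  have n6 : c i ≠ c (i + 2) := h.cyc.ne (by omega) (by omega)
  have n7 : c (i + 1) ≠ c (i + 2) := h.cyc.ne (by omega) (by omega)
  exact false_of_hexagon hG (a := c (i + 3)) (b := u) (x := c (i + 1)) (y := c i)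
    (z := c (i - 1)) (t := c (i + 2)) (by simp [huc, (huc _).symm, a1.ne', n1.symm, n3.symm,
      n4.symm, n5.symm, n6, n7, a3.ne', a4.ne', h1.ne]) hb.symm ha a3.symm a1.symm h1 a4

/-- The two chords overlap in a 6-cycle, unless `n = 5`. In that case the far ends coincide and
there are two triangles with only this vertex in common. -/
theorem not_hasChord_hasChord (hG : HasSquareCircuits B) (h : IsLongestOdd B n c)
    {i : ℤ} (h1 : HasChord B c i) (h2 : HasChord B c (i + 2)) :
    False := by
  have h5 := five_le_of_hasChord h h1
  have hodd := Nat.odd_iff.1 h.odd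
  unfold HasChord at h1 h2
  rw [show i + 2 - 1 = i + 1 by ring, show i + 2 + 2 = i + 4 by ring] at h2
  have a1 := h.cyc.adj_of_eq (i := i - 1) (j := i) (by ring)
  have a2 := h.cyc.adj i
  have a3 := h.cyc.adj_of_eq (i := i + 2) (j := i + 3) (by ring)
  have a4 := h.cyc.adj_of_eq (i := i + 3) (j := i + 4) (by ring)
  have n1 : c (i - 1) ≠ c (i + 1) := h.cyc.ne (by omega) (by omega)
  have n2 : c (i - 1) ≠ c (i + 3) := h.cyc.ne (by omega) (by omega)
  have n3 : c i ≠ c (i + 2) := h.cyc.ne (by omega) (by omega)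
  have n4 : c i ≠ c (i + 3) := h.cyc.ne (by omega) (by omega)
  have n5 : c (i + 1) ≠ c (i + 2) := h.cyc.ne (by omega) (by omega)
  have n6 : c (i + 1) ≠ c (i + 3) := h.cyc.ne (by omega) (by omega)
  have n7 : c i ≠ c (i + 4) := h.cyc.ne (by omega) (by omega)
  have n8 : c (i + 2) ≠ c (i + 4) := h.cyc.ne (by omega) (by omega)
  rcases (show n = 5 ∨ 7 ≤ n by omega) with hn | hn
  · have e : c (i + 4) = c (i - 1) := by
      rw [show i + 4 = i - 1 + (n : ℤ) by omega, h.cyc.add_period]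
    rw [e] at h2 a4
    obtain ⟨d, hd, hdm⟩ := exists_triangle a1 h2.symm a2
    obtain ⟨d', hd', hdm'⟩ := exists_triangle h1 a4.symm a3
    obtain ⟨k, l, k', l', e1, e2, e3⟩ := hG.odd _ _ _ _ hd hd' (by decide) (by decide)
    have key : ∀ k k', d k = d' k' → d k = c (i - 1) := by
      intro k k' he
      have f1 := hdm k
      have f2 := hdm' k'
      rw [← he] at f2
      rcases f1 with f1 | f1 | f1 <;> rcases f2 with f2 | f2 | f2 <;> rw [f1] at f2 ⊢ <;>
        simp_all
    exact e3 ((key _ _ e1).trans (key _ _ e2).symm)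
  · have n9 : c (i - 1) ≠ c (i + 4) := h.cyc.ne (by omega) (by omega)
    exact false_of_hexagon hG (a := c (i - 1)) (b := c (i + 2)) (x := c (i + 3)) (y := c (i + 4))
      (z := c (i + 1)) (t := c i) (by simp [a1.ne, a2.ne', a3.ne, a4.ne, n1, n2, n3.symm, n4.symm,
        n5.symm, n6.symm, n7.symm, n8, n9, h1.ne, h2.ne']) h1 a3 a4 h2.symm a2.symm a1.symm

/-- If four consecutive positions, or two in a triangle, were all modified by twins or chords, two
of these modifications would be among the incompatible pairs `E1` to `E4`. -/
theorem exists_fixed (hG : HasSquareCircuits B) (h : IsLongestOdd B n c)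
    (hB : ∀ A : Set W, A.Subsingleton → ∀ a b, a ∉ A → b ∉ A → Linked B.Adj A a b) (i : ℤ) :
    ∃ j : ℕ, j < n - 1 ∧ j < 4 ∧ IsFixed B c (i + j) := by
  have h3 := h.cyc.three_le
  have hodd := Nat.odd_iff.1 h.odd
  have E1 : ∀ k, HasTwin B c k → ¬ HasTwin B c (k + 1) := fun k h1 h2 =>
    not_hasTwin_hasTwin hG h hB h1 h2
  have E2 : ∀ k, HasTwin B c k → ¬ HasChord B c (k + 1) := fun k h1 h2 =>
    not_hasTwin_hasChord hG h h1 h2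
  have E3 : ∀ k, HasChord B c k → ¬ HasTwin B c (k + 2) := fun k h1 h2 =>
    not_hasChord_hasTwin hG h h1 h2
  have E4 : ∀ k, HasChord B c k → ¬ HasChord B c (k + 2) := fun k h1 h2 =>
    not_hasChord_hasChord hG h h1 h2
  by_contra! hcon
  rcases (show n = 3 ∨ 5 ≤ n by omega) with hn | hn
  · have hnc : ∀ k, ¬ HasChord B c k := fun k hk => by
      have := five_le_of_hasChord h hk
      omega
    have f0 := hcon 0 (by omega) (by omega)
    have f1 := hcon 1 (by omega) (by omega)
    simp only [IsFixed, hnc, not_false_eq_true, and_true, not_not, Nat.cast_zero, add_zero,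
      Nat.cast_one] at f0 f1
    exact E1 _ f0 f1
  · have f0 := hcon 0 (by omega) (by omega)
    have f1 := hcon 1 (by omega) (by omega)
    have f2 := hcon 2 (by omega) (by omega)
    have f3 := hcon 3 (by omega) (by omega)
    unfold IsFixed at f0 f1 f2 f3
    push_cast at f0 f1 f2 f3
    rw [add_zero] at f0
    rw [show i + 1 - 1 = i by ring] at f1
    rw [show i + 2 - 1 = i + 1 by ring] at f2
    rw [show i + 3 - 1 = i + 2 by ring] at f3
    have t1 := E1 (i + 1)
    have t0' := E2 i
    have t1' := E2 (i + 1)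
    have c0 := E3 i
    have c1 := E3 (i + 1)
    have c0' := E4 i
    have c1' := E4 (i + 1)
    have c2' := E4 (i - 1)
    rw [show i + 1 + 1 = i + 2 by ring] at t1 t1'
    rw [show i + 1 + 2 = i + 3 by ring] at c1 c1'
    rw [show i - 1 + 2 = i + 1 by ring] at c2'
    simp only [not_and_or, not_not] at f0 f1 f2 f3
    -- A chord at `i + 1` leaves for position `i` only a chord at `i`. Then nothing is left for
    -- position `i + 3`.
    have hC1 : ¬ HasChord B c (i + 1) := by
      intro hC
      have hC0 : HasChord B c i := by
        rcases f0 with f | f | f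
        · exact absurd hC (t0' f)
        · exact f
        · exact absurd hC (c2' f)
      rcases f3 with f | f | f
      · exact c1 hC f
      · exact c1' hC f
      · exact c0' hC0 f
    rcases f1 with f | f | f <;> rcases f2 with f' | f' | f'
    · exact t1 f f'
    · exact t1' f f'
    · exact hC1 f'
    · exact hC1 f
    · exact hC1 f
    · exact hC1 f
    · exact c0 f f'
    · exact c0' f f'
    · exact hC1 f'

/-- A longest odd cycle has two vertices, `c 0` and `c m`, that cannot be avoided. -/
theorem exists_two_fixed (hG : HasSquareCircuits B) (h : IsLongestOdd B n c)
    (hB : ∀ A : Set W, A.Subsingleton → ∀ a b, a ∉ A → b ∉ A → Linked B.Adj A a b) :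
    ∃ (c' : ℤ → W) (m : ℕ), IsLongestOdd B n c' ∧ 0 < m ∧ m < n ∧ IsFixed B c' 0 ∧
      IsFixed B c' m := by
  obtain ⟨a, -, -, ha⟩ := exists_fixed hG h hB 0
  -- The search starts one position after the first fixed vertex, and `b < n - 1` keeps it within
  -- one turn, so the second fixed vertex is different.
  obtain ⟨b, hb1, -, hb⟩ := exists_fixed hG h hB (0 + a + 1)
  have hrange : ∀ k : ℤ, Set.range (fun i => c (k + i)) = Set.range c := by
    intro k
    ext x
    constructor
    · rintro ⟨i, rfl⟩; exact ⟨_, rfl⟩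
    · rintro ⟨i, rfl⟩; exact ⟨i - k, by simp⟩
  have htr : ∀ k i, IsFixed B c (k + i) → IsFixed B (fun i => c (k + i)) i := by
    intro k i hk
    unfold IsFixed HasTwin HasChord at hk ⊢
    rw [hrange]
    simpa only [add_sub_assoc, add_assoc] using hk
  refine ⟨fun i => c (0 + a + i), b + 1, h.shift _, by omega, by omega,
    htr _ _ (by simpa using ha), htr _ _ ?_⟩
  convert hb using 1
  push_cast
  ring

end IsLongestOdd

/-- A biconnected non-bipartite graph whose circuits are squares has two vertices `v` and `w` such
that `v` can be split to get a bipartite graph, and `w` separates the two halves. -/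
theorem HasSquareCircuits.exists_split [Finite W] (hG : HasSquareCircuits B)
    (hB : ∀ A : Set W, A.Subsingleton → ∀ a b, a ∉ A → b ∉ A → Linked B.Adj A a b)
    (hnb : ¬ B.IsBipartite) : ∃ v w, v ≠ w ∧ ∃ col lft : W → Bool,
      (∀ x y, B.Adj x y → x ≠ v → y ≠ v → col x ≠ col y) ∧
      (∀ x y, B.Adj x y → x ≠ v → y ≠ v → x ≠ w → y ≠ w → lft x = lft y) ∧
      ∀ y, B.Adj v y → y ≠ w → lft y = col y := by
  obtain ⟨n, c₀, h₀⟩ := exists_isLongestOdd hnb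
  obtain ⟨c, m, h, hm0, hmn, f0, fm⟩ := h₀.exists_two_fixed hG hB
  have hodd := Nat.odd_iff.1 h.odd
  have h3 := h.cyc.three_le
  -- The position of a vertex: its index on the cycle, or the index of the cycle vertex that it
  -- duplicates.
  have hpos : ∀ x, ∃ p : ℕ, p < n ∧ (x = c p ∨ (x ∉ Set.range c ∧
      ∀ y, B.Adj x y ↔ y = c (p - 1) ∨ y = c (p + 1))) := by
    intro x
    by_cases hx : x ∈ Set.range c
    · obtain ⟨i, rfl⟩ := hx
      obtain ⟨p, hp, he⟩ := h.cyc.exists_index 0 i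
      exact ⟨p, hp, Or.inl (by rw [he, zero_add])⟩
    · obtain ⟨i, hi⟩ := h.twin hG hB hx
      obtain ⟨p, hp, he⟩ := h.cyc.exists_index 0 i
      obtain ⟨t, ht⟩ := (h.cyc.eq_iff _ _).1 he
      refine ⟨p, hp, Or.inr ⟨hx, fun y => ?_⟩⟩
      rw [hi, (h.cyc.eq_iff (i - 1) (p - 1)).2 ⟨t, by linarith⟩,
        (h.cyc.eq_iff (i + 1) (p + 1)).2 ⟨t, by linarith⟩]
  choose pos hlt hpos using hpos
  have pos_c : ∀ p : ℕ, p < n → pos (c p) = p := by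
    intro p hp
    rcases hpos (c p) with he | he
    · by_contra hne
      have := hlt (c p)
      rcases lt_or_gt_of_ne hne with hlt' | hlt'
      · exact h.cyc.ne (i := pos (c p)) (j := p) (by omega) (by omega) he.symm
      · exact h.cyc.ne (i := p) (j := pos (c p)) (by omega) (by omega) he
    · exact absurd ⟨p, rfl⟩ he.1
  have htwin : ∀ x, x ∉ Set.range c → HasTwin B c (pos x) := by
    intro x hx
    rcases hpos x with he | he
    · exact absurd ⟨_, he.symm⟩ hx
    · exact ⟨x, hx, (he.2 _).2 (Or.inl rfl), (he.2 _).2 (Or.inr rfl)⟩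
  have hfix : ∀ (x : W) (j : ℕ), IsFixed B c j → j < n → x ≠ c j → pos x ≠ j := by
    rintro x j hj hjn hx rfl
    rcases hpos x with he | he
    · exact hx he
    · exact hj.1 (htwin x he.1)
  have hchord : ∀ k, HasChord B c (k + n) → HasChord B c k := by
    intro k hk
    unfold HasChord at hk ⊢
    rwa [show k + (n : ℤ) - 1 = k - 1 + n by ring, show k + (n : ℤ) + 2 = k + 2 + n by ring,
      h.cyc.add_period, h.cyc.add_period] at hk
  -- Along an edge the position changes by 1, or by 3 without jumping over `m`, as nothing modifies
  -- `c m`. Only edges at position 0 wrap around, as nothing modifies `c 0`.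
  have hQ : ∀ x y, B.Adj x y → pos x ≤ pos y → pos y = pos x + 1 ∨
      (pos y = pos x + 3 ∧ m ≠ pos x + 1 ∧ m ≠ pos x + 2) ∨ (pos x = 0 ∧ pos y = n - 1) ∨
      (pos x = 0 ∧ pos y = n - 3 ∧ m ≠ n - 2 ∧ m ≠ n - 1) := by
    intro x y hxy hle
    have hx := hpos x
    have hy := hpos y
    have hxn := hlt x
    have hyn := hlt y
    have px := htwin x
    have py := htwin y
    have hf0 : ∀ x, x ∉ Set.range c → pos x ≠ 0 := fun x hx h0 => f0.1 (by
      have := htwin x hx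
      rwa [h0] at this)
    rcases hx with hx | hx <;> rcases hy with hy | hy
    · generalize pos x = p at *
      generalize pos y = q at *
      subst hx hy
      have hpq : p ≠ q := by rintro rfl; exact hxy.ne rfl
      have hch := h.chord hG (i := p) (d := q - p) (by omega) (by omega) (by
        rwa [show (p : ℤ) + ((q - p : ℕ) : ℤ) = q by omega])
      rcases hch with e | e | e | e
      · left; omega
      · right; right; left; omega
      · have hC : HasChord B c ((p + 1 : ℕ) : ℤ) := by
          unfold HasChord
          rwa [show (((p + 1 : ℕ) : ℤ) - 1) = p by omega,
            show (((p + 1 : ℕ) : ℤ) + 2) = q by omega]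
        right; left
        refine ⟨by omega, ?_, ?_⟩
        · rintro rfl
          exact fm.2.1 hC
        · rintro rfl
          refine fm.2.2 ?_
          rwa [show ((p + 2 : ℕ) : ℤ) - 1 = (p + 1 : ℕ) by push_cast; ring]
      · have hC : HasChord B c ((q + 1 : ℕ) : ℤ) := by
          unfold HasChord
          rw [show (((q + 1 : ℕ) : ℤ) - 1) = q by omega,
            show (((q + 1 : ℕ) : ℤ) + 2) = p + n by omega, h.cyc.add_period]
          exact hxy.symm
        have q1 : q + 1 ≠ n := by
          intro he
          rw [he, ← zero_add (n : ℤ)] at hC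
          exact f0.2.1 (hchord _ hC)
        have q2 : q + 2 ≠ n := by
          intro he
          rw [show ((q + 1 : ℕ) : ℤ) = 0 - 1 + n by omega] at hC
          exact f0.2.2 (hchord _ hC)
        right; right; right
        refine ⟨by omega, by omega, fun hm => ?_, fun hm => ?_⟩
        · refine fm.2.1 ?_
          rwa [show m = q + 1 by omega]
        · refine fm.2.2 ?_
          rwa [show (m : ℤ) - 1 = (q + 1 : ℕ) by omega]
    · have h0 := hf0 y hy.1
      rcases (hy.2 x).1 hxy.symm with e | e
      · have : pos x = pos y - 1 := by
          rw [e, show (pos y : ℤ) - 1 = (pos y - 1 : ℕ) by omega, pos_c _ (by omega)]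
        left; omega
      · rcases (show pos y + 1 = n ∨ pos y + 1 < n by omega) with h1 | h1
        · have : pos x = 0 := by
            rw [e, show (pos y : ℤ) + 1 = 0 + n by omega, h.cyc.add_period]
            exact pos_c 0 (by omega)
          right; right; left; omega
        · have : pos x = pos y + 1 := by
            rw [e]
            exact_mod_cast pos_c _ h1
          omega
    · have h0 := hf0 x hx.1
      rcases (hx.2 y).1 hxy with e | e
      · have : pos y = pos x - 1 := by
          rw [e, show (pos x : ℤ) - 1 = (pos x - 1 : ℕ) by omega, pos_c _ (by omega)]
        omega
      · rcases (show pos x + 1 = n ∨ pos x + 1 < n by omega) with h1 | h1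
        · have : pos y = 0 := by
            rw [e, show (pos x : ℤ) + 1 = 0 + n by omega, h.cyc.add_period]
            exact pos_c 0 (by omega)
          omega
        · have : pos y = pos x + 1 := by
            rw [e]
            exact_mod_cast pos_c _ h1
          left; omega
    · rcases (hx.2 y).1 hxy with e | e
      · exact absurd ⟨_, e.symm⟩ hy.1
      · exact absurd ⟨_, e.symm⟩ hy.1
  have hv : ∀ x, x ≠ c 0 → pos x ≠ 0 := fun x hx => hfix x 0 f0 (by omega) hx
  have hw : ∀ x, x ≠ c m → pos x ≠ m := fun x hx => hfix x m fm hmn hx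
  have hv0 : pos (c 0) = 0 := pos_c 0 (by omega)
  -- The color is the parity of the position, the side is whether it lies before `m`. Neighbors of
  -- `c 0` have position 1 or 3 on the near side and `n - 1` or `n - 3`, which are even, on the far
  -- side; so there the color tells the side.
  refine ⟨c 0, c m, h.cyc.ne (by omega) (by omega), fun x => decide (pos x % 2 = 1),
    fun x => decide (pos x < m), fun x y hxy hx hy => ?_, fun x y hxy hx hy hxw hyw => ?_,
    fun y hy hyw => ?_⟩
  · rw [Ne, decide_eq_decide]
    have := hv x hx
    have := hv y hy
    rcases le_total (pos x) (pos y) with hle | hle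
    · have := hQ x y hxy hle
      omega
    · have := hQ y x hxy.symm hle
      omega
  · rw [decide_eq_decide]
    have := hv x hx
    have := hv y hy
    have := hw x hxw
    have := hw y hyw
    rcases le_total (pos x) (pos y) with hle | hle
    · have := hQ x y hxy hle
      omega
    · have := hQ y x hxy.symm hle
      omega
  · rw [decide_eq_decide]
    have := hw y hyw
    have := hlt y
    have := hQ (c 0) y hy (by omega)
    omega

end LongestOddCycle

end ToricGraph

namespace ToricGraph

/-! ### Graphs whose blocks form a chain. -/

section Chain

variable {V : Type*} {R : SimpleGraph V}

/-- The whole walk stays in the component of `s` after deletion of `z`, and `z'` is not in that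
component. -/
theorem Linked.avoid {r : V → V → Prop} {z z' s a : V} (h : Linked r {z} s a)
    (h' : ¬ Linked r {z} s z') : Linked r {z'} s a := by
  refine (h.mem_of_closed (S := {a | Linked r {z} s a ∧ Linked r {z'} s a}) ⟨.refl, .refl⟩ ?_).2
  rintro x y hxy hx hy ⟨h1, h2⟩
  have h3 := h1.trans (.single hxy hx hy)
  refine ⟨h3, h2.trans (.single hxy ?_ ?_)⟩
  · rintro rfl; exact h' h1
  · rintro rfl; exact h' h3

/-- A path from `s` that stops at `z` stays before its end in the component of `s` off `z`, so it
cannot meet `z'`. -/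
theorem Linked.of_not_linked {z z' s : V} (hconn : Linked R.Adj ∅ s z) (hz : z ≠ z')
    (h : ¬ Linked R.Adj {z} s z') : Linked R.Adj {z'} s z := by
  obtain ⟨L, q, h0, hL, hS, -, hr, -⟩ := hconn.exists_path (S := {z}) (by simp) rfl
  have hL : q L = z := hL
  rw [← h0, ← hL]
  refine linked_of_seq (Nat.zero_le _) (fun i _ hi => hr i hi) fun i _ hi he => ?_
  rcases hi.lt_or_eq with hi | rfl
  · refine h ?_
    rw [← h0, ← show q i = z' from he]
    exact linked_of_seq (Nat.zero_le _) (fun j _ hj => hr j (by omega))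
      fun j _ hj => hS j (by omega)
  · exact hz (hL.symm.trans he)

/-- A vertex that cannot be separated from two vertices of a block belongs to the block. -/
theorem IsBlock.mem_of_inseparable {X : R.Subgraph} (hX : IsBlock R X) {a b c : V} (hab : a ≠ b)
    (ha : a ∈ X.verts) (hb : b ∈ X.verts)
    (h : ∀ A : Set V, A.Subsingleton → c ∉ A →
      (a ∉ A → Linked R.Adj A a c) ∧ (b ∉ A → Linked R.Adj A b c)) : c ∈ X.verts := by
  by_contra hc
  obtain ⟨L, q, h0, hL, hS, -, hr, -⟩ :=
    ((h ∅ (by simp) (by simp)).1 (by simp)).adj_symm.exists_path (S := X.verts) (by simp) ha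
  have hL0 : L ≠ 0 := by rintro rfl; rw [h0] at hL; exact hc hL
  have hstep := hr (L - 1) (by omega)
  rw [Nat.sub_add_cancel (by omega)] at hstep
  have hcy : c ∉ ({q L} : Set V) := fun he => hc (by rw [show c = q L from he]; exact hL)
  have hlink : Linked R.Adj {q L} c (q (L - 1)) := by
    rw [← h0]
    exact linked_of_seq (Nat.zero_le _) (fun j _ hj => hr j (by omega)) fun j _ hj he =>
      hS j (by omega) (by rw [show q j = q L from he]; exact hL)
  -- Deleting the vertex `q L`, where the path enters the block, leaves `c` and the preceding path
  -- vertex linked to whichever of `a` and `b` remains. This contradicts `IsBlock.not_linked`.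
  have key := h {q L} (by simp) hcy
  by_cases hy : a = q L
  · exact hX.not_linked hL (hS (L - 1) (by omega)) hstep.symm hb
      (((key.2 fun he => hab (hy.trans he.symm)).trans hlink).adj_symm)
  · exact hX.not_linked hL (hS (L - 1) (by omega)) hstep.symm ha
      (((key.1 hy).trans hlink).adj_symm)

theorem linked_of_not_isCutVertex (hconn : ∀ a b, Linked R.Adj ∅ a b) {z : V}
    (hz : ¬ IsCutVertex R z) {a b : V} (ha : a ≠ z) (hb : b ≠ z) : Linked R.Adj {z} a b := by
  by_contra hcon
  exact hz (isCutVertex_iff.2 ⟨a, b, ha, hb, hconn a b, hcon⟩)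

/-- The cut vertices between `x₁` and `x₂`, in their order. -/
theorem exists_cut_sequence [Finite V] {x₁ x₂ : V} (hconn : ∀ a b, Linked R.Adj ∅ a b)
    (hc₁ : ¬ IsCutVertex R x₁)
    (hP : ∀ z, IsCutVertex R z → ∀ a, a ≠ z → Linked R.Adj {z} x₁ a ∨ Linked R.Adj {z} x₂ a)
    (hsep : ∀ z, IsCutVertex R z → ¬ Linked R.Adj {z} x₁ x₂) :
    ∃ (k : ℕ) (w : ℕ → V), w 0 = x₁ ∧ w (k + 1) = x₂ ∧
      (∀ z, IsCutVertex R z ↔ ∃ i, 1 ≤ i ∧ i ≤ k ∧ w i = z) ∧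
      (∀ i j, 1 ≤ i → i ≤ k → j < i → Linked R.Adj {w i} x₁ (w j)) ∧
      (∀ i j, 1 ≤ i → i ≤ k → i < j → j ≤ k + 1 → Linked R.Adj {w i} x₂ (w j)) := by
  classical
  have htotal : ∀ z z', IsCutVertex R z → IsCutVertex R z' → z ≠ z' →
      ¬ Linked R.Adj {z} x₁ z' ∨ ¬ Linked R.Adj {z'} x₁ z := by
    intro z z' hz hz' hne
    by_contra! hcon
    have h1 : ¬ Linked R.Adj {z} x₂ z' := fun h => hsep z hz (hcon.1.trans h.adj_symm)
    exact hsep z' hz' (hcon.2.trans ((hconn x₂ z).of_not_linked hne h1).adj_symm)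
  -- The size of the component of `x₁` after deletion of `z`. These components grow strictly along
  -- the cut vertices, so their size orders them.
  let rank : V → ℕ := fun z => Set.ncard {a | Linked R.Adj {z} x₁ a}
  have hrank : ∀ z z', IsCutVertex R z → z ≠ z' →
      ¬ Linked R.Adj {z} x₁ z' → rank z < rank z' := by
    intro z z' hz hne h
    refine Set.ncard_lt_ncard (Set.ssubset_iff_of_subset (fun a ha => ha.avoid h) |>.2
      ⟨z, (hconn x₁ z).of_not_linked hne h, fun hz' => ?_⟩) (Set.toFinite _)
    exact hz'.notMem (A := {z}) (fun he => hc₁ (by rw [show x₁ = z from he]; exact hz)) rfl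
  have hlt : ∀ z z', IsCutVertex R z → IsCutVertex R z' → rank z < rank z' →
      ¬ Linked R.Adj {z} x₁ z' := by
    intro z z' hz hz' hr
    have hne : z ≠ z' := by rintro rfl; omega
    rcases htotal z z' hz hz' hne with h | h
    · exact h
    · have := hrank z' z hz' hne.symm h
      omega
  have hinj : Function.Injective fun z : {z // IsCutVertex R z} => rank z := by
    intro z z' he
    by_contra hne
    have hne' : z.1 ≠ z'.1 := fun h => hne (Subtype.ext h)
    have he : rank z = rank z' := he
    rcases htotal _ _ z.2 z'.2 hne' with h | h
    · have := hrank _ _ z.2 hne' h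
      omega
    · have := hrank _ _ z'.2 hne'.symm h
      omega
  have := Fintype.ofFinite {z // IsCutVertex R z}
  let _ : LinearOrder {z // IsCutVertex R z} := LinearOrder.lift' _ hinj
  obtain ⟨k, hk⟩ : ∃ k, Fintype.card {z // IsCutVertex R z} = k := ⟨_, rfl⟩
  let e := Fintype.orderIsoFinOfCardEq {z // IsCutVertex R z} hk
  have he : ∀ i j, i < j → rank (e i) < rank (e j) := fun i j hij => e.lt_iff_lt.2 hij
  let w : ℕ → V := fun i => if i = 0 then x₁ else if h : i - 1 < k then e ⟨i - 1, h⟩ else x₂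
  have hw : ∀ i (h1 : 1 ≤ i) (h2 : i ≤ k), w i = e ⟨i - 1, by omega⟩ := by
    intro i h1 h2
    simp only [w]
    rw [if_neg (by omega), dif_pos (by omega)]
  have hw0 : w 0 = x₁ := rfl
  have hwl : w (k + 1) = x₂ := by
    simp only [w]
    rw [if_neg (by omega), dif_neg (by omega)]
  have hcut : ∀ i, 1 ≤ i → i ≤ k → IsCutVertex R (w i) := by
    intro i h1 h2
    rw [hw i h1 h2]
    exact (e _).2
  have hord : ∀ i j, 1 ≤ i → i < j → j ≤ k → rank (w i) < rank (w j) := by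
    intro i j h1 h2 h3
    rw [hw i h1 (by omega), hw j (by omega) h3]
    exact he _ _ (by rw [Fin.lt_def]; simp; omega)
  refine ⟨k, w, hw0, hwl, fun z => ⟨fun hz => ?_, ?_⟩, fun i j h1 h2 h3 => ?_,
    fun i j h1 h2 h3 h4 => ?_⟩
  · refine ⟨(e.symm ⟨z, hz⟩).val + 1, by omega, (e.symm ⟨z, hz⟩).isLt, ?_⟩
    rw [hw _ (by omega) (e.symm ⟨z, hz⟩).isLt]
    simp
  · rintro ⟨i, h1, h2, rfl⟩
    exact hcut i h1 h2
  · rcases Nat.eq_zero_or_pos j with rfl | hj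
    · exact .refl
    · have hr := hord j i hj h3 h2
      exact (hconn _ _).of_not_linked (by rintro h; rw [h] at hr; omega)
        (hlt _ _ (hcut j hj (by omega)) (hcut i h1 h2) hr)
  · rcases h4.lt_or_eq with h4 | rfl
    · have hr := hord i j h1 h3 (by omega)
      exact (hP _ (hcut i h1 h2) (w j) (by rintro h; rw [h] at hr; omega)).resolve_left
        (hlt _ _ (hcut i h1 h2) (hcut j (by omega) (by omega)) hr)
    · rw [hwl]; exact .refl

/-- With `x₁` and `x₂` as ends of the sequence of cut vertices, consecutive members lie in a common
block, and every block arises in this way. -/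
theorem exists_isBlockChain [Finite V] {x₁ x₂ : V} (hx : x₁ ≠ x₂)
    (hconn : ∀ a b, Linked R.Adj ∅ a b) (hc₁ : ¬ IsCutVertex R x₁) (hc₂ : ¬ IsCutVertex R x₂)
    (hP : ∀ z, IsCutVertex R z → ∀ a, a ≠ z → Linked R.Adj {z} x₁ a ∨ Linked R.Adj {z} x₂ a)
    (hex : ∃ z, IsCutVertex R z) :
    ∃ k B B', 1 ≤ k ∧ IsBlockChain R k B B' ∧ x₁ ∈ B.1.verts ∧ x₂ ∈ B'.1.verts := by
  classical
  have hsep : ∀ z, IsCutVertex R z → ¬ Linked R.Adj {z} x₁ x₂ := by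
    intro z hz hl
    obtain ⟨a, b, ha, hb, -, hab⟩ := isCutVertex_iff.1 hz
    have key : ∀ a, a ≠ z → Linked R.Adj {z} x₁ a := fun a ha =>
      (hP z hz a ha).elim id fun h => hl.trans h
    exact hab ((key a ha).adj_symm.trans (key b hb))
  obtain ⟨k, w, hw0, hwl, hcut, hleft, hright⟩ := exists_cut_sequence hconn hc₁ hP hsep
  have hk : 1 ≤ k := by
    obtain ⟨z, hz⟩ := hex
    obtain ⟨i, h1, h2, -⟩ := (hcut z).1 hz
    omega
  have hcut' : ∀ i, 1 ≤ i → i ≤ k → IsCutVertex R (w i) := fun i h1 h2 =>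
    (hcut _).2 ⟨i, h1, h2, rfl⟩
  have hne : ∀ i j, i < j → j ≤ k + 1 → w i ≠ w j := by
    intro i j hij hj he
    rcases Nat.eq_zero_or_pos i with rfl | hi
    · rcases hj.lt_or_eq with hj | rfl
      · exact hc₁ (by rw [← hw0, he]; exact hcut' j (by omega) (by omega))
      · exact hx (by rw [← hw0, he, hwl])
    · refine (hright i j hi (by omega) hij hj).notMem (fun h => hc₂ ?_) he.symm
      rw [show x₂ = w i from h]
      exact hcut' i hi (by omega)
  have hbetween : ∀ i j l, j < i → i < l → 1 ≤ i → i ≤ k → l ≤ k + 1 →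
      ¬ Linked R.Adj {w i} (w j) (w l) := by
    intro i j l h1 h2 h3 h4 h5 h
    exact hsep _ (hcut' i h3 h4)
      ((hleft i j h3 h4 h1).trans (h.trans (hright i l h3 h4 h2 h5).adj_symm))
  -- A cut vertex other than `w i` and `w (i + 1)` has both of them on the same side, so nothing
  -- separates the two.
  have hD : ∀ i : Fin (k + 1), ∃ D : R.Subgraph, IsBlock R D ∧ w i ∈ D.verts ∧
      w (i + 1) ∈ D.verts := by
    intro i
    refine exists_isBlock_of_inseparable (hne _ _ (by omega) (by omega)) fun A hA h1 h2 => ?_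
    rcases hA.eq_empty_or_singleton with rfl | ⟨z, rfl⟩
    · exact hconn _ _
    by_cases hz : IsCutVertex R z
    · obtain ⟨j, hj1, hj2, rfl⟩ := (hcut z).1 hz
      have hji : j ≠ i := by rintro rfl; exact h1 rfl
      have hji' : j ≠ i + 1 := by rintro rfl; exact h2 rfl
      rcases (show j < i ∨ i + 1 < j by omega) with h | h
      · exact (hright j i hj1 hj2 h (by omega)).adj_symm.trans
          (hright j (i + 1) hj1 hj2 (by omega) (by omega))
      · exact (hleft j i hj1 hj2 (by omega)).adj_symm.trans (hleft j (i + 1) hj1 hj2 h)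
    · exact linked_of_not_isCutVertex hconn hz h1 h2
  choose D hD hDl hDr using hD
  have hmem : ∀ (i : Fin (k + 1)) j, j ≤ k + 1 → (w j ∈ (D i).verts ↔ j = i ∨ j = i + 1) := by
    intro i j hj
    constructor
    · intro hjD
      by_contra! hcon
      have hi := i.isLt
      have link : ∀ z a b, a ∈ (D i).verts → b ∈ (D i).verts → a ≠ z → b ≠ z →
          Linked R.Adj {z} a b := fun z a b ha hb haz hbz =>
        ((isBlock_iff.1 (hD i)).1.2 {z} (by simp) a ha b hb haz hbz).mono
          (fun _ _ h => h.adj_sub) subset_rfl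
      rcases (show j < i ∨ i + 1 < j by omega) with h | h
      · exact hbetween i j (i + 1) h (by omega) (by omega) (by omega) (by omega)
          (link _ _ _ hjD (hDr i) (hne _ _ h (by omega)) (hne _ _ (by omega) (by omega)).symm)
      · exact hbetween (i + 1) i j (by omega) h (by omega) (by omega) hj
          (link _ _ _ (hDl i) hjD (hne _ _ (by omega) (by omega)) (hne _ _ h hj).symm)
    · rintro (rfl | rfl)
      · exact hDl i
      · exact hDr i
  have hnbr : ∀ x, ∃ y, R.Adj x y := by
    intro x
    obtain ⟨y, hy⟩ : ∃ y, x ≠ y := by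
      by_cases h : x = x₁
      · exact ⟨x₂, h ▸ hx⟩
      · exact ⟨x₁, h⟩
    rcases Relation.ReflTransGen.cases_head (hconn x y) with h | ⟨e, h, -⟩
    · exact absurd h hy
    · exact ⟨e, h.1⟩
  have hall : ∀ E : R.Subgraph, IsBlock R E → ∃ i, D i = E := by
    intro E hE
    obtain ⟨a, b, hab⟩ := hE.exists_adj hnbr
    -- `E` lies on the `x₂` side of `w j`. With `i` the last such index, or 0, no vertex separates
    -- `E` from `w i` or from `w (i + 1)`, so `E` contains both and equals `D i`.
    let right : ℕ → Prop := fun j => ∃ a ∈ E.verts, a ≠ w j ∧ Linked R.Adj {w j} x₂ a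
    have hrt : ∀ j, right j → ∀ a ∈ E.verts, a ≠ w j → Linked R.Adj {w j} x₂ a := by
      rintro j ⟨a, ha, haw, hl⟩ a' ha' haw'
      exact hl.trans (((isBlock_iff.1 hE).1.2 {w j} (by simp) a ha a' ha' haw haw').mono
        (fun _ _ h => h.adj_sub) subset_rfl)
    have hlf : ∀ j, 1 ≤ j → j ≤ k → ¬ right j → ∀ a ∈ E.verts, a ≠ w j →
        Linked R.Adj {w j} x₁ a := by
      intro j h1 h2 hnr a ha haw
      exact (hP _ (hcut' j h1 h2) a haw).resolve_right fun h => hnr ⟨a, ha, haw, h⟩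
    obtain ⟨i, hik, hi, himax⟩ : ∃ i ≤ k, (i = 0 ∨ right i) ∧ ∀ j, i < j → j ≤ k → ¬ right j := by
      refine ⟨Nat.findGreatest (fun j => j = 0 ∨ right j) k, Nat.findGreatest_le _,
        Nat.findGreatest_spec (P := fun j => j = 0 ∨ right j) (Nat.zero_le k) (Or.inl rfl),
        fun j h1 h2 h3 => ?_⟩
      exact Nat.findGreatest_is_greatest h1 h2 (Or.inr h3)
    have key : ∀ a ∈ E.verts, ∀ A : Set V, A.Subsingleton → a ∉ A →
        (w i ∉ A → Linked R.Adj A a (w i)) ∧ (w (i + 1) ∉ A → Linked R.Adj A a (w (i + 1))) := by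
      intro a ha A hA haA
      rcases hA.eq_empty_or_singleton with rfl | ⟨z, rfl⟩
      · exact ⟨fun _ => hconn _ _, fun _ => hconn _ _⟩
      by_cases hz : IsCutVertex R z
      · obtain ⟨j, hj1, hj2, rfl⟩ := (hcut z).1 hz
        rcases lt_trichotomy j i with h | rfl | h
        · have hl : Linked R.Adj {w j} x₂ a := by
            by_cases hai : a = w i
            · rw [hai]; exact hright j i hj1 hj2 h (by omega)
            · refine (hrt i (hi.resolve_left (by omega)) a ha hai).avoid fun hcon => ?_
              exact hsep _ (hcut' i (by omega) hik)
                ((hleft i j (by omega) hik h).trans hcon.adj_symm)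
          exact ⟨fun _ => hl.adj_symm.trans (hright j i hj1 hj2 h (by omega)),
            fun _ => hl.adj_symm.trans (hright j (i + 1) hj1 hj2 (by omega) (by omega))⟩
        · exact ⟨fun h => absurd rfl h, fun _ =>
            (hrt j (hi.resolve_left (by omega)) a ha haA).adj_symm.trans
              (hright j (j + 1) hj1 hj2 (by omega) (by omega))⟩
        · have hl := hlf j hj1 hj2 (himax j h hj2) a ha haA
          refine ⟨fun _ => hl.adj_symm.trans (hleft j i hj1 hj2 h), fun hne' => ?_⟩
          have : j ≠ i + 1 := by rintro rfl; exact hne' rfl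
          exact hl.adj_symm.trans (hleft j (i + 1) hj1 hj2 (by omega))
      · exact ⟨fun h => linked_of_not_isCutVertex hconn hz haA h,
          fun h => linked_of_not_isCutVertex hconn hz haA h⟩
    have h1 : w i ∈ E.verts := hE.mem_of_inseparable hab.adj_sub.ne hab.fst_mem hab.snd_mem
      fun A hA h => ⟨fun ha => (key a hab.fst_mem A hA ha).1 h,
        fun hb => (key b hab.snd_mem A hA hb).1 h⟩
    have h2 : w (i + 1) ∈ E.verts := hE.mem_of_inseparable hab.adj_sub.ne hab.fst_mem hab.snd_mem
      fun A hA h => ⟨fun ha => (key a hab.fst_mem A hA ha).2 h,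
        fun hb => (key b hab.snd_mem A hA hb).2 h⟩
    exact ⟨⟨i, by omega⟩, (hD _).eq_of_two hE (hne i (i + 1) (by omega) (by omega)) (hDl ⟨i, _⟩) h1
      (hDr ⟨i, _⟩) h2⟩
  -- Even positions of the path carry the blocks `D`, odd positions the cut vertices between them.
  let φ : Fin (2 * k + 1) → {B : R.Subgraph // IsBlock R B} ⊕ {v : V // IsCutVertex R v} :=
    fun i => if h : i.val % 2 = 0 then Sum.inl ⟨D ⟨i / 2, by omega⟩, hD _⟩
      else Sum.inr ⟨w ((i + 1) / 2), hcut' _ (by omega) (by omega)⟩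
  have φeven : ∀ i : Fin (2 * k + 1), i.val % 2 = 0 →
      φ i = Sum.inl ⟨D ⟨i / 2, by omega⟩, hD _⟩ := fun i h => dif_pos h
  have φodd : ∀ i : Fin (2 * k + 1), (h : ¬ i.val % 2 = 0) →
      φ i = Sum.inr ⟨w ((i + 1) / 2), hcut' _ (by omega) (by omega)⟩ := fun i h => dif_neg h
  have hbij : Function.Bijective φ := by
    constructor
    · intro i j hij
      by_cases hi : i.val % 2 = 0 <;> by_cases hj : j.val % 2 = 0
      · rw [φeven i hi, φeven j hj] at hij
        have hDD := congrArg Subtype.val (Sum.inl.inj hij)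
        simp only at hDD
        have m1 := hDr ⟨i / 2, by omega⟩
        rw [hDD, hmem _ _ (by simp; omega)] at m1
        have m2 := hDr ⟨j / 2, by omega⟩
        rw [← hDD, hmem _ _ (by simp; omega)] at m2
        simp only at m1 m2
        ext
        omega
      · rw [φeven i hi, φodd j hj] at hij
        exact absurd hij (by simp)
      · rw [φodd i hi, φeven j hj] at hij
        exact absurd hij (by simp)
      · rw [φodd i hi, φodd j hj] at hij
        have hww := congrArg Subtype.val (Sum.inr.inj hij)
        simp only at hww
        have : (i.val + 1) / 2 = (j.val + 1) / 2 := by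
          by_contra hcon
          rcases lt_or_gt_of_ne hcon with h | h
          · exact hne _ _ h (by omega) hww
          · exact hne _ _ h (by omega) hww.symm
        ext
        omega
    · rintro (⟨E, hE⟩ | ⟨z, hz⟩)
      · obtain ⟨i, rfl⟩ := hall E hE
        refine ⟨⟨2 * i, by omega⟩, ?_⟩
        rw [φeven _ (by simp)]
        congr 3
        ext
        simp
      · obtain ⟨i, h1, h2, rfl⟩ := (hcut z).1 hz
        refine ⟨⟨2 * i - 1, by omega⟩, ?_⟩
        rw [φodd _ (by simp; omega)]
        congr 3
        simp only
        omega
  have hadj : ∀ i j : Fin (2 * k + 1), i.val % 2 = 0 → ¬ j.val % 2 = 0 →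
      ((blockTree R).Adj (φ i) (φ j) ↔ i.val + 1 = j.val ∨ j.val + 1 = i.val) := by
    intro i j hi hj
    rw [φeven i hi, φodd j hj, blockTree_adj]
    simp only
    rw [hmem _ _ (by omega)]
    simp only
    omega
  refine ⟨k, ⟨D 0, hD 0⟩, ⟨D (Fin.last k), hD _⟩, hk,
    ⟨⟨Equiv.ofBijective φ hbij, fun {i j} => ?_⟩, ?_, ?_⟩, ?_, ?_⟩
  · rw [SimpleGraph.pathGraph_adj]
    simp only [Equiv.ofBijective_apply]
    by_cases hi : i.val % 2 = 0 <;> by_cases hj : j.val % 2 = 0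
    · rw [φeven i hi, φeven j hj]
      exact iff_of_false not_blockTree_adj (by omega)
    · exact hadj i j hi hj
    · rw [SimpleGraph.adj_comm, hadj j i hj hi, or_comm]
    · rw [φodd i hi, φodd j hj]
      exact iff_of_false (by simp [blockTree]) (by omega)
  · show φ 0 = _
    rw [φeven _ (by simp)]
    congr 3
    ext
    simp
  · show φ (Fin.last (2 * k)) = _
    rw [φeven _ (by simp)]
    congr 3
    ext
    simp
  · rw [← hw0]
    exact hDl 0
  · rw [← hwl]
    exact hDr (Fin.last k)

end Chain

end ToricGraph

namespace ToricGraph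

/-! ### Splitting a vertex into a necklace. -/

section Necklace

variable {W : Type*} {B : SimpleGraph W}

theorem HasSquareCircuits.coe {V : Type*} {G : SimpleGraph V} (hG : HasSquareCircuits G)
    (C : G.Subgraph) : HasSquareCircuits C.coe where
  even n c hc := hG.even n _ hc.of_coe
  odd n c m d hc hd hn hm := by
    obtain ⟨i, j, i', j', h1, h2, h3⟩ := hG.odd _ _ _ _ hc.of_coe hd.of_coe hn hm
    exact ⟨i, j, i', j', Subtype.ext h1, Subtype.ext h2, fun h => h3 (congrArg Subtype.val h)⟩
  not_K4 x y z t h1 h2 h3 h4 h5 h6 := hG.not_K4 x y z t (C.adj_sub h1) (C.adj_sub h2)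
    (C.adj_sub h3) (C.adj_sub h4) (C.adj_sub h5) (C.adj_sub h6)

open Classical in
/-- The color of a vertex after the splitting of `v` into `x₁` and `x₂`. -/
noncomputable def splitColor {U : Type*} (π : U → W) (x₁ x₂ : U) (col : W → Bool) (a : U) : Bool :=
  if a = x₁ then false else if a = x₂ then true else col (π a)

/-- The graph obtained by splitting a vertex, which keeps the edges between different colors. -/
def splitGraph {U : Type*} (B : SimpleGraph W) (π : U → W) (f : U → Bool) : SimpleGraph U where
  Adj a b := B.Adj (π a) (π b) ∧ f a ≠ f b
  symm := ⟨fun _ _ h => ⟨h.1.symm, h.2.symm⟩⟩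
  loopless := ⟨fun _ h => h.2 rfl⟩

/-- The neighbors of `v` of color `true` stay with `x₁`, those of color `false` with `x₂`, so `R` is
bipartite. The vertex over `w` separates the two copies, so a cycle of `R` contains at most one of
them and projects to an even cycle of `B`, which has length 4. -/
theorem isNecklaceK2_of_split [Finite W] (hG : HasSquareCircuits B)
    (hB : ∀ A : Set W, A.Subsingleton → ∀ a b, a ∉ A → b ∉ A → Linked B.Adj A a b)
    (hnb : ¬ B.IsBipartite) {w : W} {col lft : W → Bool} {n : ℕ} {π : Fin n → W} {x₁ x₂ : Fin n}
    (hvw : π x₁ ≠ w) (hx : x₁ ≠ x₂) (hsurj : Function.Surjective π)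
    (hπ : ∀ a b, π a = π b ↔ a = b ∨ (a = x₁ ∧ b = x₂) ∨ (a = x₂ ∧ b = x₁))
    (hcol : ∀ x y, B.Adj x y → x ≠ π x₁ → y ≠ π x₁ → col x ≠ col y)
    (hlft : ∀ x y, B.Adj x y → x ≠ π x₁ → y ≠ π x₁ → x ≠ w → y ≠ w → lft x = lft y)
    (hlc : ∀ y, B.Adj (π x₁) y → y ≠ w → lft y = col y) : IsNecklaceK2 B := by
  classical
  set v := π x₁ with hv
  set f := splitColor π x₁ x₂ col with hf
  have hf1 : f x₁ = false := by simp [hf, splitColor]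
  have hf2 : f x₂ = true := by simp [hf, splitColor, hx.symm]
  have hf3 : ∀ a, a ≠ x₁ → a ≠ x₂ → f a = col (π a) := fun a h1 h2 => by
    simp [hf, splitColor, h1, h2]
  set R := splitGraph B π f with hR
  have hv2 : π x₂ = v := (hπ _ _).2 (Or.inr (Or.inr ⟨rfl, rfl⟩))
  have hπv : ∀ a, π a = v ↔ a = x₁ ∨ a = x₂ := by
    intro a
    rw [hv, hπ]
    constructor
    · rintro (h | ⟨h, -⟩ | ⟨h, -⟩)
      · exact Or.inl h
      · exact Or.inl h
      · exact Or.inr h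
    · rintro (h | h)
      · exact Or.inl h
      · exact Or.inr (Or.inr ⟨h, rfl⟩)
  obtain ⟨s, hs⟩ := hsurj.hasRightInverse
  have hs1 : ∀ x, x ≠ v → s x ≠ x₁ := fun x hx h => hx (by rw [← hs x, h])
  have hs2 : ∀ x, x ≠ v → s x ≠ x₂ := fun x hx h => hx (by rw [← hs x, h, hv2])
  have hsπ : ∀ a, a ≠ x₁ → a ≠ x₂ → s (π a) = a := by
    intro a h1 h2
    rcases (hπ _ _).1 (hs (π a)) with h | h | h
    · exact h
    · exact absurd h.2 h2
    · exact absurd h.2 h1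
  have hfs : ∀ x, x ≠ v → f (s x) = col x := fun x hx => by
    rw [hf3 _ (hs1 x hx) (hs2 x hx), hs x]
  have hadj : ∀ x y, B.Adj x y → x ≠ v → y ≠ v → R.Adj (s x) (s y) := by
    intro x y hxy hxv hyv
    refine ⟨by rwa [hs x, hs y], ?_⟩
    rw [hfs x hxv, hfs y hyv]
    exact hcol x y hxy hxv hyv
  have hadj1 : ∀ x, B.Adj x v → col x = true → R.Adj (s x) x₁ := by
    intro x hx hc
    refine ⟨by rwa [hs x], ?_⟩
    rw [hfs x hx.ne, hf1, hc]
    decide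
  have hadj2 : ∀ x, B.Adj x v → col x = false → R.Adj (s x) x₂ := by
    intro x hx hc
    refine ⟨by rwa [hs x, hv2], ?_⟩
    rw [hfs x hx.ne, hf2, hc]
    decide
  have hfree : ∀ a, a ≠ x₁ → a ≠ x₂ → Linked R.Adj {x₁, x₂} a (s w) := by
    intro a h1 h2
    have hav : π a ≠ v := fun h => ((hπv a).1 h).elim h1 h2
    have := (hB {v} (by simp) (π a) w hav hvw.symm).image (r' := R.Adj) (A' := {x₁, x₂}) s
      fun x y hxy hx hy => ⟨hadj x y hxy hx hy, by simp [hs1 x hx, hs2 x hx],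
        by simp [hs1 y hy, hs2 y hy]⟩
    rwa [hsπ a h1 h2] at this
  -- Both colors occur among the neighbors of `v`, since otherwise `v` could be given the other
  -- color and `B` would be bipartite.
  obtain ⟨y₁, hy₁, hc₁⟩ : ∃ y, B.Adj y v ∧ col y = true := by
    by_contra! hcon
    refine hnb (isBipartite_iff_bool.2 ⟨fun x => if x = v then true else col x, fun x y hxy => ?_⟩)
    by_cases hxv : x = v
    · have := hcon y (hxv ▸ hxy.symm)
      simp [hxv, (hxv ▸ hxy.ne' : y ≠ v), this]
    · by_cases hyv : y = v
      · have := hcon x (hyv ▸ hxy)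
        simp [hxv, hyv, this]
      · simpa [hxv, hyv] using hcol x y hxy hxv hyv
  obtain ⟨y₂, hy₂, hc₂⟩ : ∃ y, B.Adj y v ∧ col y = false := by
    by_contra! hcon
    refine hnb (isBipartite_iff_bool.2 ⟨fun x => if x = v then false else col x, fun x y hxy => ?_⟩)
    by_cases hxv : x = v
    · have := hcon y (hxv ▸ hxy.symm)
      simp [hxv, (hxv ▸ hxy.ne' : y ≠ v), this]
    · by_cases hyv : y = v
      · have := hcon x (hyv ▸ hxy)
        simp [hxv, hyv, this]
      · simpa [hxv, hyv] using hcol x y hxy hxv hyv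
  have hA1 := hadj1 y₁ hy₁ hc₁
  have hA2 := hadj2 y₂ hy₂ hc₂
  have hl1 : Linked R.Adj {x₂} x₁ (s w) := by
    refine (Linked.single hA1.symm (by simpa using hx) (by simpa using hs2 _ hy₁.ne)).trans ?_
    exact (hfree _ (hs1 _ hy₁.ne) (hs2 _ hy₁.ne)).mono (fun _ _ h => h) (by simp)
  have hl2 : Linked R.Adj {x₁} x₂ (s w) := by
    refine (Linked.single hA2.symm (by simpa using hx.symm) (by simpa using hs1 _ hy₂.ne)).trans ?_
    exact (hfree _ (hs1 _ hy₂.ne) (hs2 _ hy₂.ne)).mono (fun _ _ h => h) (by simp)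
  have hto1 : ∀ a, a ≠ x₁ → Linked R.Adj {x₁} a (s w) := by
    intro a ha
    by_cases h2 : a = x₂
    · rw [h2]; exact hl2
    · exact (hfree a ha h2).mono (fun _ _ h => h) (by simp)
  have hto2 : ∀ a, a ≠ x₂ → Linked R.Adj {x₂} a (s w) := by
    intro a ha
    by_cases h1 : a = x₁
    · rw [h1]; exact hl1
    · exact (hfree a h1 ha).mono (fun _ _ h => h) (by simp)
  have hconn : ∀ a b, Linked R.Adj ∅ a b := by
    have : ∀ a, Linked R.Adj ∅ a (s w) := by
      intro a
      by_cases h1 : a = x₁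
      · exact (hto2 a (by rw [h1]; exact hx)).mono (fun _ _ h => h) (by simp)
      · exact (hto1 a h1).mono (fun _ _ h => h) (by simp)
    exact fun a b => (this a).trans (this b).adj_symm
  have hcut1 : ¬ IsCutVertex R x₁ := by
    rw [isCutVertex_iff]
    rintro ⟨a, b, ha, hb, -, h⟩
    exact h ((hto1 a ha).trans (hto1 b hb).adj_symm)
  have hcut2 : ¬ IsCutVertex R x₂ := by
    rw [isCutVertex_iff]
    rintro ⟨a, b, ha, hb, -, h⟩
    exact h ((hto2 a ha).trans (hto2 b hb).adj_symm)
  have hsw1 : x₁ ≠ s w := (hs1 w hvw.symm).symm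
  have hsw2 : x₂ ≠ s w := (hs2 w hvw.symm).symm
  have hsep : ¬ Linked R.Adj {s w} x₁ x₂ := by
    intro hl
    -- Starting from `x₁`, one stays on the left side until `w` is met: at `v` the color equals the
    -- side, so left neighbors are attached to `x₁` and none to `x₂`.
    have := hl.mem_of_closed (S := {a | a = x₁ ∨ (a ≠ x₁ ∧ a ≠ x₂ ∧ lft (π a) = true)})
      (Or.inl rfl) (by
        intro a b hab ha hb haS
        have hπw : ∀ c, c ≠ s w → π c ≠ w := by
          intro c hc he
          refine hc ?_
          rw [← he]
          refine (hsπ c ?_ ?_).symm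
          · rintro rfl; exact hvw he
          · rintro rfl; exact hvw (hv2.symm.trans he)
        rcases haS with rfl | ⟨h1, h2, h3⟩
        · have hb1 : b ≠ a := hab.ne'
          have hb2 : b ≠ x₂ := by
            rintro rfl
            exact hab.1.ne hv2.symm
          refine Or.inr ⟨hb1, hb2, ?_⟩
          rw [hlc _ hab.1 (hπw b hb), ← hf3 b hb1 hb2]
          have := hab.2
          rw [hf1] at this
          simpa using this.symm
        · by_cases hb1 : b = x₁
          · exact Or.inl hb1
          have hav : π a ≠ v := fun h => ((hπv a).1 h).elim h1 h2
          have hb2 : b ≠ x₂ := by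
            rintro rfl
            have h4 := hab.2
            rw [hf2, hf3 a h1 h2] at h4
            have h5 := hab.1
            rw [hv2] at h5
            rw [hlc _ h5.symm (hπw a ha)] at h3
            exact h4 h3
          refine Or.inr ⟨hb1, hb2, ?_⟩
          rw [← h3]
          exact (hlft _ _ hab.1 hav (fun h => ((hπv b).1 h).elim hb1 hb2) (hπw a ha)
            (hπw b hb)).symm)
    rcases this with h | h
    · exact hx h.symm
    · exact h.2.1 rfl
  -- Without `π z` the vertex `π a` still reaches `v` in `B`. The color of the last vertex before
  -- `v` decides whether the lifted path ends in `x₁` or `x₂`.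
  have hP : ∀ z, IsCutVertex R z → ∀ a, a ≠ z →
      Linked R.Adj {z} x₁ a ∨ Linked R.Adj {z} x₂ a := by
    intro z hz a haz
    have hz1 : z ≠ x₁ := by rintro rfl; exact hcut1 hz
    have hz2 : z ≠ x₂ := by rintro rfl; exact hcut2 hz
    by_cases h1 : a = x₁
    · rw [h1]; exact Or.inl .refl
    by_cases h2 : a = x₂
    · rw [h2]; exact Or.inr .refl
    have hzv : π z ≠ v := fun h => ((hπv z).1 h).elim hz1 hz2
    have hav : π a ≠ v := fun h => ((hπv a).1 h).elim h1 h2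
    have haz' : π a ≠ π z := by
      intro h
      rcases (hπ _ _).1 h with h | h | h
      · exact haz h
      · exact h1 h.1
      · exact h2 h.1
    obtain ⟨L, q, h0, hL, hS, -, hr, hA⟩ :=
      (hB {π z} (by simp) (π a) v haz' hzv.symm).exists_path (S := {v}) haz' rfl
    have hL : q L = v := hL
    have hL0 : L ≠ 0 := by rintro rfl; exact hav (h0.symm.trans hL)
    have hlast := hr (L - 1) (by omega)
    rw [Nat.sub_add_cancel (by omega), hL] at hlast
    have hsq : ∀ i ≤ L, s (q i) ∉ ({z} : Set (Fin n)) := fun i hi he =>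
      hA i hi (by rw [← hs (q i), show s (q i) = z from he]; rfl)
    have hlink : Linked R.Adj {z} (s (q 0)) (s (q (L - 1))) :=
      linked_of_seq (q := fun i => s (q i)) (Nat.zero_le _)
        (fun i _ hi => hadj _ _ (hr i (by omega)) (hS i (by omega)) (hS (i + 1) (by omega)))
        fun i _ hi => hsq i (by omega)
    rw [h0, hsπ a h1 h2] at hlink
    by_cases hc : col (q (L - 1)) = true
    · exact Or.inl (hlink.trans (.single (hadj1 _ hlast hc) (hsq _ (by omega)) hz1.symm)).adj_symm
    · exact Or.inr (hlink.trans (.single (hadj2 _ hlast (by simpa using hc)) (hsq _ (by omega))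
        hz2.symm)).adj_symm
  have hproper : ∀ a b, R.Adj a b → f a ≠ f b := fun a b h => h.2
  -- A cycle through both copies would link them without the vertex over `w`, because deleting one
  -- vertex does not disconnect a cycle. So `π` is injective on every cycle.
  have hfour : ∀ m c, IsCyc R m c → m = 4 := by
    intro m c hc
    have hnot : ∀ i j, c i = x₁ → c j = x₂ → False := by
      intro i j hi hj
      have := hc.inseparable.2 {s w} (by simp) x₁ ⟨i, hi⟩ x₂ ⟨j, hj⟩ hsw1 hsw2
      exact hsep (this.mono (fun _ _ h => h.adj_sub) subset_rfl)
    refine hG.even m _ (hc.map (f := π) (fun i => (hc.adj i).1) fun i j hij => ?_)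
      (hc.even_of_coloring hproper)
    rcases (hπ _ _).1 hij with h | h | h
    · exact h
    · exact (hnot i j h.1 h.2).elim
    · exact (hnot j i h.2 h.1).elim
  have hnbr : ∀ a, ∃ b, R.Adj a b := by
    intro a
    by_cases h1 : a = x₁
    · exact ⟨_, h1 ▸ hA1.symm⟩
    · rcases Relation.ReflTransGen.cases_head (hconn a x₁) with h | ⟨e, h, -⟩
      · exact absurd h h1
      · exact ⟨e, h.1⟩
  obtain ⟨k, D, D', hk, hchain, hD, hD'⟩ := exists_isBlockChain hx hconn hcut1 hcut2 hP
    ⟨s w, isCutVertex_iff.2 ⟨x₁, x₂, hsw1, hsw2, hconn _ _, hsep⟩⟩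
  refine ⟨n, R, k, D, D', x₁, x₂, π, isBipartite_iff_bool.2 ⟨f, hproper⟩, hk, hchain, ?_, hD, hD',
    hcut1, hcut2, fun h => h.1.ne hv2.symm, ?_, hsurj, hπ, ?_⟩
  · exact fun C hC => hC.isK2_or_isCutEdge hnbr fun m c hc => hfour m _ hc.of_coe
  · obtain ⟨p, hp⟩ := (reachable_iff_linked.2 (hconn x₁ x₂)).exists_walk_length_eq_dist
    rw [← hp]
    refine (SimpleGraph.Coloring.odd_length_iff_not_congr
      (SimpleGraph.Coloring.mk f fun {a b} h => hproper a b h) p).2 ?_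
    change (¬ f x₁ = true) ↔ f x₂ = true
    simp [hf1, hf2]
  · ext x y
    constructor
    · intro hxy
      refine ⟨hxy.ne, ?_⟩
      by_cases hxv : x = v
      · subst hxv
        by_cases hc : col y = true
        · exact ⟨_, _, (hadj1 y hxy.symm hc).symm, rfl, hs y⟩
        · exact ⟨_, _, (hadj2 y hxy.symm (by simpa using hc)).symm, hv2, hs y⟩
      · by_cases hyv : y = v
        · subst hyv
          by_cases hc : col x = true
          · exact ⟨_, _, hadj1 x hxy hc, hs x, rfl⟩
          · exact ⟨_, _, hadj2 x hxy (by simpa using hc), hs x, hv2⟩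
        · exact ⟨_, _, hadj x y hxy hxv hyv, hs x, hs y⟩
    · rintro ⟨-, a, b, hab, rfl, rfl⟩
      exact hab.1

theorem HasSquareCircuits.isNecklaceK2 [Finite W] (hG : HasSquareCircuits B) (hB : IsBiconnected B)
    (hnb : ¬ B.IsBipartite) : IsNecklaceK2 B := by
  classical
  have := Fintype.ofFinite W
  have hbi := (isBiconnected_iff.1 hB).2
  obtain ⟨v, w, hvw, col, lft, h1, h2, h3⟩ := hG.exists_split hbi hnb
  -- The extra element `none` is the second copy of `v`, and `getD v` identifies it with the first.
  let e : Fin (Fintype.card (Option W)) ≃ Option W := (Fintype.equivFin _).symm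
  have hv : ((e (e.symm (some v))).getD v) = v := by simp
  refine isNecklaceK2_of_split hG hbi hnb (w := w) (col := col) (lft := lft)
    (π := fun a => (e a).getD v) (x₁ := e.symm (some v)) (x₂ := e.symm none) ?_ ?_ ?_ ?_ ?_ ?_ ?_
  · rw [hv]; exact hvw
  · exact fun h => by simpa using e.symm.injective h
  · exact fun x => ⟨e.symm (some x), by simp⟩
  · intro a b
    obtain ⟨a, rfl⟩ := e.symm.surjective a
    obtain ⟨b, rfl⟩ := e.symm.surjective b
    simp only [Equiv.apply_symm_apply, EmbeddingLike.apply_eq_iff_eq]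
    rcases a with _ | a <;> rcases b with _ | b <;> simp [eq_comm]
  · rw [hv]; exact h1
  · rw [hv]; exact h2
  · rw [hv]; exact h3

end Necklace

/-! ### The block structure of the whole graph. -/

section Main

variable {V : Type*} {G : SimpleGraph V}

/-- Any odd cycle shares two vertices with a given one, and blocks with two common vertices
coincide. So all odd cycles lie in a single block. -/
theorem HasSquareCircuits.exists_block [Finite V] (hG : HasSquareCircuits G) (hconn : G.Connected)
    (hnb : ¬ G.IsBipartite) :
    ∃ B : G.Subgraph, IsBlock G B ∧ ¬ B.coe.IsBipartite ∧ IsNecklaceK2 B.coe ∧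
      ∀ C : G.Subgraph, IsBlock G C → C ≠ B →
        C.coe.IsBipartite ∧ (IsK2 C.coe ∨ IsCutEdge G C) := by
  obtain ⟨n, c, hc, hn⟩ := exists_odd_isCyc hnb
  obtain ⟨B, hB, hadj⟩ := hc.exists_isBlock
  have hBnb : ¬ B.coe.IsBipartite := by
    intro h
    obtain ⟨f, hf⟩ := isBipartite_iff_bool.1 h
    exact Nat.not_even_iff_odd.2 hn ((hc.coe hadj).even_of_coloring hf)
  refine ⟨B, hB, hBnb, (hG.coe B).isNecklaceK2 (isBiconnected_coe_iff.2 (isBlock_iff.1 hB).1) hBnb,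
    fun C hC hCB => ?_⟩
  have hbip : C.coe.IsBipartite := by
    by_contra h
    obtain ⟨m, d, hd, hm⟩ := exists_odd_isCyc h
    obtain ⟨i, j, i', j', h1, h2, h3⟩ := hG.odd _ _ _ _ hc hd.of_coe hn hm
    exact hCB (hC.eq_of_two hB h3 (h1 ▸ (d i').2) (hadj i).fst_mem (h2 ▸ (d j').2) (hadj j).fst_mem)
  refine ⟨hbip, hC.isK2_or_isCutEdge (fun x => ?_) fun m d hd => ?_⟩
  · obtain ⟨y, hy⟩ : ∃ y, x ≠ y := by
      by_cases h : x = c 0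
      · exact ⟨c 1, by rw [h]; exact (hc.adj 0).ne⟩
      · exact ⟨c 0, h⟩
    rcases Relation.ReflTransGen.cases_head (reachable_iff_linked.1 (hconn.preconnected x y))
      with h | ⟨e, h, -⟩
    · exact absurd h hy
    · exact ⟨e, h.1⟩
  · obtain ⟨f, hf⟩ := isBipartite_iff_bool.1 hbip
    exact (hG.coe C).even _ _ hd (hd.even_of_coloring hf)

end Main

end ToricGraph


theorem theorem3p15 {V : Type*} [Finite V] (K : Type*) [Field K] (G : SimpleGraph V)
    (hconn : G.Connected) (hG : ¬ G.IsBipartite) :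
    (ToricGraph.IsRobust (ToricGraph.graphIdeal K G) ∧
      ToricGraph.IsGeneratedByQuadrics (ToricGraph.graphIdeal K G)) ↔
    ∃ B : G.Subgraph, ToricGraph.IsBlock G B ∧ ¬ B.coe.IsBipartite ∧
      (ToricGraph.IsK2PlusEdge B.coe ∨ ToricGraph.IsDoubleK2 B.coe ∨
        ToricGraph.IsNecklaceK2 B.coe) ∧
      ∀ C : G.Subgraph, ToricGraph.IsBlock G C → C ≠ B →
        C.coe.IsBipartite ∧ (ToricGraph.IsK2 C.coe ∨ ToricGraph.IsCutEdge G C) := by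
  constructor
  · rintro ⟨hr, hq⟩
    obtain ⟨B, h1, h2, h3, h4⟩ :=
      (ToricGraph.hasSquareCircuits_of_robust hconn hr hq).exists_block hconn hG
    -- The block is always exhibited as a necklace; the other two alternatives are treated only in
    -- the converse.
    exact ⟨B, h1, h2, Or.inr (Or.inr h3), h4⟩
  · rintro ⟨B, -, -, hB, hC⟩
    have hpoles : ToricGraph.HasPoles B.coe := by
      rcases hB with h | h | h
      · exact h.hasPoles
      · exact h.hasPoles
      · exact h.hasPoles
    have hsq : ToricGraph.HasSquareCircuits G := hpoles.hasSquareCircuits fun C hCB hne n c hc => by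
      rcases (hC C hCB hne).2 with h | h
      · exact hc.length_of_isK2 h
      · exact absurd hc (ToricGraph.not_isCyc_of_isCutEdge h)
    exact ⟨hsq.hasQuadraticFibers.isRobust, hsq.hasQuadraticFibers.isGeneratedByQuadrics⟩
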